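/- An instance of the length-constrained problem $\ell$-TEDSC, or of the lifespan-constrained problem $\tau$-TEDSC, is a tuple $\mathcal I=(G,D,k,h)$, where $G=(V,E)$ is a finite directed graph, $D$ is a finite set of demands $(u,v,t)$ with $(u,v)\in E$ and $t\in\{1,2,\dots\}$, and $k,h\in\mathbb N$. Put $\Lambda=\max_{(u,v,t)\in D}t$ ($\Lambda=0$ if $D=\emptyset$). A temporal walk $p$ is a sequence $(v_0,t_0),\dots,(v_\ell,t_\ell)$ with $t_0<t_1<\dots<t_\ell$ such that $(v_{i-1},v_i)\in E$ and $1\le t_{i-1}\le\Lambda$ for all $1\le i\le\ell$. Its temporal edges are $((v_{i-1},v_i),t_{i-1})$, $1\le i\le \ell$; its length is $\ell(p)=\ell$ and its lifespan is $\tau(p)=t_\ell-t_0$. The question is whether there is a set $S$ of at most $k$ temporal walks such that no two distinct walks of $S$ share a temporal edge, every demand $(u,v,t)\in D$ is a temporal edge $((u,v),t)$ of some walk of $S$, and every $p\in S$ satisfies $\ell(p)\le h$ (for $\ell$-TEDSC), respectively $\tau(p)\le h$ (for $\tau$-TEDSC). Let $|\mathcal I|$ be the length of the encoding of $\mathcal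 I$ as a word that lists $k$, $h$, the vertices, the edges and the demands, with all numbers, in particular $k$, $h$ and the time steps, written in binary. **Theorem.** Both $\ell$-TEDSC and $\tau$-TEDSC parameterized by $k$ are in $\mathsf{XP}$: for each of the two problems there are computable functions $f,g:\mathbb N\to\mathbb N$ and a (multi-tape) Turing machine that decides every instance $\mathcal I$ in at most $f(k)\cdot|\mathcal I|^{g(k)}$ steps. More precisely, there is a constant $c$ such that each of the two problems is decided by a Turing machine in at most $|\mathcal I|^{c(k+1)}$ steps, that is, in time $|\mathcal I|^{O(k)}$ (for $k\ge 1$). -/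

import Mathlib

namespace TEDSC

/-! ### Temporal graphs, temporal walks, schedules -/

/-- A temporal graph: a directed static graph with a labeling of its edges by sets of time steps.
Labels of pairs that are not edges of the static graph play no role. -/
structure TemporalGraph (V : Type*) where
  graph : Digraph V
  label : V → V → Set ℕ

/-- `𝒢.TimeEdge u v t`: the time-edge `((u, v), t)` belongs to `𝒢`. -/
def TemporalGraph.TimeEdge {V : Type*} (𝒢 : TemporalGraph V) (u v : V) (t : ℕ) : Prop :=
  𝒢.graph.Adj u v ∧ t ∈ 𝒢.label u v

/-- A (strict) temporal walk `(v₀, t₀), (v₁, t₁), …, (v_ℓ, t_ℓ)`: the time steps are strictly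
increasing and `((v_i, v_{i+1}), t_i)` is a time-edge for every `i < ℓ`. -/
structure TemporalWalk {V : Type*} (𝒢 : TemporalGraph V) where
  /-- the number `ℓ(p)` of time-edges -/
  length : ℕ
  vert : Fin (length + 1) → V
  time : Fin (length + 1) → ℕ
  time_strictMono : StrictMono time
  timeEdge : ∀ i : Fin length, 𝒢.TimeEdge (vert i.castSucc) (vert i.succ) (time i.castSucc)

namespace TemporalWalk

variable {V : Type*} {𝒢 : TemporalGraph V}

/-- The set of time-edges of a walk. -/
def timeEdges (p : TemporalWalk 𝒢) : Set ((V × V) × ℕ) :=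
  Set.range fun i : Fin p.length => ((p.vert i.castSucc, p.vert i.succ), p.time i.castSucc)

/-- The lifespan `τ(p) = t_ℓ - t₀` of a walk. -/
def lifespan (p : TemporalWalk 𝒢) : ℕ :=
  p.time (Fin.last p.length) - p.time 0

/-- Two walks are temporally edge disjoint (TED) if they share no time-edge. -/
def TED (p q : TemporalWalk 𝒢) : Prop :=
  Disjoint p.timeEdges q.timeEdges

end TemporalWalk

/-- The lifetime `Λ(D)` of a draft schedule: the latest time step with a demand
(`0` if there is no demand). -/
def lifetime {V : Type*} (D : Finset (V × V × ℕ)) : ℕ :=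
  D.sup fun d => d.2.2

/-- The temporal graph `𝒢(G, D)`: every edge of `G` is available at all the time steps
`1, …, Λ(D)`. -/
def temporalGraph {V : Type*} (G : Digraph V) (D : Finset (V × V × ℕ)) : TemporalGraph V where
  graph := G
  label _ _ := Set.Icc 1 (lifetime D)

/-- A schedule for `D`: a finite set of temporal walks in `𝒢(G, D)` that are pairwise TED. -/
def IsSchedule {V : Type*} {G : Digraph V} {D : Finset (V × V × ℕ)}
    (S : Finset (TemporalWalk (temporalGraph G D))) : Prop :=
  (S : Set (TemporalWalk (temporalGraph G D))).Pairwise TemporalWalk.TED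

/-- `S` extends `D`: every demand is traversed by some walk of `S`. -/
def Extends {V : Type*} {G : Digraph V} {D : Finset (V × V × ℕ)}
    (S : Finset (TemporalWalk (temporalGraph G D))) : Prop :=
  ∀ u v t, (u, v, t) ∈ D → ∃ p ∈ S, ((u, v), t) ∈ p.timeEdges

/-- The question of the length-constrained problem `ℓ`-TEDSC. -/
def LengthFeasible {V : Type*} (G : Digraph V) (D : Finset (V × V × ℕ)) (k h : ℕ) : Prop :=
  ∃ S : Finset (TemporalWalk (temporalGraph G D)),
    IsSchedule S ∧ Extends S ∧ S.card ≤ k ∧ ∀ p ∈ S, p.length ≤ h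

/-- The question of the lifespan-constrained problem `τ`-TEDSC. -/
def LifespanFeasible {V : Type*} (G : Digraph V) (D : Finset (V × V × ℕ)) (k h : ℕ) : Prop :=
  ∃ S : Finset (TemporalWalk (temporalGraph G D)),
    IsSchedule S ∧ Extends S ∧ S.card ≤ k ∧ ∀ p ∈ S, p.lifespan ≤ h

/-! ### Problem instances and their binary encoding -/

/-- An instance `(G, D, k, h)` of the constrained problems. The vertices are `0, …, n - 1`; the edge
set and the set of demands are given by listings (in any order, repetitions being immaterial).
Each demand `(u, v, t)` asks for an edge `(u, v)` of the graph at a positive time step `t`. -/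
structure Instance where
  n : ℕ
  edges : List (Fin n × Fin n)
  demands : List (Fin n × Fin n × ℕ)
  k : ℕ
  h : ℕ
  demand_edge : ∀ d ∈ demands, (d.1, d.2.1) ∈ edges
  demand_time : ∀ d ∈ demands, 1 ≤ d.2.2

/-- The directed static graph of an instance. -/
def Instance.graph (I : Instance) : Digraph (Fin I.n) where
  Adj u v := (u, v) ∈ I.edges

/-- The draft schedule of an instance. -/
def Instance.draft (I : Instance) : Finset (Fin I.n × Fin I.n × ℕ) :=
  I.demands.toFinset

/-- The tape alphabet for encoded instances. -/
inductive Sym where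
  | bit (b : Bool)
  | comma
  | semicolon

/-- A natural number in binary (least significant bit first), closed by a comma. -/
def encodeNum (x : ℕ) : List Sym :=
  x.bits.map Sym.bit ++ [Sym.comma]

/-- A list of numbers, closed by a semicolon. -/
def encodeList (l : List ℕ) : List Sym :=
  l.flatMap encodeNum ++ [Sym.semicolon]

/-- The encoding of an instance lists `k`, `h`, the vertices, the edges and the demands, with all
numbers (in particular `k`, `h` and the time steps) in binary. -/
def Instance.encode (I : Instance) : List Sym :=
  encodeList [I.k] ++ encodeList [I.h] ++ encodeList (List.range I.n) ++
    encodeList (I.edges.flatMap fun e => [(e.1 : ℕ), (e.2 : ℕ)]) ++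
    encodeList (I.demands.flatMap fun d => [(d.1 : ℕ), (d.2.1 : ℕ), d.2.2])

theorem encodeNum_cancel {a b : ℕ} {s t : List Sym}
    (e : encodeNum a ++ s = encodeNum b ++ t) : a = b ∧ s = t := by
  have hn : ∀ x : ℕ, Sym.comma ∉ x.bits.map Sym.bit := by simp
  have key : ∀ l l' : List Sym, Sym.comma ∉ l → Sym.comma ∉ l' →
      l ++ Sym.comma :: s = l' ++ Sym.comma :: t → l = l' ∧ s = t := by
    intro l
    induction l with
    | nil =>
      intro l' _ hl' hs
      cases l' with
      | nil => exact ⟨rfl, (List.cons.inj hs).2⟩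
      | cons y l' => exact absurd (by rw [(List.cons.inj hs).1]; exact List.mem_cons_self) hl'
    | cons x l ih =>
      intro l' hl hl' hs
      cases l' with
      | nil => exact absurd (by rw [(List.cons.inj hs).1]; exact List.mem_cons_self) hl
      | cons y l' =>
        simp only [List.cons_append, List.cons.injEq, List.mem_cons, not_or] at hs hl hl'
        obtain ⟨i1, i2⟩ := ih l' hl.2 hl'.2 hs.2
        exact ⟨by rw [hs.1, i1], i2⟩
  simp only [encodeNum, List.append_assoc, List.singleton_append] at e
  obtain ⟨h1, h2⟩ := key _ _ (hn a) (hn b) e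
  refine ⟨?_, h2⟩
  have h3 : a.bits = b.bits :=
    List.map_injective_iff.2 (fun x y hxy => by simpa using hxy) h1
  have h4 := congrArg (List.foldr (fun c m => Nat.bit c m) 0) h3
  have h5 : ∀ x : ℕ, List.foldr (fun c m => Nat.bit c m) 0 x.bits = x := by
    intro x
    induction x using Nat.binaryRec' with
    | zero => simp
    | bit c m hc ih => rw [Nat.bits_append_bit m c hc, List.foldr_cons, ih]
  rwa [h5, h5] at h4

theorem encodeList_cancel {l l' : List ℕ} {s t : List Sym}
    (e : encodeList l ++ s = encodeList l' ++ t) : l = l' ∧ s = t := by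
  have hne : ∀ (x : ℕ) (r r' : List Sym), encodeNum x ++ r ≠ Sym.semicolon :: r' := by
    intro x r r'
    unfold encodeNum
    cases x.bits <;> simp
  induction l generalizing l' with
  | nil =>
    cases l' with
    | nil => simpa [encodeList] using e
    | cons b l' =>
      simp only [encodeList, List.flatMap_nil, List.flatMap_cons, List.append_assoc,
        List.nil_append, List.singleton_append] at e
      exact absurd e.symm (hne _ _ _)
  | cons a l ih =>
    cases l' with
    | nil =>
      simp only [encodeList, List.flatMap_nil, List.flatMap_cons, List.append_assoc,
        List.nil_append, List.singleton_append] at e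
      exact absurd e (hne _ _ _)
    | cons b l' =>
      simp only [encodeList, List.flatMap_cons, List.append_assoc] at e
      obtain ⟨h1, h2⟩ := encodeNum_cancel e
      have h3 := ih (l' := l') (by simpa [encodeList] using h2)
      exact ⟨by rw [h1, h3.1], h3.2⟩

theorem Instance.encode_injective : Function.Injective Instance.encode := by
  rintro ⟨n, E, D, k, h, h1, h2⟩ ⟨n', E', D', k', h', h1', h2'⟩ e
  simp only [Instance.encode, List.append_assoc] at e
  obtain ⟨ek, e1⟩ := encodeList_cancel e
  obtain ⟨eh, e2⟩ := encodeList_cancel e1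
  obtain ⟨en, e3⟩ := encodeList_cancel e2
  obtain ⟨eE, e4⟩ := encodeList_cancel e3
  obtain ⟨eD, -⟩ := encodeList_cancel (s := []) (t := []) (by simpa using e4)
  have en' : n = n' := by simpa using congrArg List.length en
  subst en'
  have hE : E = E' := by
    clear h1 h1' h2 h2' e e1 e2 e3 e4 eD
    induction E generalizing E' with
    | nil => cases E' <;> simp_all
    | cons a E ih =>
      cases E' with
      | nil => simp at eE
      | cons b E' =>
        simp only [List.flatMap_cons, List.cons_append, List.nil_append, List.cons.injEq] at eE
        rw [ih E' eE.2.2, Prod.ext (Fin.ext eE.1) (Fin.ext eE.2.1)]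
  have hD : D = D' := by
    clear h1 h1' h2 h2' e e1 e2 e3 e4
    induction D generalizing D' with
    | nil => cases D' <;> simp_all
    | cons a D ih =>
      cases D' with
      | nil => simp at eD
      | cons b D' =>
        simp only [List.flatMap_cons, List.cons_append, List.nil_append, List.cons.injEq] at eD
        rw [ih D' eD.2.2.2, Prod.ext (Fin.ext eD.1) (Prod.ext (Fin.ext eD.2.1) eD.2.2.1)]
  subst hE hD
  simp_all

/-! ### Parameterized problems and the class XP -/

/-- A parameterized decision problem: instances, written as words over an alphabet by an injective
encoding, a parameter of each instance, and the set of YES-instances. -/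
structure ParamProblem where
  Inst : Type
  Alphabet : Type
  encode : Inst → List Alphabet
  encode_injective : Function.Injective encode
  param : Inst → ℕ
  yes : Inst → Prop

/-- The size `|I|` of an instance: the length of its encoding. -/
def ParamProblem.size (P : ParamProblem) (I : P.Inst) : ℕ :=
  (P.encode I).length

open Classical in
/-- A single multi-stack Turing machine, with finite alphabets, that on (the encoding of) every
instance `I` halts after at most `T I` steps and outputs the bit that tells whether `I` is a
YES-instance. -/
def ParamProblem.DecidableInTime (P : ParamProblem) (T : P.Inst → ℕ) : Prop :=
  ∃ M : Turing.TM2ComputableAux P.Alphabet Bool,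
    (∀ i : M.tm.K, Finite (M.tm.Γ i)) ∧
    ∀ I : P.Inst, Nonempty (Turing.TM2OutputsInTime M.tm
      ((P.encode I).map M.inputAlphabet.invFun)
      (some ((Computability.encodeBool (decide (P.yes I))).map M.outputAlphabet.invFun))
      (T I))

/-- The class XP: the problem is decided by one algorithm in time `f(k) · |I|^{g(k)}`, for
computable functions `f` and `g` of the parameter `k`. -/
def ParamProblem.InXP (P : ParamProblem) : Prop :=
  ∃ f g : ℕ → ℕ, Computable f ∧ Computable g ∧
    P.DecidableInTime fun I => f (P.param I) * P.size I ^ g (P.param I)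

/-- The problem `ℓ`-TEDSC parameterized by the number `k` of walks. -/
def lengthTEDSC : ParamProblem where
  Inst := Instance
  Alphabet := Sym
  encode := Instance.encode
  encode_injective := Instance.encode_injective
  param := Instance.k
  yes I := LengthFeasible I.graph I.draft I.k I.h

/-- The problem `τ`-TEDSC parameterized by the number `k` of walks. -/
def lifespanTEDSC : ParamProblem where
  Inst := Instance
  Alphabet := Sym
  encode := Instance.encode
  encode_injective := Instance.encode_injective
  param := Instance.k
  yes I := LifespanFeasible I.graph I.draft I.k I.h

end TEDSC

/-!
Both problems are decided by a dynamic program that keeps track of all the walkers at once. It is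
fast enough for the following reasons.

*Few walks.* Choosing for each demand one walk that meets it, and discarding the others, one may
assume that there are at most `m = min k |D|` walks, one for every element of `Instance.walkers`.

*Few time steps.* Time steps are written in binary, so `Λ` may be exponential in the size of the
instance, and the program cannot go through all the time steps up to `Λ`. However, between two
consecutive demand times `d < d'` the walkers merely have to get from where they are after `d` to
where they are needed at `d'`. If `d' ≤ d + m n`, then there are few time steps between them anyway.
Otherwise, the moves of walker `i` in this gap may be replaced by a walk that leaves no vertex
twice, in the block `d + i n + 1, …, d + (i + 1) n` of time steps that is reserved for this walker;
thus no two walkers conflict there. Moves before the first and after the last demand of a walk are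
dropped. Neither the length nor the lifespan of a walk grows (`exists_rescheduled`,
`IsPlan.exists_times`), and the walkers move only at the polynomially many time steps `t` such that
`d ≤ t ≤ d + m n` for some demand time `d` (`Instance.times`).

*Few states.* At each of these time steps, the program stores for each walker the edge along which it
has moved, whether it has just moved, and a label: the number of moves so far for the length
constraint, and a lower bound for the times of its moves, guessed at the start, for the lifespan
constraint. There are polynomially many such data for one walker, hence `|I| ^ O(k)` states. Only the
last edge has to be known to keep walks disjoint, because walks can only meet in a temporal edge at
the present time step. The program is correct by `exists_traced` and `exists_mem_reachAfter`.

*Machines.* To bound the running time on a stack machine, `FP f` says that `f`, a function between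
types whose elements are encoded by binary trees (`TreeEnc`), is computed in polynomial time by a
program of a small while-language over stacks (`Prog`), and `FPB B f` says that it is computed in
time polynomial in `B`. Both classes are closed under pairing, composition with functions in `FP`,
and iterations through lists whose intermediate results stay small (`FPB.foldl`), so that the dynamic program belongs to
`FPB stateBound` by its very form (`FPB.answer`). Programs are compiled to stack machines
(`Prog.machine_outputs`, `FPB.exists_machine`).
-/

namespace TEDSC

open Turing Function

/-! ### A while-language over stacks and its compilation to stack machines -/

instance : DecidableEq Sym := fun a b => by
  cases a <;> cases b <;> simp only [Sym.bit.injEq, reduceCtorEq] <;> infer_instance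

instance : Fintype Sym :=
  ⟨{.bit false, .bit true, .comma, .semicolon}, fun s => by
    rcases s with (_ | _) | _ | _ <;> simp⟩

/-- The stacks of the machines: the input, the main stack (which also receives the output), a
stack for saved values, and two auxiliary tapes for moving a tree from one stack to another. -/
inductive Stk where
  | inp
  | main
  | save
  | tmp
  | cnt
  deriving DecidableEq

instance : Fintype Stk :=
  ⟨{.inp, .main, .save, .tmp, .cnt}, fun k => by cases k <;> simp⟩

/-- The stack alphabets. -/
abbrev Stk.Alph : Stk → Type
  | .inp => Sym
  | .main => Bool
  | .save => Bool
  | .tmp => Bool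
  | .cnt => Bool

/-- The internal memory of the machines: the symbol popped last, `none` for an empty stack. -/
abbrev Mem := Option Sym

/-- The states of a running program: the memory and the stack contents. -/
abbrev PState := Mem × (∀ k : Stk, List k.Alph)

/-- Structured programs over the stacks. -/
inductive Prog where
  | push (k : Stk) (f : Mem → k.Alph)
  | pop (k : Stk) (f : Option k.Alph → Mem)
  | load (f : Mem → Mem)
  | seq (p q : Prog)
  | ite (c : Mem → Bool) (p q : Prog)
  | loop (c : Mem → Bool) (p : Prog)

namespace Prog

/-- `Run p s n s'`: the program `p`, started in the state `s`, stops in the state `s'` after `n`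
elementary steps. -/
inductive Run : Prog → PState → ℕ → PState → Prop
  | push (k f v S) : Run (push k f) (v, S) 1 (v, update S k (f v :: S k))
  | pop (k f v S) : Run (pop k f) (v, S) 1 (f (S k).head?, update S k (S k).tail)
  | load (f v S) : Run (load f) (v, S) 1 (f v, S)
  | seq {p q s n s' m s''} : Run p s n s' → Run q s' m s'' → Run (seq p q) s (n + m) s''
  | iteTrue {c p q v S n s'} : c v = true → Run p (v, S) n s' → Run (ite c p q) (v, S) (n + 1) s'
  | iteFalse {c p q v S n s'} : c v = false → Run q (v, S) n s' → Run (ite c p q) (v, S) (n + 1) s'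
  | loopTrue {c p v S n s' m s''} : c v = true → Run p (v, S) n s' → Run (loop c p) s' m s'' →
      Run (loop c p) (v, S) (n + m + 1) s''
  | loopFalse {c p v S} : c v = false → Run (loop c p) (v, S) 1 (v, S)

/-- The labels of the stack machine that executes a program. -/
def Lab : Prog → Type
  | push _ _ => Unit
  | pop _ _ => Unit
  | load _ => Unit
  | seq p q => Lab p ⊕ Lab q
  | ite _ p q => Option (Lab p ⊕ Lab q)
  | loop _ p => Option (Lab p)

instance Lab.fintype : ∀ p : Prog, Fintype (Lab p)
  | push _ _ => inferInstanceAs (Fintype Unit)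
  | pop _ _ => inferInstanceAs (Fintype Unit)
  | load _ => inferInstanceAs (Fintype Unit)
  | seq p q =>
    have := Lab.fintype p
    have := Lab.fintype q
    inferInstanceAs (Fintype (Lab p ⊕ Lab q))
  | ite _ p q =>
    have := Lab.fintype p
    have := Lab.fintype q
    inferInstanceAs (Fintype (Option (Lab p ⊕ Lab q)))
  | loop _ p =>
    have := Lab.fintype p
    inferInstanceAs (Fintype (Option (Lab p)))

/-- The label at which the execution of a program starts. -/
def entry : ∀ p : Prog, Lab p
  | push _ _ => ()
  | pop _ _ => ()
  | load _ => ()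
  | seq p _ => Sum.inl (entry p)
  | ite _ _ _ => (none : Option _)
  | loop _ _ => (none : Option _)

/-- The code of a program inside a machine with labels `Λ`, in which the labels of the program are
placed by `emb`, and which continues at the label `exit` after the program. -/
def code {Λ : Type} : ∀ p : Prog, (Lab p → Λ) → Λ → Lab p → TM2.Stmt Stk.Alph Λ Mem
  | push k f, _, exit, _ => .push k f (.goto fun _ => exit)
  | pop k f, _, exit, _ => .pop k (fun _ o => f o) (.goto fun _ => exit)
  | load f, _, exit, _ => .load f (.goto fun _ => exit)
  | seq p q, emb, exit, l =>
    match (l : Lab p ⊕ Lab q) with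
    | .inl l => code p (fun l => emb (Sum.inl l : Lab p ⊕ Lab q))
        (emb (Sum.inr (entry q) : Lab p ⊕ Lab q)) l
    | .inr l => code q (fun l => emb (Sum.inr l : Lab p ⊕ Lab q)) exit l
  | ite c p q, emb, exit, l =>
    match (l : Option (Lab p ⊕ Lab q)) with
    | none => .branch c (.goto fun _ => emb (some (Sum.inl (entry p)) : Option (Lab p ⊕ Lab q)))
        (.goto fun _ => emb (some (Sum.inr (entry q)) : Option (Lab p ⊕ Lab q)))
    | some (.inl l) => code p (fun l => emb (some (Sum.inl l) : Option (Lab p ⊕ Lab q))) exit l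
    | some (.inr l) => code q (fun l => emb (some (Sum.inr l) : Option (Lab p ⊕ Lab q))) exit l
  | loop c p, emb, exit, l =>
    match (l : Option (Lab p)) with
    | none => .branch c (.goto fun _ => emb (some (entry p) : Option (Lab p)))
        (.goto fun _ => exit)
    | some l => code p (fun l => emb (some l : Option (Lab p))) (emb (none : Option (Lab p))) l

/-- `StepsTo f n a b`: from `a`, exactly `n` steps of `f` lead to `b`. -/
def StepsTo {σ : Type*} (f : σ → Option σ) (n : ℕ) (a b : σ) : Prop :=
  (flip bind f)^[n] (some a) = some b

theorem StepsTo.trans {σ : Type*} {f : σ → Option σ} {n m : ℕ} {a b c : σ}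
    (h : StepsTo f n a b) (h' : StepsTo f m b c) : StepsTo f (n + m) a c := by
  unfold StepsTo at *
  rw [Nat.add_comm, iterate_add_apply, h, h']

theorem StepsTo.one {σ : Type*} {f : σ → Option σ} {a b : σ} (h : f a = some b) :
    StepsTo f 1 a b := by
  simpa [StepsTo, flip] using h

/-- Compilation is correct, step by step. -/
theorem Run.stepsTo {p : Prog} {s s' : PState} {n : ℕ} (h : Run p s n s') {Λ : Type}
    (M : Λ → TM2.Stmt Stk.Alph Λ Mem) (emb : Lab p → Λ) (exit : Λ)
    (hM : ∀ l, M (emb l) = code p emb exit l) :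
    StepsTo (TM2.step M) n ⟨some (emb (entry p)), s.1, s.2⟩ ⟨some exit, s'.1, s'.2⟩ := by
  induction h generalizing exit with
  | push k f v S => exact .one (by simp [hM, code])
  | pop k f v S => exact .one (by simp [hM, code])
  | load f v S => exact .one (by simp [hM, code])
  | @seq p q s n s' m s'' _ _ ih ih' =>
    exact (ih (fun l => emb (Sum.inl l : Lab p ⊕ Lab q)) (emb (Sum.inr (entry q) : Lab p ⊕ Lab q))
      fun l => hM (Sum.inl l : Lab p ⊕ Lab q)).trans
        (ih' (fun l => emb (Sum.inr l : Lab p ⊕ Lab q)) exit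
          fun l => hM (Sum.inr l : Lab p ⊕ Lab q))
  | @iteTrue c p q v S n s' hc _ ih =>
    rw [Nat.add_comm]
    refine StepsTo.trans (.one ?_) (ih (fun l => emb (some (Sum.inl l) : Option (Lab p ⊕ Lab q)))
      exit fun l => hM (some (Sum.inl l) : Option (Lab p ⊕ Lab q)))
    simp only [entry, TM2.step, hM (none : Option _), code, TM2.stepAux, hc, cond_true]
  | @iteFalse c p q v S n s' hc _ ih =>
    rw [Nat.add_comm]
    refine StepsTo.trans (.one ?_) (ih (fun l => emb (some (Sum.inr l) : Option (Lab p ⊕ Lab q)))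
      exit fun l => hM (some (Sum.inr l) : Option (Lab p ⊕ Lab q)))
    simp only [entry, TM2.step, hM (none : Option _), code, TM2.stepAux, hc, cond_false]
  | @loopTrue c p v S n s' m s'' hc _ _ ih ih' =>
    rw [Nat.add_comm]
    refine StepsTo.trans (.one ?_) ((ih (fun l => emb (some l : Option (Lab p)))
      (emb (none : Option (Lab p))) fun l => hM (some l : Option (Lab p))).trans
        (ih' emb exit hM))
    simp only [entry, TM2.step, hM (none : Option _), code, TM2.stepAux, hc, cond_true]
  | @loopFalse c p v S hc =>
    refine .one ?_
    simp only [entry, TM2.step, hM (none : Option _), code, TM2.stepAux, hc, cond_false]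

/-- The stack machine that executes a program. -/
def machine (p : Prog) : FinTM2 where
  K := Stk
  k₀ := .inp
  k₁ := .main
  Γ := Stk.Alph
  Λ := Option (Lab p)
  main := some (entry p)
  σ := Mem
  initialState := none
  Γk₀Fin := inferInstanceAs (Fintype Sym)
  m := fun l => match l with
    | none => .halt
    | some l => code p some none l

/-- Stack contents, listed. -/
def tapes (i : List Sym) (m s t c : List Bool) : ∀ k : Stk, List k.Alph
  | .inp => i
  | .main => m
  | .save => s
  | .tmp => t
  | .cnt => c

section tapes

variable (i : List Sym) (m s t c x : List Bool)

@[simp] theorem tapes_inp : tapes i m s t c .inp = i := rfl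
@[simp] theorem tapes_main : tapes i m s t c .main = m := rfl
@[simp] theorem tapes_save : tapes i m s t c .save = s := rfl
@[simp] theorem tapes_tmp : tapes i m s t c .tmp = t := rfl
@[simp] theorem tapes_cnt : tapes i m s t c .cnt = c := rfl

@[simp] theorem update_tapes_inp (x : List Sym) :
    update (tapes i m s t c) .inp x = tapes x m s t c := by
  funext k; cases k <;> rfl

@[simp] theorem update_tapes_main : update (tapes i m s t c) .main x = tapes i x s t c := by
  funext k; cases k <;> rfl

@[simp] theorem update_tapes_save : update (tapes i m s t c) .save x = tapes i m x t c := by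
  funext k; cases k <;> rfl

@[simp] theorem update_tapes_tmp : update (tapes i m s t c) .tmp x = tapes i m s x c := by
  funext k; cases k <;> rfl

@[simp] theorem update_tapes_cnt : update (tapes i m s t c) .cnt x = tapes i m s t x := by
  funext k; cases k <;> rfl

end tapes

/-- The machine of a program computes what the program computes. -/
theorem machine_outputs {p : Prog} {w : List Sym} {b : Bool} {n : ℕ}
    (h : Run p (none, tapes w [] [] [] []) n (none, tapes [] [b] [] [] [])) {t : ℕ}
    (ht : n + 1 ≤ t) :
    Nonempty (TM2OutputsInTime (machine p) w (some [b]) t) := by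
  have h1 := h.stepsTo (machine p).m some none fun l => rfl
  have h2 : StepsTo (machine p).step (n + 1) (initList (machine p) w)
      (haltList (machine p) [b]) := by
    have e1 : initList (machine p) w =
        ⟨some (some (entry p)), none, tapes w [] [] [] []⟩ := by
      unfold initList
      congr 1
      funext k; cases k <;> rfl
    have e2 : haltList (machine p) [b] = ⟨none, none, tapes [] [b] [] [] []⟩ := by
      unfold haltList
      congr 1
      funext k; cases k <;> rfl
    rw [e1, e2]
    exact StepsTo.trans h1 (.one rfl)
  exact ⟨⟨⟨n + 1, h2⟩, ht⟩⟩

end Prog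

end TEDSC

namespace TEDSC

open Turing Function

/-! ### Binary trees on stacks -/

/-- Binary trees, the universal data type of the computations below. -/
inductive Tree where
  | nil
  | cons (a b : Tree)

/-- The Polish notation of a tree. It is self-delimiting. -/
def Tree.ser : Tree → List Bool
  | nil => [false]
  | cons a b => true :: (a.ser ++ b.ser)

namespace Prog

theorem Run.cast {p : Prog} {s s' : PState} {n m : ℕ} (h : Run p s n s') (e : n = m) :
    Run p s m s' := e ▸ h

/-- Read a symbol of the stack `k`, whose alphabet is identified with `Bool` by `r`. -/
def read (k : Stk) (r : k.Alph → Bool) : Prog :=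
  pop k fun o => o.map fun x => .bit (r x)

/-- The bit stored in the memory. -/
def memBit : Mem → Bool
  | some (.bit b) => b
  | _ => false

@[simp] theorem memBit_bit (b : Bool) : memBit (some (.bit b)) = b := rfl

/-- One round of `lift`: move a symbol to `tmp`, and count the subtrees that are still to be read,
in addition to the current one, by the height of `cnt`. -/
def liftBody (k : Stk) (r : k.Alph → Bool) : Prog :=
  seq (read k r) (seq (push .tmp memBit) (ite memBit (push .cnt fun _ => true) (read .cnt id)))

/-- Move the tree on top of the stack `k` to `tmp`, in reverse. -/
def lift (k : Stk) (r : k.Alph → Bool) : Prog :=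
  seq (load fun _ => some .comma) (loop Option.isSome (liftBody k r))

variable {i : List Sym} {M S t c : List Bool} {v : Mem}

theorem run_read_main (b : Bool) :
    Run (read .main id) (v, tapes i (b :: M) S t c) 1 (some (.bit b), tapes i M S t c) := by
  simpa [read] using Run.pop .main (fun o => o.map fun x => Sym.bit (id x)) v
    (tapes i (b :: M) S t c)

theorem run_read_save (b : Bool) :
    Run (read .save id) (v, tapes i M (b :: S) t c) 1 (some (.bit b), tapes i M S t c) := by
  simpa [read] using Run.pop .save (fun o => o.map fun x => Sym.bit (id x)) v
    (tapes i M (b :: S) t c)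

theorem run_read_tmp :
    Run (read .tmp id) (v, tapes i M S t c) 1 (t.head?.map .bit, tapes i M S t.tail c) := by
  simpa [read] using Run.pop .tmp (fun o => o.map fun x => Sym.bit (id x)) v (tapes i M S t c)

theorem run_read_cnt :
    Run (read .cnt id) (v, tapes i M S t c) 1 (c.head?.map .bit, tapes i M S t c.tail) := by
  simpa [read] using Run.pop .cnt (fun o => o.map fun x => Sym.bit (id x)) v (tapes i M S t c)

theorem run_push_main (f : Mem → Bool) :
    Run (push .main f) (v, tapes i M S t c) 1 (v, tapes i (f v :: M) S t c) := by
  simpa using Run.push .main f v (tapes i M S t c)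

theorem run_push_save (f : Mem → Bool) :
    Run (push .save f) (v, tapes i M S t c) 1 (v, tapes i M (f v :: S) t c) := by
  simpa using Run.push .save f v (tapes i M S t c)

theorem run_push_tmp (f : Mem → Bool) :
    Run (push .tmp f) (v, tapes i M S t c) 1 (v, tapes i M S (f v :: t) c) := by
  simpa using Run.push .tmp f v (tapes i M S t c)

theorem run_push_cnt (f : Mem → Bool) :
    Run (push .cnt f) (v, tapes i M S t c) 1 (v, tapes i M S t (f v :: c)) := by
  simpa using Run.push .cnt f v (tapes i M S t c)

/-- Reading a tree in the loop of `lift` removes one pending subtree from `cnt`. -/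
theorem run_lift_loop_main (x : Tree) {m : ℕ} {s' : PState} (hv : v.isSome = true)
    (h : Run (loop Option.isSome (liftBody .main id))
      (c.head?.map .bit, tapes i M S (x.ser.reverse ++ t) c.tail) m s') :
    Run (loop Option.isSome (liftBody .main id)) (v, tapes i (x.ser ++ M) S t c)
      (m + 5 * x.ser.length) s' := by
  induction x generalizing v M t c m with
  | nil =>
    refine (Run.loopTrue hv (.seq (run_read_main false) (.seq (run_push_tmp memBit)
      (.iteFalse rfl run_read_cnt))) h).cast ?_
    simp only [Tree.ser, List.length_singleton]; ring
  | cons a b iha ihb =>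
    simp only [Tree.ser, List.append_assoc, List.cons_append, List.reverse_cons,
      List.reverse_append] at h ⊢
    refine (Run.loopTrue hv (.seq (run_read_main true) (.seq (run_push_tmp memBit)
      (.iteTrue rfl (run_push_cnt fun _ => true)))) (iha rfl
        (ihb (m := m) (M := M) rfl ?_))).cast ?_
    · simpa using h
    · simp only [List.length_cons, List.length_append]; ring

theorem run_lift_loop_save (x : Tree) {m : ℕ} {s' : PState} (hv : v.isSome = true)
    (h : Run (loop Option.isSome (liftBody .save id))
      (c.head?.map .bit, tapes i M S (x.ser.reverse ++ t) c.tail) m s') :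
    Run (loop Option.isSome (liftBody .save id)) (v, tapes i M (x.ser ++ S) t c)
      (m + 5 * x.ser.length) s' := by
  induction x generalizing v S t c m with
  | nil =>
    refine (Run.loopTrue hv (.seq (run_read_save false) (.seq (run_push_tmp memBit)
      (.iteFalse rfl run_read_cnt))) h).cast ?_
    simp only [Tree.ser, List.length_singleton]; ring
  | cons a b iha ihb =>
    simp only [Tree.ser, List.append_assoc, List.cons_append, List.reverse_cons,
      List.reverse_append] at h ⊢
    refine (Run.loopTrue hv (.seq (run_read_save true) (.seq (run_push_tmp memBit)
      (.iteTrue rfl (run_push_cnt fun _ => true)))) (iha rfl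
        (ihb (m := m) (S := S) rfl ?_))).cast ?_
    · simpa using h
    · simp only [List.length_cons, List.length_append]; ring

theorem run_lift_main (x : Tree) :
    Run (lift .main id) (v, tapes i (x.ser ++ M) S [] []) (2 + 5 * x.ser.length)
      (none, tapes i M S x.ser.reverse []) := by
  refine (Run.seq (.load _ _ _) (run_lift_loop_main x rfl (m := 1) ?_)).cast (by ring)
  simpa using Run.loopFalse (by rfl)

theorem run_lift_save (x : Tree) :
    Run (lift .save id) (v, tapes i M (x.ser ++ S) [] []) (2 + 5 * x.ser.length)
      (none, tapes i M S x.ser.reverse []) := by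
  refine (Run.seq (.load _ _ _) (run_lift_loop_save x rfl (m := 1) ?_)).cast (by ring)
  simpa using Run.loopFalse (by rfl)

/-- Empty `tmp`, executing `p` for each of its symbols. -/
def flush (p : Prog) : Prog :=
  seq (read .tmp id) (loop Option.isSome (seq p (read .tmp id)))

theorem run_flush_main : Run (flush (push .main memBit)) (v, tapes i M S t c)
    (2 + 3 * t.length) (none, tapes i (t.reverse ++ M) S [] c) := by
  have h : ∀ M, Run (loop Option.isSome (seq (push .main memBit) (read .tmp id)))
      (t.head?.map .bit, tapes i M S t.tail c) (1 + 3 * t.length)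
      (none, tapes i (t.reverse ++ M) S [] c) := by
    induction t with
    | nil => exact fun M => .loopFalse rfl
    | cons b t ih =>
      intro M
      refine (Run.loopTrue rfl (.seq (run_push_main memBit) run_read_tmp)
        (by simpa using ih (b :: M))).cast ?_
      simp only [List.length_cons]; ring
  exact (Run.seq run_read_tmp (h M)).cast (by ring)

theorem run_flush_save : Run (flush (push .save memBit)) (v, tapes i M S t c)
    (2 + 3 * t.length) (none, tapes i M (t.reverse ++ S) [] c) := by
  have h : ∀ S, Run (loop Option.isSome (seq (push .save memBit) (read .tmp id)))
      (t.head?.map .bit, tapes i M S t.tail c) (1 + 3 * t.length)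
      (none, tapes i M (t.reverse ++ S) [] c) := by
    induction t with
    | nil => exact fun S => .loopFalse rfl
    | cons b t ih =>
      intro S
      refine (Run.loopTrue rfl (.seq (run_push_save memBit) run_read_tmp)
        (by simpa using ih (b :: S))).cast ?_
      simp only [List.length_cons]; ring
  exact (Run.seq run_read_tmp (h S)).cast (by ring)

theorem run_flush_both :
    Run (flush (seq (push .main memBit) (push .save memBit))) (v, tapes i M S t c)
      (2 + 4 * t.length) (none, tapes i (t.reverse ++ M) (t.reverse ++ S) [] c) := by
  have h : ∀ M S, Run (loop Option.isSome
      (seq (seq (push .main memBit) (push .save memBit)) (read .tmp id)))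
      (t.head?.map .bit, tapes i M S t.tail c) (1 + 4 * t.length)
      (none, tapes i (t.reverse ++ M) (t.reverse ++ S) [] c) := by
    induction t with
    | nil => exact fun M S => .loopFalse rfl
    | cons b t ih =>
      intro M S
      refine (Run.loopTrue rfl (.seq (.seq (run_push_main memBit) (run_push_save memBit))
        run_read_tmp) (by simpa using ih (b :: M) (b :: S))).cast ?_
      simp only [List.length_cons]; ring
  exact (Run.seq run_read_tmp (h M S)).cast (by ring)

theorem run_flush_drop : Run (flush (load id)) (v, tapes i M S t c)
    (2 + 3 * t.length) (none, tapes i M S [] c) := by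
  have h : Run (loop Option.isSome (seq (load id) (read .tmp id)))
      (t.head?.map .bit, tapes i M S t.tail c) (1 + 3 * t.length)
      (none, tapes i M S [] c) := by
    induction t with
    | nil => exact .loopFalse rfl
    | cons b t ih =>
      refine (Run.loopTrue rfl (.seq (.load id _ _) run_read_tmp) (by simpa using ih)).cast ?_
      simp only [List.length_cons]; ring
  exact (Run.seq run_read_tmp h).cast (by ring)

/-- `Computes p x y n`: in at most `n` steps, the program `p` replaces the tree `x` on top of the
main stack by the tree `y`, without regard to what lies below, and to what lies on `save`. -/
def Computes (p : Prog) (x y : Tree) (n : ℕ) : Prop :=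
  ∀ v M S, ∃ v', ∃ m ≤ n,
    Run p (v, tapes [] (x.ser ++ M) S [] []) m (v', tapes [] (y.ser ++ M) S [] [])

theorem Computes.mono {p : Prog} {x y : Tree} {n m : ℕ} (h : Computes p x y n) (hnm : n ≤ m) :
    Computes p x y m := fun v M S =>
  let ⟨v', l, hl, hr⟩ := h v M S
  ⟨v', l, hl.trans hnm, hr⟩

theorem computes_skip (x : Tree) : Computes (load id) x x 1 :=
  fun v _ _ => ⟨v, 1, le_rfl, .load id v _⟩

theorem Computes.comp {p q : Prog} {x y z : Tree} {n m : ℕ} (h : Computes p x y n)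
    (h' : Computes q y z m) : Computes (seq p q) x z (n + m) := fun v M S =>
  let ⟨v', _, hl, hr⟩ := h v M S
  let ⟨v'', _, hl', hr'⟩ := h' v' M S
  ⟨v'', _, Nat.add_le_add hl hl', .seq hr hr'⟩

/-- Drop the tree on top of the main stack. -/
def drop : Prog := seq (lift .main id) (flush (load id))

theorem run_drop (x : Tree) : Run drop (v, tapes i (x.ser ++ M) S [] []) (4 + 8 * x.ser.length)
    (none, tapes i M S [] []) :=
  (Run.seq (run_lift_main x) run_flush_drop).cast (by simp only [List.length_reverse]; ring)

/-- Move a tree from the main stack to `save`. -/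
def store : Prog := seq (lift .main id) (flush (push .save memBit))

theorem run_store (x : Tree) : Run store (v, tapes i (x.ser ++ M) S [] [])
    (4 + 8 * x.ser.length) (none, tapes i M (x.ser ++ S) [] []) := by
  have := run_flush_save (v := none) (i := i) (M := M) (S := S) (t := x.ser.reverse) (c := [])
  rw [List.reverse_reverse, List.length_reverse] at this
  exact (Run.seq (run_lift_main x) this).cast (by ring)

/-- Move a tree from `save` to the main stack. -/
def restore : Prog := seq (lift .save id) (flush (push .main memBit))

theorem run_restore (x : Tree) : Run restore (v, tapes i M (x.ser ++ S) [] [])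
    (4 + 8 * x.ser.length) (none, tapes i (x.ser ++ M) S [] []) := by
  have := run_flush_main (v := none) (i := i) (M := M) (S := S) (t := x.ser.reverse) (c := [])
  rw [List.reverse_reverse, List.length_reverse] at this
  exact (Run.seq (run_lift_save x) this).cast (by ring)

/-- Copy a tree from the main stack to `save`. -/
def copy : Prog := seq (lift .main id) (flush (seq (push .main memBit) (push .save memBit)))

theorem run_copy (x : Tree) : Run copy (v, tapes i (x.ser ++ M) S [] [])
    (4 + 9 * x.ser.length) (none, tapes i (x.ser ++ M) (x.ser ++ S) [] []) := by
  have := run_flush_both (v := none) (i := i) (M := M) (S := S) (t := x.ser.reverse) (c := [])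
  rw [List.reverse_reverse, List.length_reverse] at this
  exact (Run.seq (run_lift_main x) this).cast (by ring)

/-- Replace the tree on the main stack by the empty tree. -/
def clear : Prog := seq drop (push .main fun _ => false)

theorem computes_clear (x : Tree) : Computes clear x .nil (5 + 8 * x.ser.length) :=
  fun _ _ _ => ⟨_, _, le_rfl, (Run.seq (run_drop x) (run_push_main _)).cast (by ring)⟩

/-- Pair the results of two programs. -/
def pair (p q : Prog) : Prog :=
  seq copy (seq q (seq restore (seq p (push .main fun _ => true))))

theorem Computes.pair {p q : Prog} {x y z : Tree} {n m : ℕ} (h : Computes p x y n)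
    (h' : Computes q x z m) :
    Computes (pair p q) x (.cons y z) (n + m + 9 + 17 * x.ser.length) := by
  intro v M S
  obtain ⟨v', l', hl', hr'⟩ := h' none M (x.ser ++ S)
  obtain ⟨v'', l'', hl'', hr''⟩ := h none (z.ser ++ M) S
  refine ⟨v'', _, ?_, .seq (run_copy x) (.seq hr' (.seq (run_restore x) (.seq (m := 1) hr'' ?_)))⟩
  · omega
  · simpa [Tree.ser] using run_push_main (i := []) (M := y.ser ++ (z.ser ++ M)) (S := S)
      (t := []) (c := []) (v := v'') fun _ => true

/-- Put the top symbol of the main stack into the memory. -/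
def look : Prog := seq (read .main id) (push .main memBit)

theorem run_look (b : Bool) : Run look (v, tapes i (b :: M) S t c) 2
    (some (.bit b), tapes i (b :: M) S t c) :=
  .seq (run_read_main b) (run_push_main memBit)

/-- The left subtree. -/
def left : Prog := seq (read .main id) (seq store (seq drop restore))

theorem computes_left (a b : Tree) :
    Computes left (.cons a b) a (13 + 16 * (Tree.cons a b).ser.length) := by
  intro v M S
  have h := run_store (v := some (.bit true)) (i := []) (M := b.ser ++ M) (S := S) a
  rw [← List.append_assoc] at h
  refine ⟨_, _, ?_, .seq (run_read_main true) (.seq h (.seq (run_drop b) (run_restore a)))⟩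
  simp only [Tree.ser, List.length_cons, List.length_append]
  omega

/-- The right subtree. -/
def right : Prog := seq (read .main id) drop

theorem computes_right (a b : Tree) :
    Computes right (.cons a b) b (5 + 8 * (Tree.cons a b).ser.length) := by
  intro v M S
  have h := run_drop (v := some (.bit true)) (i := []) (M := b.ser ++ M) (S := S) a
  rw [← List.append_assoc] at h
  refine ⟨_, _, ?_, .seq (run_read_main true) h⟩
  simp only [Tree.ser, List.length_cons, List.length_append]
  omega

/-- On a tree `cons l s`, find out whether `l` is empty. -/
def lookLeft : Prog :=
  seq (read .main id) (seq look (push .main fun _ => true))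

theorem run_lookLeft (b : Bool) : Run lookLeft (v, tapes i (true :: b :: M) S t c) 4
    (some (.bit b), tapes i (true :: b :: M) S t c) :=
  .seq (run_read_main true) (.seq (run_look b) (run_push_main _))

/-- On a tree `cons l s`, execute `p` if `l` is empty, and `q` otherwise. -/
def caseLeft (p q : Prog) : Prog := seq lookLeft (ite memBit q p)

theorem Computes.caseLeft_nil {p q : Prog} {c y : Tree} {n : ℕ}
    (h : Computes p (.cons .nil c) y n) :
    Computes (caseLeft p q) (.cons .nil c) y (n + 5) := by
  intro v M S
  obtain ⟨v', l', hl', hr'⟩ := h (some (.bit false)) M S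
  exact ⟨v', _, by omega, .seq (run_lookLeft false) (.iteFalse rfl hr')⟩

theorem Computes.caseLeft_cons {p q : Prog} {a b c y : Tree} {n : ℕ}
    (h : Computes q (.cons (.cons a b) c) y n) :
    Computes (caseLeft p q) (.cons (.cons a b) c) y (n + 5) := by
  intro v M S
  obtain ⟨v', l', hl', hr'⟩ := h (some (.bit true)) M S
  exact ⟨v', _, by omega, .seq (run_lookLeft true) (.iteTrue rfl hr')⟩

/-- Repeat a program on trees `cons l s` as long as `l` is not empty. -/
def iter (p : Prog) : Prog := seq lookLeft (loop memBit (seq p lookLeft))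

theorem computes_iter {p : Prog} {n : ℕ} (m : ℕ) (X : ℕ → Tree)
    (h : ∀ j < m, (∃ a b c, X j = .cons (.cons a b) c) ∧ Computes p (X j) (X (j + 1)) n)
    (hm : ∃ c, X m = .cons .nil c) : Computes (iter p) (X 0) (X m) (m * (n + 5) + 5) := by
  -- the bit found by `lookLeft` on `X 0`
  have hX : ∀ X : ℕ → Tree, (∀ j < m, (∃ a b c, X j = .cons (.cons a b) c)) →
      (∃ c, X m = .cons .nil c) → ∃ l, (X 0).ser = true :: decide (0 < m) :: l := by
    intro X h hm
    rcases Nat.eq_zero_or_pos m with rfl | hm0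
    · obtain ⟨c, hc⟩ := hm
      exact ⟨c.ser, by simp [hc, Tree.ser]⟩
    · obtain ⟨a, b, c, hc⟩ := h 0 hm0
      exact ⟨a.ser ++ (b.ser ++ c.ser), by simp [hc, Tree.ser, hm0]⟩
  have key : ∀ M S, ∃ l ≤ m * (n + 5) + 1, ∃ v',
      Run (loop memBit (seq p lookLeft))
        (some (.bit (decide (0 < m))), tapes [] ((X 0).ser ++ M) S [] []) l
        (v', tapes [] ((X m).ser ++ M) S [] []) := by
    clear hX
    intro M S
    induction m generalizing X with
    | zero => exact ⟨1, by omega, _, .loopFalse rfl⟩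
    | succ m ih =>
      obtain ⟨v1, l1, hl1, hr1⟩ := (h 0 (by omega)).2 (some (.bit true)) M S
      obtain ⟨l2, hl2, v2, hr2⟩ := ih (fun j => X (j + 1)) (fun j hj => h (j + 1) (by omega)) hm
      have h1 : ∃ r, (X 1).ser = true :: decide (0 < m) :: r := by
        rcases Nat.eq_zero_or_pos m with rfl | hm0
        · obtain ⟨c, hc⟩ := hm
          exact ⟨c.ser, by simp [hc, Tree.ser]⟩
        · obtain ⟨⟨a, b, c, hc⟩, -⟩ := h 1 (by omega)
          exact ⟨a.ser ++ (b.ser ++ c.ser), by simp [hc, Tree.ser, hm0]⟩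
      obtain ⟨r, hr⟩ := h1
      have h3 := run_lookLeft (v := v1) (i := []) (M := r ++ M) (S := S) (t := []) (c := [])
        (decide (0 < m))
      rw [← List.cons_append, ← List.cons_append, ← hr] at h3
      refine ⟨_, ?_, v2, .loopTrue (by simp) (.seq hr1 h3) hr2⟩
      have : (m + 1) * (n + 5) = m * (n + 5) + (n + 5) := by ring
      omega
  intro v M S
  obtain ⟨r, hr⟩ := hX X (fun j hj => (h j hj).1) hm
  obtain ⟨l, hl, v', hrun⟩ := key M S
  have h3 := run_lookLeft (v := v) (i := []) (M := r ++ M) (S := S) (t := []) (c := [])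
    (decide (0 < m))
  rw [← List.cons_append, ← List.cons_append, ← hr] at h3
  exact ⟨v', _, by omega, .seq h3 hrun⟩

end Prog

end TEDSC

namespace TEDSC

open Prog

/-! ### Functions computable in polynomial time -/

/-- Polynomially bounded monotone functions. -/
@[fun_prop]
def PolyBd (b : ℕ → ℕ) : Prop := Monotone b ∧ ∃ C, ∀ n, b n ≤ (n + 2) ^ C

namespace PolyBd

variable {b b' : ℕ → ℕ}

@[fun_prop]
theorem id : PolyBd fun n => n := ⟨monotone_id, 1, fun n => by simp⟩

@[fun_prop]
theorem const (c : ℕ) : PolyBd fun _ => c :=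
  ⟨monotone_const, c, fun n => c.lt_two_pow_self.le.trans (Nat.pow_le_pow_left (by omega) c)⟩

@[fun_prop]
theorem add (h : PolyBd b) (h' : PolyBd b') : PolyBd fun n => b n + b' n := by
  obtain ⟨h, C, hC⟩ := h
  obtain ⟨h', C', hC'⟩ := h'
  refine ⟨h.add h', max C C' + 1, fun n => ?_⟩
  have h1 := (hC n).trans (Nat.pow_le_pow_right (by omega) (le_max_left C C'))
  have h2 := (hC' n).trans (Nat.pow_le_pow_right (by omega) (le_max_right C C'))
  rw [pow_succ]
  nlinarith [Nat.zero_le n]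

@[fun_prop]
theorem mul (h : PolyBd b) (h' : PolyBd b') : PolyBd fun n => b n * b' n := by
  obtain ⟨h, C, hC⟩ := h
  obtain ⟨h', C', hC'⟩ := h'
  exact ⟨h.mul' h', C + C', fun n => (Nat.mul_le_mul (hC n) (hC' n)).trans (pow_add _ _ _).ge⟩

@[fun_prop]
theorem comp (h : PolyBd b) (h' : PolyBd b') : PolyBd fun n => b (b' n) := by
  obtain ⟨h, C, hC⟩ := h
  obtain ⟨h', C', hC'⟩ := h'
  refine ⟨h.comp h', (C' + 2) * C, fun n => (hC _).trans ?_⟩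
  rw [pow_mul]
  refine Nat.pow_le_pow_left ?_ _
  have h1 := hC' n
  have h2 : 1 ≤ (n + 2) ^ C' := Nat.one_le_pow _ _ (by omega)
  rw [pow_add]
  nlinarith [Nat.zero_le n, Nat.zero_le (n * n)]

end PolyBd

/-- Types whose elements are represented by trees. -/
class TreeEnc (α : Type) where
  enc : α → Tree

open TreeEnc (enc)

instance : TreeEnc Unit := ⟨fun _ => .nil⟩

instance : TreeEnc Bool := ⟨fun b => if b then .cons .nil .nil else .nil⟩

instance {α β : Type} [TreeEnc α] [TreeEnc β] : TreeEnc (α × β) :=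
  ⟨fun x => .cons (enc x.1) (enc x.2)⟩

/-- The representation of lists by trees. -/
def encList {α : Type} [TreeEnc α] : List α → Tree
  | [] => .nil
  | a :: l => .cons (enc a) (encList l)

instance {α : Type} [TreeEnc α] : TreeEnc (List α) := ⟨encList⟩

/-- Natural numbers are represented in binary. -/
instance : TreeEnc ℕ := ⟨fun n => enc n.bits⟩

section size

variable {α β : Type} [TreeEnc α] [TreeEnc β]

/-- The size of the representation of an object. -/
def size (a : α) : ℕ := (enc a).ser.length

theorem size_pair (x : α × β) : size x = size x.1 + size x.2 + 1 := by
  simp [size, enc, Tree.ser]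

@[simp] theorem size_nil : size ([] : List α) = 1 := rfl

@[simp] theorem size_cons (a : α) (l : List α) : size (a :: l) = size a + size l + 1 := by
  simp [size, enc, encList, Tree.ser]

theorem size_bool_le (b : Bool) : size b ≤ 3 := by cases b <;> simp [size, enc, Tree.ser]

theorem size_pos (a : α) : 1 ≤ size a := by
  unfold size
  cases enc a <;> simp [Tree.ser]

theorem size_append (l l' : List α) : size (l ++ l') + 1 = size l + size l' := by
  induction l with
  | nil => simp [add_comm]
  | cons a l ih => simp only [List.cons_append, size_cons]; omega

theorem size_append_le (l l' : List α) : size (l ++ l') ≤ size l + size l' := by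
  have := size_append l l'; omega

theorem length_lt_size (l : List α) : l.length < size l := by
  induction l with
  | nil => simp
  | cons a l ih => simp only [List.length_cons, size_cons]; omega

theorem size_le_of_mem {a : α} {l : List α} (h : a ∈ l) : size a ≤ size l := by
  induction l with
  | nil => simp at h
  | cons b l ih =>
    rcases List.mem_cons.1 h with rfl | h
    · simp only [size_cons]; omega
    · have := ih h; simp only [size_cons]; omega

theorem size_le_of_sublist {l l' : List α} (h : l.Sublist l') : size l ≤ size l' := by
  induction h with
  | slnil => rfl
  | cons a _ ih => simp only [size_cons]; omega
  | cons_cons a _ ih => simp only [size_cons]; omega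

theorem size_list_le {l : List α} {m : ℕ} (h : ∀ a ∈ l, size a ≤ m) :
    size l ≤ l.length * (m + 1) + 1 := by
  induction l with
  | nil => simp
  | cons a l ih =>
    have h1 := ih fun a ha => h a (List.mem_cons_of_mem _ ha)
    have h2 := h a List.mem_cons_self
    simp only [List.length_cons, size_cons, add_mul]
    omega

theorem size_flatMap_le {γ : Type} {l : List γ} {f : γ → List β} {m : ℕ}
    (h : ∀ a ∈ l, size (f a) ≤ m) :
    size (l.flatMap f) ≤ l.length * m + 1 := by
  induction l with
  | nil => simp
  | cons a l ih =>
    have h1 := ih fun a ha => h a (List.mem_cons_of_mem _ ha)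
    have h2 := h a List.mem_cons_self
    have h3 := size_append (f a) (l.flatMap f)
    simp only [List.flatMap_cons, List.length_cons, add_mul]
    omega

theorem size_nat_le (n : ℕ) : size n ≤ 4 * n.size + 1 := by
  have h : size n = size n.bits := rfl
  rw [h, ← Nat.size_eq_bits_len, mul_comm]
  exact size_list_le fun b _ => size_bool_le b

end size

/-- `FPB B f`: the function `f` is computable in time polynomial in the bound `B`, and so is the
size of its values; the size of the argument is at most `B`. -/
def FPB {α β : Type} [TreeEnc α] [TreeEnc β] (B : α → ℕ) (f : α → β) : Prop :=
  (∀ a, size a ≤ B a) ∧ ∃ (p : Prog) (b : ℕ → ℕ), PolyBd b ∧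
    ∀ a, size (f a) ≤ b (B a) ∧ Computes p (enc a) (enc (f a)) (b (B a))

/-- Functions computable in polynomial time. -/
@[fun_prop]
def FP {α β : Type} [TreeEnc α] [TreeEnc β] (f : α → β) : Prop := FPB size f

section closure

variable {α β γ δ : Type} [TreeEnc α] [TreeEnc β] [TreeEnc γ] [TreeEnc δ] {B : α → ℕ}

theorem FPB.size_le {f : α → β} (h : FPB B f) : ∃ b, PolyBd b ∧ ∀ a, size (f a) ≤ b (B a) := by
  obtain ⟨-, p, b, hb, h⟩ := h
  exact ⟨b, hb, fun a => (h a).1⟩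

theorem FP.size_le {f : α → β} (h : FP f) : ∃ b, PolyBd b ∧ ∀ a, size (f a) ≤ b (size a) :=
  FPB.size_le h

/-- Only the representations of the values matter. -/
theorem FPB.cast {f : α → β} {g : α → γ} (h : FPB B f) (e : ∀ a, enc (g a) = enc (f a)) :
    FPB B g := by
  obtain ⟨hB, p, b, hb, h⟩ := h
  refine ⟨hB, p, b, hb, fun a => ?_⟩
  rw [e, size, e]
  exact h a

theorem FP.cast {f : α → β} {g : α → γ} (h : FP f) (e : ∀ a, enc (g a) = enc (f a)) : FP g :=
  FPB.cast h e

theorem FP.compB {g : β → γ} {f : α → β} (hg : FP g) (hf : FPB B f) :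
    FPB B fun a => g (f a) := by
  obtain ⟨-, q, b', hb', hg⟩ := hg
  obtain ⟨hB, p, b, hb, hf⟩ := hf
  refine ⟨hB, seq p q, fun n => b n + b' (b n), by fun_prop, fun a => ?_⟩
  have h1 : b' (size (f a)) ≤ b' (b (B a)) := hb'.1 (hf a).1
  refine ⟨(hg _).1.trans (h1.trans (Nat.le_add_left _ _)), ((hf a).2.comp (hg _).2).mono ?_⟩
  exact Nat.add_le_add_left h1 _

@[fun_prop]
theorem FP.comp {g : β → γ} {f : α → β} (hg : FP g) (hf : FP f) : FP fun a => g (f a) :=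
  FP.compB hg hf

theorem FPB.idB (hB : ∀ a, size a ≤ B a) : FPB B fun a => a :=
  ⟨hB, load id, fun n => n + 1, by fun_prop, fun a =>
    ⟨(hB a).trans (Nat.le_succ _), (computes_skip _).mono (Nat.le_add_left _ _)⟩⟩

@[fun_prop]
theorem FP.id : FP fun a : α => a := FPB.idB fun _ => le_rfl

theorem FP.toFPB {f : α → β} (h : FP f) (hB : ∀ a, size a ≤ B a) : FPB B f :=
  h.compB (FPB.idB hB)

theorem FPB.pair {f : α → β} {g : α → γ} (hf : FPB B f) (hg : FPB B g) :
    FPB B fun a => (f a, g a) := by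
  obtain ⟨hB, p, b, hb, hf⟩ := hf
  obtain ⟨-, q, b', hb', hg⟩ := hg
  refine ⟨hB, Prog.pair p q, fun n => b n + b' n + 9 + 17 * n, by fun_prop, fun a => ?_⟩
  refine ⟨?_, ((hf a).2.pair (hg a).2).mono ?_⟩
  · have h1 := (hf a).1
    have h2 := (hg a).1
    simp only [size_pair]
    omega
  · have : (enc a).ser.length ≤ B a := hB a
    dsimp only
    omega

@[fun_prop]
theorem FP.pair {f : α → β} {g : α → γ} (hf : FP f) (hg : FP g) : FP fun a => (f a, g a) :=
  FPB.pair hf hg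

theorem FP.fst' : FP fun x : α × β => x.1 :=
  ⟨fun _ => le_rfl, left, fun n => 13 + 16 * n, by fun_prop, fun a =>
    ⟨by have := size_pair a; dsimp only; omega, computes_left _ _⟩⟩

theorem FP.snd' : FP fun x : α × β => x.2 :=
  ⟨fun _ => le_rfl, right, fun n => 5 + 8 * n, by fun_prop, fun a =>
    ⟨by have := size_pair a; dsimp only; omega, computes_right _ _⟩⟩

@[fun_prop]
theorem FP.fst {f : α → β × γ} (hf : FP f) : FP fun a => (f a).1 := FP.fst'.comp hf

@[fun_prop]
theorem FP.snd {f : α → β × γ} (hf : FP f) : FP fun a => (f a).2 := FP.snd'.comp hf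

/-- Constants. -/
@[fun_prop]
theorem FP.const (c : β) : FP fun _ : α => c := by
  have key : ∀ c : Tree, ∃ p : Prog, ∃ b, PolyBd b ∧
      ∀ a : α, Computes p (enc a) c (b (size a)) := by
    intro c
    induction c with
    | nil => exact ⟨clear, fun n => 5 + 8 * n, by fun_prop, fun a => computes_clear _⟩
    | cons x y ihx ihy =>
      obtain ⟨p, b, hb, hp⟩ := ihx
      obtain ⟨q, b', hb', hq⟩ := ihy
      exact ⟨Prog.pair p q, fun n => b n + b' n + 9 + 17 * n, by fun_prop, fun a =>
        (hp a).pair (hq a)⟩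
  obtain ⟨p, b, hb, h⟩ := key (enc c)
  exact ⟨fun _ => le_rfl, p, fun n => b n + size c, by fun_prop, fun a =>
    ⟨Nat.le_add_left _ _, (h a).mono (Nat.le_add_right _ _)⟩⟩

@[fun_prop]
theorem FP.cons {f : α → β} {l : α → List β} (hf : FP f) (hl : FP l) : FP fun a => f a :: l a :=
  (hf.pair hl).cast fun _ => rfl

/-- Case distinction on a list. -/
theorem FP.listCases {l : α → List β} {f : α → γ} {g : α → β → List β → γ} (hl : FP l) (hf : FP f)
    (hg : FP fun x : α × β × List β => g x.1 x.2.1 x.2.2) :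
    FP fun a => match l a with
      | [] => f a
      | b :: t => g a b t := by
  have h1 : FP fun x : Unit × α => f x.2 := by fun_prop
  have h2 : FP fun x : (β × List β) × α => g x.2 x.1.1 x.1.2 :=
    hg.comp (f := fun x : (β × List β) × α => (x.2, x.1.1, x.1.2)) (by fun_prop)
  obtain ⟨-, p, b, hb, h1⟩ := h1
  obtain ⟨-, q, b', hb', h2⟩ := h2
  obtain ⟨-, r, b₀, hb₀, h0⟩ := hl.pair (FP.id (α := α))
  refine ⟨fun _ => le_rfl, seq r (caseLeft p q), fun n => b₀ n + (b (b₀ n) + b' (b₀ n) + 5),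
    by fun_prop, fun a => ?_⟩
  obtain ⟨hs, h0⟩ := h0 a
  dsimp only at hs h0 ⊢
  rcases e : l a with _ | ⟨x, t⟩
  · rw [e] at hs h0
    have h3 := h1 ((), a)
    have h4 : b (size ((), a)) ≤ b (b₀ (size a)) := hb.1 hs
    exact ⟨by dsimp only at h3 ⊢; omega,
      (h0.comp (h3.2.caseLeft_nil (q := q))).mono (by omega)⟩
  · rw [e] at hs h0
    have h3 := h2 ((x, t), a)
    have h4 : b' (size ((x, t), a)) ≤ b' (b₀ (size a)) := hb'.1 hs
    exact ⟨by dsimp only at h3 ⊢; omega,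
      (h0.comp (h3.2.caseLeft_cons (p := p))).mono (by omega)⟩

/-- The list with at most one element that stands for a Boolean value. -/
theorem FP.boolList : FP fun b : Bool => if b then [()] else [] :=
  FP.id.cast fun b => by cases b <;> rfl

@[fun_prop]
theorem FP.ite {c : α → Bool} {f g : α → β} (hc : FP c) (hf : FP f) (hg : FP g) :
    FP fun a => if c a then f a else g a := by
  have h : FP fun x : α × Unit × List Unit => f x.1 := by fun_prop
  refine ((FP.boolList.comp hc).listCases hg (g := fun a _ _ => f a) h).cast fun a => ?_
  cases c a <;> rfl

/-- An iteration through a list, if its intermediate results stay small. The bound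
`B` may exceed the size of the argument: the dynamic program builds a list of states whose size is
polynomial in `stateBound`, but not in the size of the instance. -/
theorem FPB.foldl {l : α → List β} {i : α → γ} {step : α → γ → β → γ} (hl : FPB B l)
    (hi : FPB B i) (hs : FP fun x : α × γ × β => step x.1 x.2.1 x.2.2)
    (hb : ∃ b, PolyBd b ∧ ∀ a l', l' <+: l a → size (l'.foldl (step a) (i a)) ≤ b (B a)) :
    FPB B fun a => (l a).foldl (step a) (i a) := by
  have hbody : FP fun x : (β × List β) × α × γ => (x.1.2, x.2.1, step x.2.1 x.2.2 x.1.1) := by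
    have := hs.comp (f := fun x : (β × List β) × α × γ => (x.2.1, x.2.2, x.1.1)) (by fun_prop)
    fun_prop
  obtain ⟨b, hb, hsize⟩ := hb
  obtain ⟨-, p, b₁, hb₁, hp⟩ := hbody
  have hini := hl.pair ((FPB.idB hl.1).pair hi)
  obtain ⟨hB, q, b₂, hb₂, hq⟩ := hini
  obtain ⟨b₃, hb₃, hlen⟩ := hl.size_le
  refine ⟨hB, seq q (seq (iter p) (seq right right)), fun n =>
    b₂ n + ((b₃ n * (b₁ (b₃ n + n + b n + 3) + 5) + 5) +
      ((5 + 8 * (n + b n + 3)) + (5 + 8 * (n + b n + 3)))) + b n, by fun_prop, fun a => ?_⟩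
  set L := l a with hL
  have hlen' : L.length ≤ b₃ (B a) := (length_lt_size L).le.trans (hlen a)
  have hsize' : ∀ j, size ((L.take j).foldl (step a) (i a)) ≤ b (B a) := fun j =>
    hsize a _ (List.take_prefix _ _)
  have hiter := computes_iter (p := p) (n := b₁ (b₃ (B a) + B a + b (B a) + 3)) L.length
    (fun j => enc (L.drop j, a, (L.take j).foldl (step a) (i a))) (fun j hj => ?_) ?_
  · have h0 := (hq a).2
    simp only [List.drop_zero, List.take_zero, List.foldl_nil, List.drop_length,
      List.take_length] at hiter
    have h5 := hsize' L.length
    rw [List.take_length] at h5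
    have h6 := hB a
    have h3 := computes_right .nil (enc (a, L.foldl (step a) (i a)))
    have h4 := computes_right (enc a) (enc (L.foldl (step a) (i a)))
    refine ⟨by dsimp only; rw [← hL]; omega, (h0.comp (hiter.comp (h3.comp h4))).mono ?_⟩
    have e1 : (Tree.cons .nil (enc (a, L.foldl (step a) (i a)))).ser.length =
        size a + size (L.foldl (step a) (i a)) + 3 := by
      simp only [size, enc, Tree.ser, List.length_cons, List.length_append, List.length_nil]
      omega
    have e2 : (Tree.cons (enc a) (enc (L.foldl (step a) (i a)))).ser.length =
        size a + size (L.foldl (step a) (i a)) + 1 := by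
      simp only [size, Tree.ser, List.length_cons, List.length_append]
    rw [e1, e2]
    have h7 : L.length * (b₁ (b₃ (B a) + B a + b (B a) + 3) + 5) ≤
        b₃ (B a) * (b₁ (b₃ (B a) + B a + b (B a) + 3) + 5) := Nat.mul_le_mul_right _ hlen'
    dsimp only
    omega
  · have hd : L.drop j = L[j] :: L.drop (j + 1) := List.drop_eq_getElem_cons hj
    have ht : (L.take (j + 1)).foldl (step a) (i a) =
        step a ((L.take j).foldl (step a) (i a)) L[j] := by
      rw [← List.take_concat_get' L j hj, List.foldl_append]; rfl
    rw [hd, ht]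
    refine ⟨⟨_, _, _, rfl⟩, ((hp ((L[j], L.drop (j + 1)), a,
      (L.take j).foldl (step a) (i a))).2).mono (hb₁.1 ?_)⟩
    have h1 := size_le_of_sublist (List.drop_sublist j L)
    have h2 := hsize' j
    have h3 := hB a
    have h4 : size L ≤ b₃ (B a) := hlen a
    rw [hd, size_cons] at h1
    simp only [size_pair]
    omega
  · exact ⟨_, by rw [List.drop_length]; rfl⟩

theorem FP.foldl {l : α → List β} {i : α → γ} {step : α → γ → β → γ} (hl : FP l)
    (hi : FP i) (hs : FP fun x : α × γ × β => step x.1 x.2.1 x.2.2)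
    (hb : ∃ b, PolyBd b ∧ ∀ a l', l' <+: l a → size (l'.foldl (step a) (i a)) ≤ b (size a)) :
    FP fun a => (l a).foldl (step a) (i a) :=
  FPB.foldl hl hi hs hb

end closure

end TEDSC

namespace TEDSC

open TreeEnc (enc)
open Prog

/-! ### From polynomial-time functions to deciding machines -/

/-- Whether a symbol is a bit. -/
def Sym.isBit : Sym → Bool
  | .bit _ => true
  | _ => false

/-- The value of a bit; for the other symbols, it tells `semicolon` from `comma`. -/
def Sym.val : Sym → Bool
  | .bit b => b
  | .comma => false
  | .semicolon => true

instance : TreeEnc Sym := ⟨fun s => enc (s.isBit, s.val)⟩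

/-- Instances are represented by their reversed encoding, in the order in which a machine can build
the list from its input stack. -/
instance : TreeEnc Instance := ⟨fun I => enc I.encode.reverse⟩

/-- Push the tree of a Boolean value on the main stack. -/
def pushBool (f : Mem → Bool) : Prog :=
  ite f (seq (push .main fun _ => false) (seq (push .main fun _ => false)
    (push .main fun _ => true))) (push .main fun _ => false)

theorem run_pushBool (f : Mem → Bool) {v : Mem} {i : List Sym} {M : List Bool} :
    ∃ n ≤ 4, Run (pushBool f) (v, tapes i M [] [] []) n
      (v, tapes i ((enc (f v)).ser ++ M) [] [] []) := by
  rcases e : f v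
  · exact ⟨_, by omega, .iteFalse e (run_push_main _)⟩
  · exact ⟨_, by omega, .iteTrue e (.seq (run_push_main _) (.seq (run_push_main _)
      (run_push_main _)))⟩

/-- Add the symbol in the memory to the list on the main stack. -/
def pushSym : Prog :=
  seq (pushBool fun v => v.elim false Sym.val) (seq (pushBool fun v => v.elim false Sym.isBit)
    (seq (push .main fun _ => true) (push .main fun _ => true)))

theorem run_pushSym (s : Sym) (l : List Sym) {i : List Sym} :
    ∃ n ≤ 10, Run pushSym (some s, tapes i (enc l).ser [] [] []) n
      (some s, tapes i (enc (s :: l)).ser [] [] []) := by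
  obtain ⟨n, hn, h⟩ := run_pushBool (fun v => v.elim false Sym.val) (v := some s) (i := i)
    (M := (enc l).ser)
  obtain ⟨m, hm, h'⟩ := run_pushBool (fun v => v.elim false Sym.isBit) (v := some s) (i := i)
    (M := (enc s.val).ser ++ (enc l).ser)
  refine ⟨_, ?_, .seq h (.seq h' (.seq (run_push_main fun _ => true) (m := 1) ?_))⟩
  · omega
  · have e : (enc (s :: l)).ser =
        true :: true :: ((enc s.isBit).ser ++ ((enc s.val).ser ++ (enc l).ser)) := by
      simp [enc, encList, Tree.ser]
    rw [e]
    exact run_push_main fun _ => true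

/-- Read the input. -/
def readInput : Prog :=
  seq (push .main fun _ => false) (seq (pop .inp id)
    (loop Option.isSome (seq pushSym (pop .inp id))))

theorem run_readInput (w : List Sym) : ∃ n ≤ 12 * w.length + 3, ∃ v,
    Run readInput (none, tapes w [] [] [] []) n (v, tapes [] (enc w.reverse).ser [] [] []) := by
  have hpop : ∀ (v : Mem) (w : List Sym) M, Run (pop .inp id) (v, tapes w M [] [] []) 1
      (w.head?, tapes w.tail M [] [] []) := fun v w M => by
    simpa using Run.pop .inp id v (tapes w M [] [] [])
  have key : ∀ l : List Sym, ∃ n ≤ 12 * w.length + 1, ∃ v,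
      Run (loop Option.isSome (seq pushSym (pop .inp id)))
        (w.head?, tapes w.tail (enc l).ser [] [] []) n
        (v, tapes [] (enc (w.reverse ++ l)).ser [] [] []) := by
    induction w with
    | nil => exact fun l => ⟨1, by omega, _, .loopFalse rfl⟩
    | cons s w ih =>
      intro l
      obtain ⟨n, hn, h⟩ := run_pushSym s l (i := w)
      obtain ⟨m, hm, v, h'⟩ := ih (s :: l)
      refine ⟨_, ?_, v, .loopTrue rfl (.seq h (hpop _ _ _)) (by simpa using h')⟩
      simp only [List.length_cons]
      omega
  obtain ⟨n, hn, v, h⟩ := key []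
  rw [List.append_nil] at h
  exact ⟨_, by omega, v, .seq (run_push_main _) (.seq (hpop _ _ _) h)⟩

/-- Turn the tree of a Boolean value into the output bit. -/
def writeOutput : Prog :=
  seq look (seq (ite memBit (seq (read .main id) (seq (read .main id) (seq (read .main id)
    (push .main fun _ => true)))) (load id)) (load fun _ => none))

theorem run_writeOutput (b : Bool) (v : Mem) : ∃ n ≤ 8,
    Run writeOutput (v, tapes [] (enc b).ser [] [] []) n (none, tapes [] [b] [] [] []) := by
  cases b
  · exact ⟨_, by omega, .seq (run_look false) (.seq (.iteFalse rfl (.load _ _ _)) (.load _ _ _))⟩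
  · exact ⟨_, by omega, .seq (run_look true) (.seq (.iteTrue rfl (.seq (run_read_main true)
      (.seq (run_read_main false) (.seq (run_read_main false) (run_push_main fun _ => true)))))
      (.load _ _ _))⟩

/-- A function computable in time polynomial in `B` is computed by a stack machine. -/
theorem FPB.exists_machine {B : Instance → ℕ} {f : Instance → Bool} (hf : FPB B f) :
    ∃ (b : ℕ → ℕ) (M : Turing.TM2ComputableAux Sym Bool), PolyBd b ∧
      (∀ i : M.tm.K, Finite (M.tm.Γ i)) ∧
      ∀ I t, b (B I) ≤ t → Nonempty (Turing.TM2OutputsInTime M.tm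
        (I.encode.map M.inputAlphabet.invFun)
        (some ((Computability.encodeBool (f I)).map M.outputAlphabet.invFun)) t) := by
  obtain ⟨hB, p, b, hb, hp⟩ := hf
  refine ⟨fun n => 12 * n + b n + 12,
    ⟨machine (seq readInput (seq p writeOutput)), Equiv.refl _, Equiv.refl _⟩, by fun_prop, ?_,
    fun I t ht => ?_⟩
  · intro i
    cases i
    · exact inferInstanceAs (Finite Sym)
    all_goals exact inferInstanceAs (Finite Bool)
  · obtain ⟨n, hn, v, h⟩ := run_readInput I.encode
    obtain ⟨v', m, hm, h'⟩ := (hp I).2 v [] []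
    obtain ⟨l, hl, h''⟩ := run_writeOutput (f I) v'
    rw [List.append_nil, List.append_nil] at h'
    have := machine_outputs (.seq h (.seq h' h'')) (t := t) ?_
    · rw [← List.map_id I.encode] at this
      exact this
    · have h1 := length_lt_size I.encode.reverse
      rw [List.length_reverse] at h1
      have h2 : size I.encode.reverse ≤ B I := hB I
      dsimp only at ht
      omega

end TEDSC

namespace TEDSC

open TreeEnc (enc)

/-! ### Lists and numbers in polynomial time -/

theorem foldl_cons_eq_reverse_append {β : Type} (l l' : List β) :
    l.foldl (fun acc b => b :: acc) l' = l.reverse ++ l' := by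
  induction l generalizing l' with
  | nil => simp
  | cons b l ih => simp [ih]

section lists

variable {α β γ : Type} [TreeEnc α] [TreeEnc β] [TreeEnc γ]

@[fun_prop]
theorem FP.reverse {l : α → List β} (hl : FP l) : FP fun a => (l a).reverse := by
  have hs : ∀ l : List β, size l.reverse = size l := by
    intro l
    induction l with
    | nil => rfl
    | cons b l ih =>
      have := size_append l.reverse [b]
      simp only [List.reverse_cons, size_cons, size_nil] at this ⊢
      omega
  obtain ⟨b, hb, hsize⟩ := hl.size_le
  refine (FP.foldl hl (i := fun _ => []) (step := fun _ acc b => b :: acc) (by fun_prop)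
    (by fun_prop) ⟨b, hb, fun a l' h => ?_⟩).cast
      fun a => by rw [foldl_cons_eq_reverse_append, List.append_nil]
  rw [foldl_cons_eq_reverse_append, List.append_nil, hs]
  exact (size_le_of_sublist h.sublist).trans (hsize a)

@[fun_prop]
theorem FP.append {l l' : α → List β} (hl : FP l) (hl' : FP l') : FP fun a => l a ++ l' a := by
  obtain ⟨b, hb, hsize⟩ := hl.reverse.size_le
  obtain ⟨b', hb', hsize'⟩ := hl'.size_le
  obtain ⟨b₂, hb₂, hrev⟩ := (FP.reverse (FP.id (α := List β))).size_le
  refine (FP.foldl hl.reverse hl' (step := fun _ acc b => b :: acc)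
    (by fun_prop) ⟨fun n => b₂ (b n) + b' n, by fun_prop, fun a l'' h => ?_⟩).cast
      fun a => by rw [foldl_cons_eq_reverse_append, List.reverse_reverse]
  rw [foldl_cons_eq_reverse_append]
  have h1 := size_append_le l''.reverse (l' a)
  have h2 := (hrev l'').trans (hb₂.1 ((size_le_of_sublist h.sublist).trans (hsize a)))
  have h3 := hsize' a
  dsimp only
  omega

@[fun_prop]
theorem FP.flatMap {l : α → List β} {f : α → β → List γ} (hl : FP l)
    (hf : FP fun x : α × β => f x.1 x.2) : FP fun a => (l a).flatMap (f a) := by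
  have key : ∀ (a : α) (l : List β) (l' : List γ),
      l.foldl (fun acc b => acc ++ f a b) l' = l' ++ l.flatMap (f a) := by
    intro a l
    induction l with
    | nil => simp
    | cons b l ih => simp [ih]
  obtain ⟨b, hb, hsize⟩ := hl.size_le
  obtain ⟨b', hb', hsize'⟩ := hf.size_le
  have hs : FP fun x : α × List γ × β => x.2.1 ++ f x.1 x.2.2 :=
    FP.append (by fun_prop)
      (hf.comp (f := fun x : α × List γ × β => (x.1, x.2.2)) (by fun_prop))
  refine (FP.foldl hl (i := fun _ => []) (step := fun a acc b => acc ++ f a b) (by fun_prop) hs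
    ⟨fun n => b n * b' (n + b n + 1) + 1, by fun_prop, fun a l' h => ?_⟩).cast
      fun a => by rw [key, List.nil_append]
  rw [key, List.nil_append]
  have h1 := size_le_of_sublist h.sublist
  have h2 := hsize a
  refine (size_flatMap_le (m := b' (size a + b (size a) + 1)) fun x hx => ?_).trans ?_
  · refine (hsize' (a, x)).trans (hb'.1 ?_)
    have := size_le_of_mem hx
    simp only [size_pair]
    omega
  · have := length_lt_size l'
    exact Nat.succ_le_succ (Nat.mul_le_mul_right _ (by omega))

@[fun_prop]
theorem FP.map {l : α → List β} {f : α → β → γ} (hl : FP l)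
    (hf : FP fun x : α × β => f x.1 x.2) : FP fun a => (l a).map (f a) :=
  (FP.flatMap (f := fun a b => [f a b]) hl (by fun_prop)).cast fun a => by
    rw [List.map_eq_flatMap]

@[fun_prop]
theorem FP.filter {l : α → List β} {p : α → β → Bool} (hl : FP l)
    (hp : FP fun x : α × β => p x.1 x.2) : FP fun a => (l a).filter (p a) := by
  refine (FP.flatMap (f := fun a b => if p a b then [b] else []) hl
    (FP.ite hp (by fun_prop) (by fun_prop))).cast fun a => ?_
  congr 1
  induction l a with
  | nil => rfl
  | cons b l ih => rw [List.filter_cons, List.flatMap_cons, ih]; split <;> simp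

@[fun_prop]
theorem FP.not {f : α → Bool} (hf : FP f) : FP fun a => !f a :=
  (FP.ite hf (FP.const false) (FP.const true)).cast fun a => by cases f a <;> rfl

@[fun_prop]
theorem FP.and {f g : α → Bool} (hf : FP f) (hg : FP g) : FP fun a => f a && g a :=
  (FP.ite hf hg (FP.const false)).cast fun a => by cases f a <;> rfl

@[fun_prop]
theorem FP.or {f g : α → Bool} (hf : FP f) (hg : FP g) : FP fun a => f a || g a :=
  (FP.ite hf (FP.const true) hg).cast fun a => by cases f a <;> rfl

@[fun_prop]
theorem FP.xor {f g : α → Bool} (hf : FP f) (hg : FP g) : FP fun a => xor (f a) (g a) :=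
  (FP.ite hf hg.not hg).cast fun a => by cases f a <;> cases g a <;> rfl

@[fun_prop]
theorem FP.isEmpty {l : α → List β} (hl : FP l) : FP fun a => (l a).isEmpty :=
  (hl.listCases (f := fun _ => true) (g := fun _ _ _ => false) (by fun_prop)
    (by fun_prop)).cast fun a => by cases l a <;> rfl

@[fun_prop]
theorem FP.any {l : α → List β} {p : α → β → Bool} (hl : FP l)
    (hp : FP fun x : α × β => p x.1 x.2) : FP fun a => (l a).any (p a) := by
  refine (FP.not (FP.isEmpty (FP.filter hl hp))).cast fun a => ?_
  congr 1
  induction l a with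
  | nil => rfl
  | cons b l ih =>
    rw [List.any_cons, List.filter_cons, ih]
    cases p a b <;> simp

@[fun_prop]
theorem FP.all {l : α → List β} {p : α → β → Bool} (hl : FP l)
    (hp : FP fun x : α × β => p x.1 x.2) : FP fun a => (l a).all (p a) := by
  refine (FP.not (FP.any (p := fun a b => !p a b) hl (FP.not hp))).cast fun a => ?_
  rw [List.all_eq_not_any_not]

@[fun_prop]
theorem FP.tail {l : α → List β} (hl : FP l) : FP fun a => (l a).tail :=
  (hl.listCases (f := fun _ => []) (g := fun _ _ t => t) (by fun_prop) (by fun_prop)).cast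
    fun a => by cases l a <;> rfl

theorem FP.headD {l : α → List β} {f : α → β} (hl : FP l) (hf : FP f) :
    FP fun a => (l a).headD (f a) :=
  (hl.listCases hf (g := fun _ b _ => b) (by fun_prop)).cast fun a => by cases l a <;> rfl

end lists

section numbers

variable {α β : Type} [TreeEnc α] [TreeEnc β]

@[fun_prop]
theorem FP.bits {f : α → ℕ} (hf : FP f) : FP fun a => (f a).bits := hf.cast fun _ => rfl

@[fun_prop]
theorem FP.bodd {f : α → ℕ} (hf : FP f) : FP fun a => (f a).bodd :=
  (hf.bits.headD (FP.const false)).cast fun a => by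
    rw [Nat.bodd_eq_bits_head]; cases (f a).bits <;> rfl

@[fun_prop]
theorem FP.div2 {f : α → ℕ} (hf : FP f) : FP fun a => (f a).div2 :=
  hf.bits.tail.cast fun a => by rw [← Nat.div2_bits_eq_tail]; rfl

@[fun_prop]
theorem FP.bit {c : α → Bool} {f : α → ℕ} (hc : FP c) (hf : FP f) :
    FP fun a => Nat.bit (c a) (f a) := by
  have h : FP fun a => if !c a && (f a).bits.isEmpty then ([] : List Bool)
      else c a :: (f a).bits := by fun_prop
  refine h.cast fun a => ?_
  rcases Nat.eq_zero_or_pos (f a) with h0 | h0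
  · rw [h0]
    cases c a <;> rfl
  · have h1 : (Nat.bit (c a) (f a)).bits = c a :: (f a).bits :=
      Nat.bits_append_bit _ _ fun h => by omega
    have h2 : (f a).bits.isEmpty = false := by
      rw [List.isEmpty_eq_false_iff]
      intro h3
      have h4 := Nat.size_eq_bits_len (f a)
      rw [h3] at h4
      have := Nat.size_pos.2 h0
      simp at h4
      omega
    rw [h2, Bool.and_false, if_neg (by simp), ← h1]
    rfl

theorem size_div2_le (n : ℕ) : size n.div2 ≤ size n := by
  have h : size n.div2.bits ≤ size n.bits := by
    rw [Nat.div2_bits_eq_tail]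
    exact size_le_of_sublist (List.tail_sublist _)
  exact h

/-- The comparison of natural numbers, as a Boolean value. -/
def ltB (m n : ℕ) : Bool := decide (m < n)

/-- The equality of natural numbers, as a Boolean value. -/
def eqB (m n : ℕ) : Bool := decide (m = n)

@[simp] theorem ltB_iff {m n : ℕ} : ltB m n = true ↔ m < n := decide_eq_true_iff

@[simp] theorem eqB_iff {m n : ℕ} : eqB m n = true ↔ m = n := decide_eq_true_iff

/-- One round of the comparison of two numbers, from the least significant bit on. The last
component of the state is the result for the bits compared already. -/
def cmpStep (s : ℕ × ℕ × Bool) (_ : Bool) : ℕ × ℕ × Bool :=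
  (s.1.div2, s.2.1.div2, if xor s.1.bodd s.2.1.bodd then s.2.1.bodd else s.2.2)

theorem foldl_cmpStep (L : List Bool) (m n : ℕ) (r : Bool) (hm : m < 2 ^ L.length)
    (hn : n < 2 ^ L.length) :
    (L.foldl cmpStep (m, n, r)).2.2 = if m = n then r else decide (m < n) := by
  induction L generalizing m n r with
  | nil =>
    simp only [List.length_nil, pow_zero, Nat.lt_one_iff] at hm hn
    simp [hm, hn]
  | cons x L ih =>
    simp only [List.length_cons, pow_succ] at hm hn
    rw [List.foldl_cons, cmpStep]
    rw [ih _ _ _ (by rw [Nat.div2_val]; dsimp only; omega)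
      (by rw [Nat.div2_val]; dsimp only; omega)]
    have h1 := Nat.bodd_add_div2 m
    have h2 := Nat.bodd_add_div2 n
    rcases e1 : m.bodd <;> rcases e2 : n.bodd <;> rw [e1] at h1 <;> rw [e2] at h2 <;>
      simp only [Bool.toNat_false, Bool.toNat_true] at h1 h2 <;>
      simp only [Bool.xor_false, Bool.xor_true, Bool.not_true, Bool.not_false, if_true, if_false,
        Bool.false_eq_true] <;> split_ifs <;> first | rfl | omega | skip
    all_goals simp only [decide_eq_decide, decide_eq_true_eq, decide_eq_false_iff_not,
      Bool.true_eq, Bool.false_eq] at *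
    all_goals omega

@[fun_prop]
theorem FP.ltB {f g : α → ℕ} (hf : FP f) (hg : FP g) : FP fun a => ltB (f a) (g a) := by
  have hs : FP fun x : α × (ℕ × ℕ × Bool) × Bool => cmpStep x.2.1 x.2.2 := by
    unfold cmpStep; fun_prop
  obtain ⟨b, hb, hfs⟩ := hf.size_le
  obtain ⟨b', hb', hgs⟩ := hg.size_le
  have hL : FP fun a => (f a).bits ++ (g a).bits := by fun_prop
  have h : FP fun a => (((f a).bits ++ (g a).bits).foldl cmpStep (f a, g a, false)) := by
    refine FP.foldl hL (i := fun a => (f a, g a, false))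
      (by fun_prop) hs ⟨fun n => b n + b' n + 5, by fun_prop, fun a l _ => ?_⟩
    have key : ∀ (l : List Bool) (s : ℕ × ℕ × Bool), size s.1 ≤ b (size a) →
        size s.2.1 ≤ b' (size a) → size (l.foldl cmpStep s) ≤ b (size a) + b' (size a) + 5 := by
      intro l
      induction l with
      | nil =>
        intro s h1 h2
        have := size_bool_le s.2.2
        simp only [List.foldl_nil, size_pair]
        omega
      | cons x l ih =>
        exact fun s h1 h2 => ih _ ((size_div2_le _).trans h1) ((size_div2_le _).trans h2)
    exact key l _ (hfs a) (hgs a)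
  refine (FP.snd (FP.snd h)).cast fun a => ?_
  have hlt : ∀ n : ℕ, n < 2 ^ n.bits.length := fun n => by
    rw [Nat.size_eq_bits_len]; exact Nat.lt_size_self n
  rw [foldl_cmpStep]
  · congr 1
    unfold TEDSC.ltB
    split_ifs with h
    · simp [h]
    · rfl
  · exact (hlt _).trans_le (Nat.pow_le_pow_right (by omega) (by simp))
  · exact (hlt _).trans_le (Nat.pow_le_pow_right (by omega) (by simp))

@[fun_prop]
theorem FP.eqB {f g : α → ℕ} (hf : FP f) (hg : FP g) : FP fun a => eqB (f a) (g a) := by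
  have h : FP fun a => !TEDSC.ltB (f a) (g a) && !TEDSC.ltB (g a) (f a) := by fun_prop
  refine h.cast fun a => ?_
  congr 1
  rw [Bool.eq_iff_iff]
  simp [TEDSC.ltB]
  omega

/-- The number with given bits, the most significant bit first. -/
def ofBits (l : List Bool) : ℕ := l.foldl (fun n b => Nat.bit b n) 0

theorem foldl_bit_lt (l : List Bool) (n : ℕ) :
    l.foldl (fun n b => Nat.bit b n) n < (n + 1) * 2 ^ l.length := by
  induction l generalizing n with
  | nil => simp
  | cons b l ih =>
    refine (ih _).trans_le ?_
    rw [List.length_cons, pow_succ', ← mul_assoc]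
    refine Nat.mul_le_mul_right _ ?_
    cases b <;> simp [Nat.bit] <;> omega

@[fun_prop]
theorem FP.ofBits {l : α → List Bool} (hl : FP l) : FP fun a => ofBits (l a) := by
  obtain ⟨b, hb, hsize⟩ := hl.size_le
  refine FP.foldl hl (i := fun _ => 0) (step := fun _ n b => Nat.bit b n) (by fun_prop)
    (by fun_prop) ⟨fun n => 4 * b n + 1, by fun_prop, fun a l' h => ?_⟩
  refine (size_nat_le _).trans ?_
  have h1 := foldl_bit_lt l' 0
  rw [zero_add, one_mul, ← Nat.size_le] at h1
  have h2 := length_lt_size l'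
  have h3 := size_le_of_sublist h.sublist
  have h4 := hsize a
  dsimp only
  omega

/-- One round of the addition of two numbers. The state consists of the remaining bits, the carry,
and the bits of the sum found already, the last one first. -/
def addStep (s : ℕ × ℕ × Bool × List Bool) (_ : Bool) : ℕ × ℕ × Bool × List Bool :=
  (s.1.div2, s.2.1.div2,
    (s.1.bodd && s.2.1.bodd) || (s.2.2.1 && (s.1.bodd || s.2.1.bodd)),
    xor (xor s.1.bodd s.2.1.bodd) s.2.2.1 :: s.2.2.2)

theorem foldl_addStep (L : List Bool) (m n : ℕ) (c : Bool) (l : List Bool)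
    (h : m + n + c.toNat < 2 ^ L.length) :
    ofBits (L.foldl addStep (m, n, c, l)).2.2.2 =
      l.foldl (fun n b => Nat.bit b n) (m + n + c.toNat) := by
  induction L generalizing m n c l with
  | nil =>
    simp only [List.length_nil, pow_zero, Nat.lt_one_iff] at h
    rw [h]
    rfl
  | cons x L ih =>
    simp only [List.length_cons, pow_succ] at h
    have h1 := Nat.bodd_add_div2 m
    have h2 := Nat.bodd_add_div2 n
    rw [List.foldl_cons, addStep, ih]
    · dsimp only
      rw [List.foldl_cons]
      congr 1
      revert h1 h2
      cases m.bodd <;> cases n.bodd <;> cases c <;>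
        simp [Nat.bit] <;> omega
    · dsimp only
      revert h h1 h2
      cases m.bodd <;> cases n.bodd <;> cases c <;> simp <;> omega

@[fun_prop]
theorem FP.add {f g : α → ℕ} (hf : FP f) (hg : FP g) : FP fun a => f a + g a := by
  have hs : FP fun x : α × (ℕ × ℕ × Bool × List Bool) × Bool => addStep x.2.1 x.2.2 := by
    unfold addStep; fun_prop
  obtain ⟨b, hb, hfs⟩ := hf.size_le
  obtain ⟨b', hb', hgs⟩ := hg.size_le
  have hL : FP fun a => (f a).bits ++ (g a).bits ++ [true] := by fun_prop
  obtain ⟨b₂, hb₂, hLs⟩ := hL.size_le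
  have h : FP fun a => (((f a).bits ++ (g a).bits ++ [true]).foldl addStep
      (f a, g a, false, [])) := by
    refine FP.foldl hL (i := fun a => (f a, g a, false, []))
      (by fun_prop) hs ⟨fun n => b n + b' n + 4 * b₂ n + 7, by fun_prop, fun a l hl => ?_⟩
    have key : ∀ (l : List Bool) (s : ℕ × ℕ × Bool × List Bool), size s.1 ≤ b (size a) →
        size s.2.1 ≤ b' (size a) → size (l.foldl addStep s) ≤
          b (size a) + b' (size a) + size s.2.2.2 + 4 * l.length + 6 := by
      intro l
      induction l with
      | nil =>
        intro s h1 h2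
        have := size_bool_le s.2.2.1
        simp only [List.foldl_nil, size_pair, List.length_nil]
        omega
      | cons x l ih =>
        intro s h1 h2
        have := ih (addStep s x) ((size_div2_le _).trans h1) ((size_div2_le _).trans h2)
        have h3 : size (addStep s x).2.2.2 ≤ size s.2.2.2 + 4 := by
          simp only [addStep, size_cons]
          have := size_bool_le (Bool.xor (Bool.xor s.1.bodd s.2.1.bodd) s.2.2.1)
          omega
        simp only [List.foldl_cons, List.length_cons]
        omega
    have h1 := key l (f a, g a, false, []) (hfs a) (hgs a)
    have h2 := length_lt_size l
    have h3 := size_le_of_sublist hl.sublist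
    have h4 := hLs a
    simp only [size_nil] at h1
    dsimp only
    omega
  refine (FP.ofBits (FP.snd (FP.snd (FP.snd h)))).cast fun a => ?_
  have hlt : ∀ n : ℕ, n < 2 ^ n.bits.length := fun n => by
    rw [Nat.size_eq_bits_len]; exact Nat.lt_size_self n
  rw [foldl_addStep]
  · simp
  · have h1 := (hlt (f a)).trans_le (Nat.pow_le_pow_right (n := 2) (by omega)
      (Nat.le_add_right (f a).bits.length (g a).bits.length))
    have h2 := (hlt (g a)).trans_le (Nat.pow_le_pow_right (n := 2) (by omega)
      (Nat.le_add_left (g a).bits.length (f a).bits.length))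
    simp only [List.length_append, List.length_singleton, pow_succ, Bool.toNat_false]
    omega

/-- The list `[0, …, l.length - 1]`. -/
@[fun_prop]
theorem FP.range {l : α → List β} (hl : FP l) : FP fun a => List.range (l a).length := by
  obtain ⟨b, hb, hsize⟩ := hl.size_le
  have key : ∀ l : List β, l.foldl (fun (s : ℕ × List ℕ) _ => (s.1 + 1, s.2 ++ [s.1])) (0, []) =
      (l.length, List.range l.length) := by
    intro l
    induction l using List.reverseRecOn with
    | nil => rfl
    | append_singleton l x ih => rw [List.foldl_append, ih]; simp [List.range_succ]
  have h : FP fun a => (l a).foldl (fun (s : ℕ × List ℕ) _ => (s.1 + 1, s.2 ++ [s.1])) (0, []) := by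
    refine FP.foldl hl (i := fun _ => (0, []))
      (step := fun _ (s : ℕ × List ℕ) _ => (s.1 + 1, s.2 ++ [s.1])) (by fun_prop) (by fun_prop)
      ⟨fun n => 4 * b n + b n * (4 * b n + 1 + 1) + 4, by fun_prop, fun a l' h => ?_⟩
    rw [key, size_pair]
    have h1 : l'.length ≤ b (size a) :=
      (length_lt_size l').le.trans ((size_le_of_sublist h.sublist).trans (hsize a))
    have hn : ∀ n ≤ l'.length, size n ≤ 4 * b (size a) + 1 := fun n hn => by
      have h2 := size_nat_le n
      have h3 : n.size ≤ n := Nat.size_le.2 n.lt_two_pow_self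
      omega
    have h2 := hn _ le_rfl
    have h3 := size_list_le (l := List.range l'.length) (m := 4 * b (size a) + 1)
      fun n h => hn n (List.mem_range.1 h).le
    rw [List.length_range] at h3
    have h4 := Nat.mul_le_mul_right (4 * b (size a) + 1 + 1) h1
    dsimp only
    omega
  exact (FP.snd h).cast fun a => by rw [key]

/-- Insertion of a number into a strictly sorted list. -/
def ins (l : List ℕ) (x : ℕ) : List ℕ :=
  l.filter (fun y => ltB y x) ++ x :: l.filter (fun y => ltB x y)

/-- The strictly sorted list with the same elements as a given list. -/
def sort (l : List ℕ) : List ℕ := l.foldl ins []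

theorem mem_sort {l : List ℕ} {x : ℕ} : x ∈ sort l ↔ x ∈ l := by
  have hins : ∀ l x y, y ∈ ins l x ↔ y = x ∨ y ∈ l := by
    intro l x y
    simp only [ins, List.mem_append, List.mem_filter, ltB_iff, List.mem_cons]
    rcases lt_trichotomy x y with h | h | h
    · simp [h, h.not_gt]
    · simp [h]
    · simp [h, h.not_gt, h.ne]
  have : ∀ l₀, x ∈ l.foldl ins l₀ ↔ x ∈ l ∨ x ∈ l₀ := by
    induction l with
    | nil => simp
    | cons y l ih => intro l₀; rw [List.foldl_cons, ih, hins, List.mem_cons]; tauto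
  simpa [sort] using this []

theorem sort_sorted (l : List ℕ) : (sort l).Pairwise (· < ·) := by
  have hins : ∀ l x, l.Pairwise (· < ·) → (ins l x).Pairwise (· < ·) := by
    intro l x h
    rw [ins, List.pairwise_append, List.pairwise_cons]
    refine ⟨h.filter _, ⟨by simp, h.filter _⟩, ?_⟩
    intro y hy z hz
    simp only [List.mem_filter, ltB_iff, List.mem_cons] at hy hz
    omega
  have : ∀ l₀, l₀.Pairwise (· < ·) → (l.foldl ins l₀).Pairwise (· < ·) := by
    induction l with
    | nil => exact fun _ h => h
    | cons y l ih => exact fun l₀ h => ih _ (hins _ _ h)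
  exact this [] List.Pairwise.nil

@[fun_prop]
theorem FP.sort {l : α → List ℕ} (hl : FP l) : FP fun a => sort (l a) := by
  obtain ⟨b, hb, hsize⟩ := hl.size_le
  have hs : FP fun x : α × List ℕ × ℕ => ins x.2.1 x.2.2 := by unfold ins; fun_prop
  refine FP.foldl hl (i := fun _ => []) (step := fun _ => ins) (by fun_prop) hs
    ⟨b, hb, fun a l' h => ?_⟩
  have hf : ∀ (l : List ℕ) x, size (l.filter fun y => TEDSC.ltB y x) +
      size (l.filter fun y => TEDSC.ltB x y) ≤ size l + 1 := by
    intro l x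
    induction l with
    | nil => simp
    | cons y l ih =>
      simp only [List.filter_cons]
      split_ifs with h1 h2
      · simp only [ltB_iff] at h1 h2; omega
      all_goals simp only [size_cons]; omega
  have key : ∀ l l₀ : List ℕ, size (l.foldl ins l₀) + 1 ≤ size l₀ + size l := by
    intro l
    induction l with
    | nil => simp
    | cons x l ih =>
      intro l₀
      have h1 := ih (ins l₀ x)
      have h2 := hf l₀ x
      have h3 : size (ins l₀ x) + 1 = size (l₀.filter fun y => TEDSC.ltB y x) +
          size (x :: l₀.filter fun y => TEDSC.ltB x y) := size_append _ _
      simp only [List.foldl_cons, size_cons] at h3 ⊢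
      omega
  have h1 := key l' []
  have h2 := (size_le_of_sublist h.sublist).trans (hsize a)
  simp only [size_nil] at h1
  omega

end numbers

end TEDSC

namespace TEDSC

open TreeEnc (enc)

/-! ### Reading an instance in polynomial time -/

section parse

attribute [fun_prop] FP.headD

/-- One round of the reading of an encoded instance, from its end. The state consists of the lists
of bit strings read so far; the first bit string of the first list is still incomplete. -/
def readSym (l : List (List (List Bool))) (s : Sym) : List (List (List Bool)) :=
  if s.isBit then ((s.val :: (l.headD []).headD []) :: (l.headD []).tail) :: l.tail
  else if s.val then [] :: l else ([] :: l.headD []) :: l.tail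

theorem foldr_readSym_encodeList (l : List ℕ) (s : List Sym) :
    (encodeList l ++ s).foldr (fun a b => readSym b a) [] =
      l.map Nat.bits :: s.foldr (fun a b => readSym b a) [] := by
  have h : ∀ (bs : List Bool) (s : List Sym) X Y, s.foldr (fun a b => readSym b a) [] = X :: Y →
      (bs.map Sym.bit ++ [Sym.comma] ++ s).foldr (fun a b => readSym b a) [] =
        (bs :: X) :: Y := by
    intro bs s X Y h
    rw [List.append_assoc, List.foldr_append, List.foldr_append, h]
    induction bs with
    | nil => rfl
    | cons b bs ih => rw [List.map_cons, List.foldr_cons, ih]; rfl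
  induction l with
  | nil => rfl
  | cons n l ih =>
    have := h n.bits (encodeList l ++ s) _ _ ih
    simpa [encodeList, encodeNum] using this

/-- The lists of numbers that make up an encoded instance. -/
theorem FP.parse : FP fun I : Instance => [[I.k], [I.h], List.range I.n,
    I.edges.flatMap fun e => [(e.1 : ℕ), (e.2 : ℕ)],
    I.demands.flatMap fun d => [(d.1 : ℕ), (d.2.1 : ℕ), d.2.2]] := by
  have hw : FP fun I : Instance => I.encode.reverse := FP.id.cast fun _ => rfl
  have hval : FP Sym.val := (FP.snd (FP.id (α := Bool × Bool))).comp
    (FP.cast (FP.id (α := Sym)) (g := fun s : Sym => (s.isBit, s.val)) fun _ => rfl)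
  have hbit : FP Sym.isBit := (FP.fst (FP.id (α := Bool × Bool))).comp
    (FP.cast (FP.id (α := Sym)) (g := fun s : Sym => (s.isBit, s.val)) fun _ => rfl)
  have hs : FP fun x : Instance × List (List (List Bool)) × Sym => readSym x.2.1 x.2.2 := by
    unfold readSym
    have h1 : FP fun x : Instance × List (List (List Bool)) × Sym => x.2.2.val :=
      hval.comp (by fun_prop)
    have h2 : FP fun x : Instance × List (List (List Bool)) × Sym => x.2.2.isBit :=
      hbit.comp (by fun_prop)
    fun_prop
  have hsize : ∀ {β : Type} [TreeEnc β] (l : List (List β)),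
      size (l.headD []) + size l.tail ≤ size l + 1 := by
    intro β _ l
    cases l
    · exact le_rfl
    · simp only [List.headD_cons, List.tail_cons, size_cons]
      omega
  have hread : ∀ l s, size (readSym l s) ≤ size l + 8 := by
    intro l s
    have h1 := hsize l
    have h2 := hsize (l.headD [])
    have h3 := size_bool_le s.val
    unfold readSym
    split_ifs <;> simp only [size_cons, size_nil] <;> omega
  have h : FP fun I : Instance => I.encode.reverse.foldl readSym [] := by
    refine FP.foldl hw (i := fun _ => []) (step := fun _ => readSym) (by fun_prop) hs
      ⟨fun n => 8 * n + 1, by fun_prop, fun I l hl => ?_⟩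
    have key : ∀ (l : List Sym) l', size (l.foldl readSym l') ≤ 8 * l.length + size l' := by
      intro l
      induction l with
      | nil => simp
      | cons s l ih =>
        intro l'
        have h1 := ih (readSym l' s)
        have h2 := hread l' s
        simp only [List.foldl_cons, List.length_cons]
        omega
    have h1 := key l []
    have h2 := length_lt_size l
    have h3 := size_le_of_sublist hl.sublist
    have h4 : size I.encode.reverse = size I := rfl
    rw [size_nil] at h1
    dsimp only
    omega
  refine h.cast fun I => ?_
  have e : ∀ l : List ℕ, enc (l.map Nat.bits) = enc l := by
    intro l
    induction l with
    | nil => rfl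
    | cons n l ih => exact congrArg (Tree.cons _) ih
  have e' : ∀ l : List (List ℕ), enc (l.map (List.map Nat.bits)) = enc l := by
    intro l
    induction l with
    | nil => rfl
    | cons n l ih => exact congrArg₂ Tree.cons (e n) ih
  rw [List.foldl_reverse, Instance.encode, ← e', List.append_assoc, List.append_assoc,
    List.append_assoc, foldr_readSym_encodeList, foldr_readSym_encodeList,
    foldr_readSym_encodeList, foldr_readSym_encodeList, ← List.append_nil (encodeList _),
    foldr_readSym_encodeList]
  rfl

@[fun_prop]
theorem FP.k : FP fun I : Instance => I.k :=
  ((FP.id.headD (FP.const [])).headD (FP.const 0)).comp FP.parse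

@[fun_prop]
theorem FP.h : FP fun I : Instance => I.h :=
  ((FP.id.tail.headD (FP.const [])).headD (FP.const 0)).comp FP.parse

@[fun_prop]
theorem FP.vertices {α : Type} [TreeEnc α] {I : α → Instance} (hI : FP I) :
    FP fun a => List.range (I a).n :=
  ((FP.id.tail.tail.headD (FP.const [])).comp FP.parse).comp hI

/-- One round of the grouping of a list into pairs. -/
def pairStep (s : List ℕ × List (ℕ × ℕ)) (x : ℕ) : List ℕ × List (ℕ × ℕ) :=
  if s.1.isEmpty then ([x], s.2) else ([], s.2 ++ [(s.1.headD 0, x)])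

/-- One round of the grouping of a list into triples. -/
def tripleStep (s : List ℕ × List (ℕ × ℕ × ℕ)) (x : ℕ) : List ℕ × List (ℕ × ℕ × ℕ) :=
  if s.1.isEmpty then ([x], s.2)
  else if s.1.tail.isEmpty then (s.1 ++ [x], s.2)
  else ([], s.2 ++ [(s.1.headD 0, s.1.tail.headD 0, x)])

/-- Iterations through a list of numbers whose state grows by at most the size of each number. -/
theorem FP.foldl_group {α β : Type} [TreeEnc α] [TreeEnc β] {l : α → List ℕ} (hl : FP l)
    {f : List ℕ × List β → ℕ → List ℕ × List β} (hf : FP fun x : (List ℕ × List β) × ℕ => f x.1 x.2)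
    {c : ℕ} (hs : ∀ s x, size (f s x) ≤ size s + size x + c) :
    FP fun a => ((l a).foldl f ([], [])).2 := by
  obtain ⟨b, hb, hsize⟩ := hl.size_le
  have h : FP fun a => (l a).foldl f ([], []) := by
    refine FP.foldl hl (i := fun _ => ([], [])) (step := fun _ => f) (by fun_prop)
      (hf.comp (f := fun x : α × (List ℕ × List β) × ℕ => (x.2.1, x.2.2)) (by fun_prop))
      ⟨fun n => b n + c * b n + 3, by fun_prop, fun a l' h => ?_⟩
    have key : ∀ (l : List ℕ) s, size (l.foldl f s) ≤ size l + c * l.length + size s := by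
      intro l
      induction l with
      | nil => simp
      | cons x l ih =>
        intro s
        have h1 := ih (f s x)
        have h2 := hs s x
        simp only [List.foldl_cons, List.length_cons, size_cons, mul_add]
        omega
    have h1 := key l' ([], [])
    have h2 := length_lt_size l'
    have h3 := (size_le_of_sublist h.sublist).trans (hsize a)
    have h4 : c * l'.length ≤ c * b (size a) := Nat.mul_le_mul_left _ (by omega)
    have h5 : size (([] : List ℕ), ([] : List β)) = 3 := rfl
    dsimp only
    omega
  exact FP.snd h

theorem size_headD_le {α : Type} [TreeEnc α] (l : List α) (a : α) :
    size (l.headD a) ≤ size l + size a := by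
  cases l
  · simp
  · simp only [List.headD_cons, size_cons]; omega

/-- The edges of an instance, as pairs of numbers. -/
def Instance.edgeList (I : Instance) : List (ℕ × ℕ) := I.edges.map fun e => (e.1, e.2)

/-- The demands of an instance, as triples of numbers. -/
def Instance.demandList (I : Instance) : List (ℕ × ℕ × ℕ) :=
  I.demands.map fun d => (d.1, d.2.1, d.2.2)

@[fun_prop]
theorem FP.edgeList : FP Instance.edgeList := by
  have h : FP fun I : Instance => I.edges.flatMap fun e => [(e.1 : ℕ), (e.2 : ℕ)] :=
    (FP.id.tail.tail.tail.headD (FP.const [])).comp FP.parse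
  have hs : FP fun x : (List ℕ × List (ℕ × ℕ)) × ℕ => pairStep x.1 x.2 := by
    unfold pairStep; fun_prop
  refine (FP.foldl_group h hs (c := 10) fun s x => ?_).cast fun I => ?_
  · unfold pairStep
    have h1 := size_headD_le s.1 0
    have h2 : size (0 : ℕ) = 1 := rfl
    have h3 := size_append s.2 [(s.1.headD 0, x)]
    have h4 := size_pos s.1
    split_ifs <;> simp only [size_pair, size_cons, size_nil] at h3 ⊢ <;> omega
  · have key : ∀ (l : List (Fin I.n × Fin I.n)) r,
        (l.flatMap fun e => [(e.1 : ℕ), (e.2 : ℕ)]).foldl pairStep ([], r) =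
          ([], r ++ l.map fun e => ((e.1 : ℕ), (e.2 : ℕ))) := by
      intro l
      induction l with
      | nil => simp
      | cons e l ih => intro r; simp [pairStep, ih]
    rw [key]
    rfl

@[fun_prop]
theorem FP.demandList : FP Instance.demandList := by
  have h : FP fun I : Instance => I.demands.flatMap fun d => [(d.1 : ℕ), (d.2.1 : ℕ), d.2.2] :=
    (FP.id.tail.tail.tail.tail.headD (FP.const [])).comp FP.parse
  have hs : FP fun x : (List ℕ × List (ℕ × ℕ × ℕ)) × ℕ => tripleStep x.1 x.2 := by
    unfold tripleStep; fun_prop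
  refine (FP.foldl_group h hs (c := 10) fun s x => ?_).cast fun I => ?_
  · unfold tripleStep
    have h1 := size_headD_le s.1 0
    have h1' := size_headD_le s.1.tail 0
    have h2 : size (0 : ℕ) = 1 := rfl
    have h3 := size_append s.2 [(s.1.headD 0, s.1.tail.headD 0, x)]
    have h4 := size_pos s.1
    have h5 := size_append s.1 [x]
    have h6 : size (s.1.headD 0) + size s.1.tail ≤ size s.1 + 1 := by
      rcases s.1 with _ | ⟨y, l⟩
      · exact le_rfl
      · simp only [List.headD_cons, List.tail_cons, size_cons]; omega
    split_ifs <;> simp only [size_pair, size_cons, size_nil] at h3 h5 ⊢ <;> omega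
  · have key : ∀ (l : List (Fin I.n × Fin I.n × ℕ)) r,
        (l.flatMap fun d => [(d.1 : ℕ), (d.2.1 : ℕ), d.2.2]).foldl tripleStep ([], r) =
          ([], r ++ l.map fun d => ((d.1 : ℕ), (d.2.1 : ℕ), d.2.2)) := by
      intro l
      induction l with
      | nil => simp
      | cons e l ih => intro r; simp [tripleStep, ih]
    rw [key]
    rfl

end parse

/-! ### The dynamic program -/

/-- What the dynamic program stores about a walker: whether it moved in the last time step, the
edge along which it moved then, the head of which is its present vertex, and a label. For the
length constraint the label counts the moves; for the lifespan constraint it is a lower bound for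
the times of all the moves. -/
abbrev Pos := Bool × ℕ × ℕ × ℕ

namespace Instance

variable (I : Instance)

/-- The walkers. No more of them than demands are needed. -/
def walkers : List ℕ := (List.range I.demandList.length).filter fun i => ltB i I.k

/-- The time steps with a demand. -/
def demandTimes : List ℕ := I.demandList.map fun d => d.2.2

/-- The time that may pass between a demand and a move: `0, …, m n`, where `m` is the number of
walkers. -/
def delays : List ℕ := List.range (0 :: I.walkers.flatMap fun _ => List.range I.n).length

/-- The time steps at which the walkers may move, in increasing order. -/
def times : List ℕ :=
  sort (I.demandTimes.flatMap fun d => (I.delays.map fun j => d + j).filter fun t =>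
    I.demandTimes.any fun d' => !ltB d' t)

/-- The labels. -/
def labels : List ℕ := (0 :: I.times) ++ List.range (0 :: I.times).length

/-- The possible data of a single walker. -/
def positions : List Pos :=
  [true, false].flatMap fun b => (List.range I.n).flatMap fun u => (List.range I.n).flatMap fun v =>
    I.labels.map fun w => (b, u, v, w)

/-- The states of the dynamic program: data for every walker. -/
def states : List (List (ℕ × Pos)) :=
  I.walkers.foldl (fun acc i => I.positions.flatMap fun q => acc.map fun s => (i, q) :: s) [[]]

/-- Whether a move at time `t` is compatible with the labels before and after it. The Boolean `μ`
selects the length constraint (`true`) or the lifespan constraint (`false`). -/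
def labelOK (μ : Bool) (t w w' : ℕ) : Bool :=
  if μ then eqB w' (w + 1) && !ltB I.h w' else eqB w' w && (!ltB t w && ltB t (w + I.h))

/-- Whether a single walker can pass from `q` to `q'` at time `t`. -/
def stepOK (μ : Bool) (t : ℕ) (q q' : Pos) : Bool :=
  if q'.1 then eqB q'.2.1 q.2.2.1 &&
    ((I.edgeList.any fun e => eqB e.1 q'.2.1 && eqB e.2 q'.2.2.1) &&
      I.labelOK μ t q.2.2.2 q'.2.2.2)
  else eqB q'.2.2.1 q.2.2.1 && eqB q'.2.2.2 q.2.2.2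

/-- Whether the walkers can pass from the state `s` to the state `s'` at time `t`. -/
def transOK (μ : Bool) (t : ℕ) (s s' : List (ℕ × Pos)) : Bool :=
  s'.all fun x' => s.any fun x => eqB x.1 x'.1 && I.stepOK μ t x.2 x'.2

/-- Whether no two walkers have moved along the same edge, and all the demands at time `t` have been
met. -/
def stateOK (t : ℕ) (s : List (ℕ × Pos)) : Bool :=
  (s.all fun x => s.all fun y => !(x.2.1 && (y.2.1 && (eqB x.2.2.1 y.2.2.1 &&
    eqB x.2.2.2.1 y.2.2.2.1))) || eqB x.1 y.1) &&
  I.demandList.all fun d => !eqB d.2.2 t || s.any fun x => x.2.1 &&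
    (eqB x.2.2.1 d.1 && eqB x.2.2.2.1 d.2.1)

/-- Whether the labels of a state are initial ones. -/
def initOK (μ : Bool) (s : List (ℕ × Pos)) : Bool :=
  if μ then s.all fun x => eqB x.2.2.2.2 0 else true

/-- The states that can be reached at the end, where the states are taken from a list `A`. -/
def reach (μ : Bool) (A : List (List (ℕ × Pos))) : List (List (ℕ × Pos)) :=
  I.times.foldl (fun L t => A.filter fun s' => I.stateOK t s' &&
    L.any fun s => I.transOK μ t s s') (A.filter fun s => initOK μ s)

/-- The answer of the dynamic program. -/
def answer (μ : Bool) : Bool := !(I.reach μ I.states).isEmpty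

end Instance

section dynamicProgram

variable {α : Type} [TreeEnc α]

@[fun_prop]
theorem FP.walkers : FP Instance.walkers := by unfold Instance.walkers; fun_prop

@[fun_prop]
theorem FP.demandTimes : FP Instance.demandTimes := by unfold Instance.demandTimes; fun_prop

@[fun_prop]
theorem FP.delays : FP Instance.delays := by unfold Instance.delays; fun_prop

@[fun_prop]
theorem FP.times : FP Instance.times := by unfold Instance.times; fun_prop

@[fun_prop]
theorem FP.labels : FP Instance.labels := by unfold Instance.labels; fun_prop

@[fun_prop]
theorem FP.positions : FP Instance.positions := by unfold Instance.positions; fun_prop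

@[fun_prop]
theorem FP.labelOK {μ : Bool} {I : α → Instance} {t w w' : α → ℕ} (hI : FP I) (ht : FP t)
    (hw : FP w) (hw' : FP w') : FP fun a => (I a).labelOK μ (t a) (w a) (w' a) := by
  unfold Instance.labelOK; cases μ <;> simp <;> fun_prop

@[fun_prop]
theorem FP.stepOK {μ : Bool} {I : α → Instance} {t : α → ℕ} {q q' : α → Pos} (hI : FP I)
    (ht : FP t) (hq : FP q) (hq' : FP q') : FP fun a => (I a).stepOK μ (t a) (q a) (q' a) := by
  unfold Instance.stepOK; fun_prop

@[fun_prop]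
theorem FP.transOK {μ : Bool} {I : α → Instance} {t : α → ℕ} {s s' : α → List (ℕ × Pos)}
    (hI : FP I) (ht : FP t) (hs : FP s) (hs' : FP s') :
    FP fun a => (I a).transOK μ (t a) (s a) (s' a) := by
  unfold Instance.transOK; fun_prop

@[fun_prop]
theorem FP.stateOK {I : α → Instance} {t : α → ℕ} {s : α → List (ℕ × Pos)}
    (hI : FP I) (ht : FP t) (hs : FP s) : FP fun a => (I a).stateOK (t a) (s a) := by
  unfold Instance.stateOK; fun_prop

@[fun_prop]
theorem FP.initOK {μ : Bool} {s : α → List (ℕ × Pos)} (hs : FP s) :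
    FP fun a => Instance.initOK μ (s a) := by
  unfold Instance.initOK; cases μ <;> simp <;> fun_prop

@[fun_prop]
theorem FP.reach {μ : Bool} : FP fun x : Instance × List (List (ℕ × Pos)) => x.1.reach μ x.2 := by
  have hl : FP fun x : Instance × List (List (ℕ × Pos)) => x.1.times := by fun_prop
  refine FP.foldl hl (i := fun x => x.2.filter fun s => Instance.initOK μ s)
    (step := fun x L t => x.2.filter fun s' => x.1.stateOK t s' &&
      L.any fun s => x.1.transOK μ t s s') (by fun_prop) (by fun_prop)
      ⟨fun n => n, by fun_prop, fun x l _ => ?_⟩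
  have hx : size x.2 ≤ size x := by have := size_pair x; omega
  rcases List.eq_nil_or_concat l with rfl | ⟨l, t, rfl⟩
  · exact (size_le_of_sublist List.filter_sublist).trans hx
  · rw [List.concat_eq_append, List.foldl_append]
    exact (size_le_of_sublist List.filter_sublist).trans hx

/-- The bound that is used for the number of states. -/
def stateBound (I : Instance) : ℕ := (size I + 2) ^ (I.k + 1)

/-- There are `|positions| ^ |walkers|` states, each of polynomial size. -/
theorem FPB.states : FPB stateBound Instance.states := by
  have hB : ∀ I : Instance, size I ≤ stateBound I := fun I => by
    have h1 : (size I + 2) ^ 1 ≤ (size I + 2) ^ (I.k + 1) :=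
      Nat.pow_le_pow_right (by omega) (by omega)
    rw [pow_one] at h1
    unfold stateBound
    omega
  obtain ⟨b, ⟨hbm, C, hC⟩, hpos⟩ := FP.positions.size_le
  obtain ⟨b', hb', hwalk⟩ := FP.walkers.size_le
  refine FPB.foldl (FP.walkers.toFPB hB) (i := fun _ => [[]])
    (step := fun I acc i => I.positions.flatMap fun q => acc.map fun s => (i, q) :: s)
    ((FP.const _).toFPB hB) (by fun_prop)
    ⟨fun n => (n ^ C) * (b' n * (b' n + b n + 3) + 3) + 1, ?_, fun I l hl => ?_⟩
  · have h1 : PolyBd fun n => n ^ C :=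
      ⟨fun m n h => Nat.pow_le_pow_left h C, C, fun n => Nat.pow_le_pow_left (by omega) C⟩
    have h2 : PolyBd b := ⟨hbm, C, hC⟩
    fun_prop
  -- every state is a list of entries for the walkers in `l`
  have key : ∀ l : List ℕ, (∀ i ∈ l, size i ≤ b' (size I)) →
      (l.foldl (fun acc i => I.positions.flatMap fun q => acc.map fun s => (i, q) :: s)
        [[]]).length = I.positions.length ^ l.length ∧
      ∀ s ∈ l.foldl (fun acc i => I.positions.flatMap fun q => acc.map fun s => (i, q) :: s)
        [([] : List (ℕ × Pos))], size s ≤ l.length * (b' (size I) + b (size I) + 2) + 1 := by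
    intro l
    induction l using List.reverseRecOn with
    | nil => simp
    | append_singleton l i ih =>
      intro h
      obtain ⟨ih1, ih2⟩ := ih fun i hi => h i (by simp [hi])
      rw [List.foldl_append, List.foldl_cons, List.foldl_nil]
      constructor
      · rw [List.length_flatMap]
        simp [ih1, pow_succ, mul_comm]
      · intro s hs
        simp only [List.mem_flatMap, List.mem_map] at hs
        obtain ⟨q, hq, s, hs, rfl⟩ := hs
        have h1 := ih2 s hs
        have h2 := (size_le_of_mem hq).trans (hpos I)
        have h3 := h i (by simp)
        rw [List.length_append, List.length_singleton, add_mul, size_cons]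
        simp only [size_pair] at h2 ⊢
        omega
  obtain ⟨h1, h2⟩ := key l fun i hi =>
    (size_le_of_mem (hl.sublist.subset hi)).trans (hwalk I)
  refine (size_list_le h2).trans ?_
  rw [h1]
  have hlen : l.length ≤ I.k := by
    have h3 : I.walkers.length ≤ I.k := by
      have h4 : I.walkers ⊆ List.range I.k := fun i hi => by
        simp only [Instance.walkers, List.mem_filter, ltB_iff] at hi
        exact List.mem_range.2 hi.2
      have h5 : I.walkers.Nodup := List.nodup_range.filter _
      simpa using (h5.subperm h4).length_le
    exact hl.length_le.trans h3
  have hlen' : l.length ≤ b' (size I) :=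
    hl.length_le.trans ((length_lt_size _).le.trans (hwalk I))
  have hm : b (size I) ≤ b (stateBound I) := hbm (hB I)
  have hm' : b' (size I) ≤ b' (stateBound I) := hb'.1 (hB I)
  refine Nat.succ_le_succ (Nat.mul_le_mul ?_ ?_)
  · calc I.positions.length ^ l.length
        ≤ ((size I + 2) ^ C) ^ l.length :=
          Nat.pow_le_pow_left ((length_lt_size _).le.trans ((hpos I).trans (hC _))) _
      _ ≤ ((size I + 2) ^ C) ^ (I.k + 1) :=
          Nat.pow_le_pow_right (Nat.pow_pos (by omega)) (by omega)
      _ = stateBound I ^ C := by rw [stateBound, ← pow_mul, ← pow_mul, mul_comm]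
  · have : l.length * (b' (size I) + b (size I) + 2) ≤
        b' (stateBound I) * (b' (stateBound I) + b (stateBound I) + 3) :=
      Nat.mul_le_mul (by omega) (by omega)
    omega

/-- The dynamic program is polynomial in the size of the instance together with the list of states,
which in turn is polynomial in `stateBound`. -/
theorem FPB.answer (μ : Bool) : FPB stateBound fun I => I.answer μ := by
  have h1 : FP fun x : Instance × List (List (ℕ × Pos)) => !(x.1.reach μ x.2).isEmpty := by
    fun_prop
  exact h1.compB ((FPB.idB FPB.states.1).pair FPB.states)

end dynamicProgram

/-- A bound polynomial in `stateBound` is of the form `|I| ^ (c (k + 1))`. -/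
theorem exists_pow_bound {b : ℕ → ℕ} (hb : PolyBd b) :
    ∃ c, ∀ c' ≥ c, ∀ I : Instance, b (stateBound I) ≤ I.encode.length ^ (c' * (I.k + 1)) := by
  obtain ⟨-, C, hC⟩ := hb
  refine ⟨6 * C, fun c' hc' I => (hC _).trans ?_⟩
  have h7 : 2 ≤ I.encode.length := by
    simp [Instance.encode, encodeList]; omega
  have h1 : size I ≤ 8 * I.encode.length + 1 := by
    have h2 := size_list_le (l := I.encode.reverse) (m := 7) fun s _ => by
      have h : size s = size (s.isBit, s.val) := rfl
      rw [h, size_pair]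
      have := size_bool_le s.isBit
      have := size_bool_le s.val
      dsimp only
      omega
    rw [List.length_reverse, mul_comm] at h2
    exact h2
  set N := I.encode.length
  have h2 : size I + 2 ≤ N ^ 5 := by
    have : 16 * N ≤ N ^ 5 := by
      have : 2 ^ 4 ≤ N ^ 4 := Nat.pow_le_pow_left h7 4
      rw [pow_succ]
      exact Nat.mul_le_mul_right _ this
    omega
  have h3 : stateBound I + 2 ≤ N ^ (6 * (I.k + 1)) := by
    have h4 : stateBound I ≤ N ^ (5 * (I.k + 1)) := by
      rw [pow_mul]; exact Nat.pow_le_pow_left h2 _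
    have h5 : 2 ≤ N ^ (I.k + 1) := h7.trans (Nat.le_self_pow (by omega) _)
    have h6 : 2 ≤ N ^ (5 * (I.k + 1)) := h7.trans (Nat.le_self_pow (by omega) _)
    have h8 : N ^ (6 * (I.k + 1)) = N ^ (5 * (I.k + 1)) * N ^ (I.k + 1) := by
      rw [← pow_add]; congr 1; ring
    rw [h8]
    nlinarith
  calc (stateBound I + 2) ^ C ≤ (N ^ (6 * (I.k + 1))) ^ C := Nat.pow_le_pow_left h3 _
    _ = N ^ (6 * C * (I.k + 1)) := by rw [← pow_mul]; congr 1; ring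
    _ ≤ N ^ (c' * (I.k + 1)) := Nat.pow_le_pow_right (by omega) (Nat.mul_le_mul_right _ hc')

end TEDSC

namespace TEDSC

/-! ### Walks as lists of timed edges, and their rescheduling -/

/-- Timed edges `((u, v), t)`. -/
abbrev TEdge := ℕ × ℕ × ℕ

/-- Consecutive edges of the list are adjacent, and the first one starts in `x`. -/
def IsWalk : ℕ → List TEdge → Prop
  | _, [] => True
  | x, e :: l => e.1 = x ∧ IsWalk e.2.1 l

/-- The last vertex of a walk that starts in `x`. -/
def walkEnd (x : ℕ) (l : List TEdge) : ℕ := l.foldl (fun _ e => e.2.1) x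

/-- The time steps of the edges are strictly increasing. -/
def Increasing (l : List TEdge) : Prop := l.Pairwise fun e e' => e.2.2 < e'.2.2

theorem isWalk_append {x : ℕ} {l l' : List TEdge} :
    IsWalk x (l ++ l') ↔ IsWalk x l ∧ IsWalk (walkEnd x l) l' := by
  induction l generalizing x with
  | nil => simp [IsWalk, walkEnd]
  | cons e l ih => simp only [List.cons_append, IsWalk, ih, walkEnd, List.foldl_cons, and_assoc]

theorem walkEnd_append (x : ℕ) (l l' : List TEdge) :
    walkEnd x (l ++ l') = walkEnd (walkEnd x l) l' := List.foldl_append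

/-- A walk contains a walk with the same ends that leaves no vertex twice. -/
theorem IsWalk.exists_path {x : ℕ} {l : List TEdge} (h : IsWalk x l) :
    ∃ l', IsWalk x l' ∧ walkEnd x l' = walkEnd x l ∧ (l'.map Prod.fst).Nodup ∧ l' ⊆ l ∧
      l'.length ≤ l.length := by
  induction l generalizing x with
  | nil => exact ⟨[], trivial, rfl, by simp, by simp, le_rfl⟩
  | cons e l ih =>
    obtain ⟨rfl, h⟩ := h
    obtain ⟨l', h1, h2, h3, h4, h5⟩ := ih h
    by_cases he : e.1 ∈ l'.map Prod.fst
    · obtain ⟨c, hc, hce⟩ := List.mem_map.1 he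
      obtain ⟨a, b, rfl⟩ := List.append_of_mem hc
      refine ⟨c :: b, ⟨hce, (isWalk_append.1 h1).2.2⟩, ?_, ?_, ?_, ?_⟩
      · rw [walkEnd_append] at h2
        exact h2
      · rw [List.map_append] at h3
        exact h3.of_append_right
      · exact fun y hy => List.mem_cons_of_mem _ (h4 (List.mem_append_right _ hy))
      · simp only [List.length_append, List.length_cons] at h5 ⊢
        omega
    · refine ⟨e :: l', ⟨rfl, h1⟩, h2, ?_, ?_, ?_⟩
      · rw [List.map_cons, List.nodup_cons]
        exact ⟨he, h3⟩
      · exact List.cons_subset_cons _ h4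
      · simpa using h5

/-- Replace the time steps of a walk by `b`, `b + 1`, …. -/
def retime : ℕ → List TEdge → List TEdge
  | _, [] => []
  | b, e :: l => (e.1, e.2.1, b) :: retime (b + 1) l

theorem isWalk_retime {b x : ℕ} {l : List TEdge} (h : IsWalk x l) : IsWalk x (retime b l) := by
  induction l generalizing b x with
  | nil => trivial
  | cons e l ih => exact ⟨h.1, ih h.2⟩

theorem walkEnd_retime (b x : ℕ) (l : List TEdge) : walkEnd x (retime b l) = walkEnd x l := by
  induction l generalizing b x with
  | nil => rfl
  | cons e l ih => exact ih _ _

theorem length_retime (b : ℕ) (l : List TEdge) : (retime b l).length = l.length := by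
  induction l generalizing b with
  | nil => rfl
  | cons e l ih => simp [retime, ih]

theorem mem_retime {b : ℕ} {l : List TEdge} {e : TEdge} (h : e ∈ retime b l) :
    (∃ e' ∈ l, e'.1 = e.1 ∧ e'.2.1 = e.2.1) ∧ b ≤ e.2.2 ∧ e.2.2 < b + l.length := by
  induction l generalizing b with
  | nil => simp [retime] at h
  | cons c l ih =>
    rcases List.mem_cons.1 h with rfl | h
    · exact ⟨⟨c, by simp, rfl, rfl⟩, le_rfl, by simp⟩
    · obtain ⟨⟨e', h1, h2⟩, h3, h4⟩ := ih h
      refine ⟨⟨e', by simp [h1], h2⟩, by omega, ?_⟩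
      rw [List.length_cons]
      omega

theorem increasing_retime (b : ℕ) (l : List TEdge) : Increasing (retime b l) := by
  induction l generalizing b with
  | nil => exact List.Pairwise.nil
  | cons e l ih => exact List.Pairwise.cons (fun e' h => (mem_retime h).2.1) (ih _)

section reschedule

variable (dts : List ℕ) (n k : ℕ)

/-- The time step `t` lies between two demand times at distance at most `k n`. -/
def Short (t : ℕ) : Prop := ∃ d ∈ dts, ∃ d' ∈ dts, d ≤ t ∧ t ≤ d' ∧ d' ≤ d + k * n

/-- The time step `t` belongs to the block of `n` time steps that is reserved for walker `i` after
a demand time that is followed by more than `k n` time steps without demand. -/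
def Reserved (i t : ℕ) : Prop :=
  ∃ d ∈ dts, d + i * n < t ∧ t ≤ d + (i + 1) * n ∧ (∀ c ∈ dts, d < c → d + k * n < c) ∧
    ∃ d' ∈ dts, d < d'

variable {dts n k}

theorem Reserved.not_short {i t : ℕ} (hi : i < k) (h : Reserved dts n k i t) :
    ¬ Short dts n k t := by
  rintro ⟨c, hc, c', hc', h1, h2, h3⟩
  obtain ⟨d, hd, h4, h5, h6, -⟩ := h
  have h7 : (i + 1) * n ≤ k * n := Nat.mul_le_mul_right _ hi
  have h8 := h6 c' hc' (by omega)
  have h9 : ¬ d < c := fun h => by have := h6 c hc h; omega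
  omega

theorem Reserved.eq {i j t : ℕ} (hi : i < k) (hj : j < k) (h : Reserved dts n k i t)
    (h' : Reserved dts n k j t) : i = j := by
  obtain ⟨d, hd, h1, h2, h3, -⟩ := h
  obtain ⟨d', hd', h1', h2', h3', -⟩ := h'
  have h4 : (i + 1) * n ≤ k * n := Nat.mul_le_mul_right _ hi
  have h4' : (j + 1) * n ≤ k * n := Nat.mul_le_mul_right _ hj
  have h5 : ¬ d < d' := fun h => by have := h3 d' hd' h; omega
  have h5' : ¬ d' < d := fun h => by have := h3' d hd h; omega
  obtain rfl : d = d' := by omega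
  rcases lt_trichotomy i j with h | h | h
  · have : (i + 1) * n ≤ j * n := Nat.mul_le_mul_right _ h
    omega
  · exact h
  · have : (j + 1) * n ≤ i * n := Nat.mul_le_mul_right _ h
    omega

/-- The relation between a walk `l` of walker `i` and its rescheduled version `l'`: it uses the same
edges, at time steps that are unproblematic, keeps the moves at demand times, and does not leave the
time span of `l`. The lower bounds in `lower` are those that are needed to concatenate rescheduled
walks. -/
structure Rescheduled (dts : List ℕ) (n k i x : ℕ) (l l' : List TEdge) : Prop where
  isWalk : IsWalk x l'
  increasing : Increasing l'
  length_le : l'.length ≤ l.length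
  edge : ∀ e ∈ l', ∃ e' ∈ l, e'.1 = e.1 ∧ e'.2.1 = e.2.1
  time : ∀ e ∈ l', e ∈ l ∧ Short dts n k e.2.2 ∨ Reserved dts n k i e.2.2
  demand : ∀ e ∈ l, e.2.2 ∈ dts → e ∈ l'
  lower : ∀ b, (b ∈ dts ∨ ∃ d ∈ dts, b = d + 1) → (∀ e ∈ l, b ≤ e.2.2) → ∀ e ∈ l', b ≤ e.2.2
  upper : ∀ e ∈ l', ∃ e' ∈ l, e.2.2 ≤ e'.2.2

theorem exists_max_le (dts : List ℕ) {d t : ℕ} (hd : d ∈ dts) (h : d ≤ t) :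
    ∃ m ∈ dts, m ≤ t ∧ ∀ c ∈ dts, c ≤ t → c ≤ m := by
  obtain ⟨m, hm, hmax⟩ := (dts.toFinset.filter (· ≤ t)).exists_max_image id ⟨d, by simp [hd, h]⟩
  simp only [Finset.mem_filter, List.mem_toFinset, id] at hm hmax
  exact ⟨m, hm.1, hm.2, fun c hc hct => hmax c ⟨hc, hct⟩⟩

theorem exists_min_ge (dts : List ℕ) {d t : ℕ} (hd : d ∈ dts) (h : t ≤ d) :
    ∃ m ∈ dts, t ≤ m ∧ ∀ c ∈ dts, t ≤ c → m ≤ c := by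
  obtain ⟨m, hm, hmin⟩ := (dts.toFinset.filter (t ≤ ·)).exists_min_image id ⟨d, by simp [hd, h]⟩
  simp only [Finset.mem_filter, List.mem_toFinset, id] at hm hmin
  exact ⟨m, hm.1, hm.2, fun c hc hct => hmin c ⟨hc, hct⟩⟩

/-- Rescheduling of a walk all of whose edges come after some demand time. The moves between two
consecutive demand times are kept if the demand times are close to each other. Otherwise, they are
replaced by a path, traversed in the time steps that are reserved for the walker. The moves after
the last demand time of the walk are dropped. -/
theorem exists_rescheduled {i : ℕ} (hi : i < k) (l : List TEdge) (x : ℕ)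
    (hw : IsWalk x l) (hinc : Increasing l) (hn : ∀ e ∈ l, e.1 < n)
    (hlow : ∃ d ∈ dts, ∀ e ∈ l, d ≤ e.2.2) : ∃ l', Rescheduled dts n k i x l l' := by
  induction hlen : l.length using Nat.strong_induction_on generalizing l x with
  | _ m ih =>
  subst hlen
  by_cases hdem : ∃ e ∈ l, e.2.2 ∈ dts
  swap
  · push Not at hdem
    exact ⟨[], trivial, List.Pairwise.nil, by simp, by simp, by simp,
      fun e he h => absurd h (hdem e he), by simp, by simp⟩
  obtain ⟨d₀, hd₀, hlow⟩ := hlow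
  rcases l with _ | ⟨e, l⟩
  · simp at hdem
  obtain ⟨rfl, hw'⟩ := hw
  obtain ⟨hinc1, hinc2⟩ := List.pairwise_cons.1 hinc
  by_cases he : e.2.2 ∈ dts
  · -- a move at a demand time is kept
    obtain ⟨l', H⟩ := ih l.length (by simp) l _ hw' hinc2
      (fun c hc => hn c (List.mem_cons_of_mem _ hc)) ⟨e.2.2, he, fun c hc => (hinc1 c hc).le⟩ rfl
    refine ⟨e :: l', ⟨rfl, H.isWalk⟩, List.pairwise_cons.2 ⟨fun c hc => ?_, H.increasing⟩,
      by simpa using H.length_le, ?_, ?_, ?_, ?_, ?_⟩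
    · exact H.lower (e.2.2 + 1) (.inr ⟨_, he, rfl⟩) (fun c hc => hinc1 c hc) c hc
    · intro c hc
      rcases List.mem_cons.1 hc with rfl | hc
      · exact ⟨c, by simp, rfl, rfl⟩
      · obtain ⟨c', h1, h2⟩ := H.edge c hc
        exact ⟨c', List.mem_cons_of_mem _ h1, h2⟩
    · intro c hc
      rcases List.mem_cons.1 hc with rfl | hc
      · exact .inl ⟨by simp, _, he, _, he, le_rfl, le_rfl, by omega⟩
      · exact (H.time c hc).imp_left fun h => ⟨List.mem_cons_of_mem _ h.1, h.2⟩
    · intro c hc hcd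
      rcases List.mem_cons.1 hc with rfl | hc
      · simp
      · exact List.mem_cons_of_mem _ (H.demand c hc hcd)
    · intro b hb hbl c hc
      rcases List.mem_cons.1 hc with rfl | hc
      · exact hbl _ (by simp)
      · exact H.lower b hb (fun c hc => hbl c (List.mem_cons_of_mem _ hc)) c hc
    · intro c hc
      rcases List.mem_cons.1 hc with rfl | hc
      · exact ⟨c, by simp, le_rfl⟩
      · obtain ⟨c', h1, h2⟩ := H.upper c hc
        exact ⟨c', List.mem_cons_of_mem _ h1, h2⟩
  -- the demand times `d` and `d'` before and after the first move
  obtain ⟨d, hd, hde, hdmax⟩ := exists_max_le dts hd₀ (hlow e (by simp))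
  obtain ⟨f, hf, hfd⟩ := hdem
  have hef : e.2.2 ≤ f.2.2 := by
    rcases List.mem_cons.1 hf with rfl | hf
    · exact le_rfl
    · exact (hinc1 f hf).le
  obtain ⟨d', hd', hed', hdmin⟩ := exists_min_ge dts hfd hef
  have hne : ∀ c ∈ dts, c ≠ e.2.2 := fun c hc h => he (h ▸ hc)
  have hde' : d < e.2.2 := lt_of_le_of_ne hde (hne d hd)
  have hed'' : e.2.2 < d' := lt_of_le_of_ne hed' (hne d' hd').symm
  have hgap : ∀ c ∈ dts, ¬ (d < c ∧ c < d') := by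
    rintro c hc ⟨h1, h2⟩
    rcases le_total c e.2.2 with h | h
    · have := hdmax c hc h; omega
    · have := hdmin c hc h; omega
  -- the moves between `d` and `d'`, and those from `d'` on
  set L := e :: l with hL
  have hsplit : ∀ L : List TEdge, Increasing L → ∃ A C, L = A ++ C ∧ (∀ c ∈ A, c.2.2 < d') ∧
      ∀ c ∈ C, d' ≤ c.2.2 := by
    intro L
    induction L with
    | nil => exact fun _ => ⟨[], [], rfl, by simp, by simp⟩
    | cons a L ihL =>
      intro h
      by_cases ha : a.2.2 < d'
      · obtain ⟨A, C, h1, h2, h3⟩ := ihL (List.pairwise_cons.1 h).2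
        refine ⟨a :: A, C, by rw [h1]; rfl, ?_, h3⟩
        intro c hc
        rcases List.mem_cons.1 hc with rfl | hc
        · exact ha
        · exact h2 c hc
      · refine ⟨[], a :: L, rfl, by simp, ?_⟩
        intro c hc
        rcases List.mem_cons.1 hc with rfl | hc
        · omega
        · have := (List.pairwise_cons.1 h).1 c hc
          omega
  obtain ⟨A, C, hAC, hA, hC⟩ := hsplit L hinc
  have hwL : IsWalk e.1 L := ⟨rfl, hw'⟩
  have hAe : ∀ c ∈ A, e.2.2 ≤ c.2.2 := by
    intro c hc
    have : c ∈ L := by rw [hAC]; exact List.mem_append_left _ hc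
    rcases List.mem_cons.1 this with rfl | h
    · exact le_rfl
    · exact (hinc1 c h).le
  have heA : e ∈ A := by
    have : e ∈ A ++ C := by rw [← hAC, hL]; simp
    rcases List.mem_append.1 this with h | h
    · exact h
    · have := hC e h; omega
  have hfC : f ∈ C := by
    rw [hAC] at hf
    rcases List.mem_append.1 hf with h | h
    · have h1 := hA f h
      have h2 := hdmin _ hfd hef
      omega
    · exact h
  rw [hAC] at hwL hinc
  obtain ⟨hwA, hwC⟩ := isWalk_append.1 hwL
  obtain ⟨hincA, hincC, hincAC⟩ := List.pairwise_append.1 hinc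
  have hlenC : C.length < L.length := by
    have := List.length_pos_of_mem heA
    rw [hAC, List.length_append]; omega
  have hLA : ∀ c ∈ A, c ∈ L := fun c hc => by rw [hAC]; exact List.mem_append_left _ hc
  have hLC : ∀ c ∈ C, c ∈ L := fun c hc => by rw [hAC]; exact List.mem_append_right _ hc
  obtain ⟨C', H⟩ := ih C.length hlenC C _ hwC hincC (fun c hc => hn c (hLC c hc))
    ⟨d', hd', hC⟩ rfl
  have hC' : ∀ c ∈ C', d' ≤ c.2.2 := H.lower d' (.inl hd') hC
  -- it remains to replace `A` by a suitable list `A'`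
  suffices hA' : ∃ A', IsWalk e.1 A' ∧ walkEnd e.1 A' = walkEnd e.1 A ∧ Increasing A' ∧
      A'.length ≤ A.length ∧ (∀ c ∈ A', ∃ c' ∈ A, c'.1 = c.1 ∧ c'.2.1 = c.2.1) ∧
      (∀ c ∈ A', c ∈ A ∧ Short dts n k c.2.2 ∨ Reserved dts n k i c.2.2) ∧
      ∀ c ∈ A', d < c.2.2 ∧ c.2.2 < d' by
    obtain ⟨A', h1, h2, h3, h4, h5, h6, h7⟩ := hA'
    refine ⟨A' ++ C', isWalk_append.2 ⟨h1, h2 ▸ H.isWalk⟩,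
      List.pairwise_append.2 ⟨h3, H.increasing, fun a ha c hc => ?_⟩, ?_, ?_, ?_, ?_, ?_, ?_⟩
    · exact (h7 a ha).2.trans_le (hC' c hc)
    · have := H.length_le
      rw [hAC, List.length_append, List.length_append]
      omega
    · intro c hc
      rcases List.mem_append.1 hc with hc | hc
      · obtain ⟨c', h8, h9⟩ := h5 c hc
        exact ⟨c', hLA c' h8, h9⟩
      · obtain ⟨c', h8, h9⟩ := H.edge c hc
        exact ⟨c', hLC c' h8, h9⟩
    · intro c hc
      rcases List.mem_append.1 hc with hc | hc
      · exact (h6 c hc).imp_left fun h => ⟨hLA c h.1, h.2⟩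
      · exact (H.time c hc).imp_left fun h => ⟨hLC c h.1, h.2⟩
    · intro c hc hcd
      rw [hAC] at hc
      rcases List.mem_append.1 hc with hc | hc
      · exact absurd ⟨hde'.trans_le (hAe c hc), hA c hc⟩ (hgap _ hcd)
      · exact List.mem_append_right _ (H.demand c hc hcd)
    · intro b hb hbl c hc
      rcases List.mem_append.1 hc with hc | hc
      · have h8 := (h7 c hc).1
        have h9 := hbl e (by simp [hL])
        rcases hb with hb | ⟨b, hb, rfl⟩
        · have := hdmax b hb h9; omega
        · have := hdmax b hb (by omega); omega
      · exact H.lower b hb (fun c hc => hbl c (hLC c hc)) c hc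
    · intro c hc
      rcases List.mem_append.1 hc with hc | hc
      · exact ⟨f, hLC f hfC, (h7 c hc).2.le.trans (hC f hfC)⟩
      · obtain ⟨c', h8, h9⟩ := H.upper c hc
        exact ⟨c', hLC c' h8, h9⟩
  by_cases hshort : d' ≤ d + k * n
  · exact ⟨A, hwA, rfl, hincA, le_rfl, fun c hc => ⟨c, hc, rfl, rfl⟩, fun c hc =>
      .inl ⟨hc, d, hd, d', hd', hde.trans (hAe c hc), (hA c hc).le, hshort⟩, fun c hc =>
      ⟨hde'.trans_le (hAe c hc), hA c hc⟩⟩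
  · obtain ⟨B, hB1, hB2, hB3, hB4, hB5⟩ := hwA.exists_path
    have hBn : B.length ≤ n := by
      have h1 : B.map Prod.fst ⊆ List.range n := by
        intro u hu
        obtain ⟨c, hc, rfl⟩ := List.mem_map.1 hu
        exact List.mem_range.2 (hn c (hLA c (hB4 hc)))
      simpa using (hB3.subperm h1).length_le
    have hres : ∀ c ∈ retime (d + i * n + 1) B, Reserved dts n k i c.2.2 := by
      intro c hc
      obtain ⟨-, h1, h2⟩ := mem_retime hc
      refine ⟨d, hd, by omega, ?_, fun c hc hdc => ?_, d', hd', by omega⟩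
      · rw [add_mul]; omega
      · have := hgap c hc
        omega
    refine ⟨retime (d + i * n + 1) B, isWalk_retime hB1, (walkEnd_retime _ _ _).trans hB2,
      increasing_retime _ _, (length_retime _ _).trans_le hB5, fun c hc => ?_,
      fun c hc => .inr (hres c hc), fun c hc => ?_⟩
    · obtain ⟨⟨c', h1, h2⟩, -⟩ := mem_retime hc
      exact ⟨c', hB4 h1, h2⟩
    · obtain ⟨-, h1, h2⟩ := mem_retime hc
      have h3 : (i + 1) * n ≤ k * n := Nat.mul_le_mul_right _ hi
      rw [add_mul] at h3
      exact ⟨by omega, by omega⟩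

end reschedule

end TEDSC

namespace TEDSC

/-! ### Schedules as families of lists of timed edges -/

/-- The constraint on a single walk: a bound for its length (`μ = true`), or for its lifespan
(`μ = false`), where the last move ends one time step after it starts. -/
def Bounded (μ : Bool) (h : ℕ) (l : List TEdge) : Prop :=
  if μ then l.length ≤ h else ∃ s, ∀ e ∈ l, s ≤ e.2.2 ∧ e.2.2 < s + h

/-- A solution of the instance `I`, given by the lists of timed edges of the walkers, which move
only at time steps `t` such that `T t`. -/
structure IsPlan (I : Instance) (T : ℕ → Prop) (μ : Bool) (P : ℕ → List TEdge) : Prop where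
  isWalk : ∀ i ∈ I.walkers, ∃ x < I.n, IsWalk x (P i)
  increasing : ∀ i ∈ I.walkers, Increasing (P i)
  edge : ∀ i ∈ I.walkers, ∀ e ∈ P i, (e.1, e.2.1) ∈ I.edgeList ∧ T e.2.2
  bounded : ∀ i ∈ I.walkers, Bounded μ I.h (P i)
  disjoint : ∀ i ∈ I.walkers, ∀ j ∈ I.walkers, ∀ e ∈ P i, e ∈ P j → i = j
  demand : ∀ d ∈ I.demandList, ∃ i ∈ I.walkers, d ∈ P i

variable {I : Instance}

theorem mem_edgeList {u v : ℕ} :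
    (u, v) ∈ I.edgeList ↔ ∃ a b : Fin I.n, I.graph.Adj a b ∧ a.1 = u ∧ b.1 = v := by
  simp [Instance.edgeList, Instance.graph]

theorem mem_demandList {u v t : ℕ} :
    (u, v, t) ∈ I.demandList ↔ ∃ a b : Fin I.n, (a, b, t) ∈ I.demands ∧ a.1 = u ∧ b.1 = v := by
  simp [Instance.demandList]

theorem mem_walkers {i : ℕ} : i ∈ I.walkers ↔ i < I.demands.length ∧ i < I.k := by
  simp [Instance.walkers, Instance.demandList]

theorem nodup_walkers : I.walkers.Nodup := List.nodup_range.filter _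

/-- The walkers are numbered consecutively from `0` on. -/
theorem lt_length_walkers {i : ℕ} (hi : i ∈ I.walkers) : i < I.walkers.length := by
  have h : List.range (i + 1) ⊆ I.walkers := fun j hj => by
    rw [mem_walkers] at hi ⊢
    have := List.mem_range.1 hj
    omega
  simpa using (List.nodup_range.subperm h).length_le

theorem length_walkers_le : I.walkers.length ≤ I.k := by
  have h : I.walkers ⊆ List.range I.k := fun i hi => List.mem_range.2 (mem_walkers.1 hi).2
  simpa using (nodup_walkers.subperm h).length_le

theorem mem_demandTimes {t : ℕ} : t ∈ I.demandTimes ↔ ∃ d ∈ I.demands, d.2.2 = t := by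
  simp [Instance.demandTimes, Instance.demandList]

theorem one_le_of_mem_demandTimes {t : ℕ} (h : t ∈ I.demandTimes) : 1 ≤ t := by
  obtain ⟨d, hd, rfl⟩ := mem_demandTimes.1 h
  exact I.demand_time d hd

theorem le_lifetime {t : ℕ} (ht : 1 ≤ t) :
    t ≤ lifetime I.draft ↔ ∃ d ∈ I.demandTimes, t ≤ d := by
  rw [lifetime, Finset.le_sup_iff (by exact ht)]
  simp only [Instance.draft, List.mem_toFinset, mem_demandTimes]
  constructor
  · rintro ⟨d, hd, h⟩
    exact ⟨_, ⟨d, hd, rfl⟩, h⟩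
  · rintro ⟨_, ⟨d, hd, rfl⟩, h⟩
    exact ⟨d, hd, h⟩

theorem mem_times {t : ℕ} : t ∈ I.times ↔
    (∃ d ∈ I.demandTimes, d ≤ t ∧ t ≤ d + I.walkers.length * I.n) ∧ ∃ d ∈ I.demandTimes, t ≤ d := by
  have h : I.delays = List.range (I.walkers.length * I.n + 1) := by
    simp [Instance.delays, List.length_flatMap]
  rw [Instance.times, mem_sort]
  simp only [h, List.mem_flatMap, List.mem_filter, List.mem_map, List.mem_range, List.any_eq_true,
    Bool.not_eq_true', ← Bool.not_eq_true, ltB_iff, not_lt]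
  constructor
  · rintro ⟨d, hd, ⟨j, hj, rfl⟩, h⟩
    exact ⟨⟨d, hd, by omega, by omega⟩, h⟩
  · rintro ⟨⟨d, hd, h1, h2⟩, h⟩
    exact ⟨d, hd, ⟨t - d, by omega, by omega⟩, h⟩

theorem lt_of_mem_edgeList {u v : ℕ} (h : (u, v) ∈ I.edgeList) : u < I.n ∧ v < I.n := by
  obtain ⟨a, b, -, rfl, rfl⟩ := mem_edgeList.1 h
  exact ⟨a.2, b.2⟩

/-- Whether the edges of the temporal graph are available at time `t`. -/
def Avail (I : Instance) (t : ℕ) : Prop := 1 ≤ t ∧ ∃ d ∈ I.demandTimes, t ≤ d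

theorem avail_of_mem_times {t : ℕ} (h : t ∈ I.times) : Avail I t := by
  obtain ⟨⟨d, hd, h1, -⟩, h⟩ := mem_times.1 h
  exact ⟨(one_le_of_mem_demandTimes hd).trans h1, h⟩

theorem IsPlan.of_times {μ : Bool} {P : ℕ → List TEdge} (h : IsPlan I (· ∈ I.times) μ P) :
    IsPlan I (Avail I) μ P :=
  { h with edge := fun i hi e he =>
      ⟨(h.edge i hi e he).1, avail_of_mem_times (h.edge i hi e he).2⟩ }

/-- Every solution can be rescheduled such that the walkers move at few time steps. -/
theorem IsPlan.exists_times {μ : Bool} {P : ℕ → List TEdge} (h : IsPlan I (Avail I) μ P) :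
    ∃ P', IsPlan I (· ∈ I.times) μ P' := by
  -- the walk of a single walker, started at its first edge at a demand time
  have key : ∀ i ∈ I.walkers, ∃ x < I.n, ∃ l', Rescheduled I.demandTimes I.n I.walkers.length i x
      ((P i).dropWhile fun e => decide (e.2.2 ∉ I.demandTimes)) l' ∧
      (∀ e ∈ P i, e.2.2 ∈ I.demandTimes → e ∈ l') ∧
      ∀ e ∈ l', ∃ e' ∈ P i, e'.2.2 ≤ e.2.2 := by
    intro i hi
    obtain ⟨x, hx, hw⟩ := h.isWalk i hi
    have hinc := h.increasing i hi
    have hedge := h.edge i hi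
    set p : TEdge → Bool := fun e => decide (e.2.2 ∉ I.demandTimes)
    have happ := List.takeWhile_append_dropWhile (p := p) (l := P i)
    have htake : ∀ e ∈ (P i).takeWhile p, e.2.2 ∉ I.demandTimes := fun e he => by
      simpa [p] using List.mem_takeWhile_imp he
    have hsub : ∀ e ∈ (P i).dropWhile p, e ∈ P i := fun e he =>
      (List.dropWhile_sublist p).subset he
    have hdem : ∀ e ∈ P i, e.2.2 ∈ I.demandTimes → e ∈ (P i).dropWhile p := by
      intro e he hd
      rw [← happ] at he
      rcases List.mem_append.1 he with h | h
      · exact absurd hd (htake e h)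
      · exact h
    rw [← happ] at hw hinc
    have hw' := (isWalk_append.1 hw).2
    have hinc' := (List.pairwise_append.1 hinc).2.1
    rcases e : (P i).dropWhile p with _ | ⟨c, l⟩
    · refine ⟨x, hx, [], ⟨trivial, List.Pairwise.nil, by simp, by simp, by simp, by simp, by simp,
        by simp⟩, ?_, by simp⟩
      rw [e] at hdem
      exact hdem
    · have hc : c.2.2 ∈ I.demandTimes := by
        have := List.head?_dropWhile_not p (P i)
        rw [e] at this
        simpa [p] using this
      rw [e] at hw' hinc' hdem hsub
      have hcl : ∀ e ∈ c :: l, c.2.2 ≤ e.2.2 := by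
        intro e he
        rcases List.mem_cons.1 he with rfl | he
        · exact le_rfl
        · exact ((List.pairwise_cons.1 hinc').1 e he).le
      obtain ⟨l', H⟩ := exists_rescheduled (n := I.n) (lt_length_walkers hi) (c :: l) c.1
        ⟨rfl, hw'.2⟩ hinc' (fun e he => (lt_of_mem_edgeList (hedge e (hsub e he)).1).1)
        ⟨_, hc, hcl⟩
      exact ⟨c.1, (lt_of_mem_edgeList (hedge c (hsub c (by simp))).1).1, l', H,
        fun e he hd => H.demand e (hdem e he hd) hd,
        fun e he => ⟨c, hsub c (by simp), H.lower _ (.inl hc) hcl e he⟩⟩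
  choose! x hx P' hP' hdem hlow using key
  have hsub : ∀ i, ∀ e ∈ (P i).dropWhile fun e => decide (e.2.2 ∉ I.demandTimes), e ∈ P i :=
    fun i e he => (List.dropWhile_sublist _).subset he
  refine ⟨P', ⟨fun i hi => ⟨x i, hx i hi, (hP' i hi).isWalk⟩, fun i hi => (hP' i hi).increasing,
    fun i hi e he => ⟨?_, ?_⟩, fun i hi => ?_, fun i hi j hj e he he' => ?_, fun d hd => ?_⟩⟩
  · obtain ⟨e', h1, h2, h3⟩ := (hP' i hi).edge e he
    rw [← h2, ← h3]
    exact (h.edge i hi e' (hsub i e' h1)).1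
  · rw [mem_times]
    rcases (hP' i hi).time e he with ⟨-, d, hd, d', hd', h1, h2, h3⟩ |
      ⟨d, hd, h1, h2, h3, d', hd', h4⟩
    · exact ⟨⟨d, hd, h1, h2.trans h3⟩, d', hd', h2⟩
    · have h5 : (i + 1) * I.n ≤ I.walkers.length * I.n :=
        Nat.mul_le_mul_right _ (lt_length_walkers hi)
      have h6 := h3 d' hd' h4
      exact ⟨⟨d, hd, by omega, by omega⟩, d', hd', by omega⟩
  · have h1 := h.bounded i hi
    unfold Bounded at h1 ⊢
    split_ifs at h1 ⊢ with hμ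
    · exact (hP' i hi).length_le.trans ((List.dropWhile_sublist _).length_le.trans h1)
    · obtain ⟨s, hs⟩ := h1
      refine ⟨s, fun e he => ?_⟩
      obtain ⟨e₁, h2, h3⟩ := hlow i hi e he
      obtain ⟨e₂, h4, h5⟩ := (hP' i hi).upper e he
      exact ⟨(hs e₁ h2).1.trans h3, h5.trans_lt (hs e₂ (hsub i e₂ h4)).2⟩
  · have hik := lt_length_walkers hi
    have hjk := lt_length_walkers hj
    rcases (hP' i hi).time e he with ⟨h1, h2⟩ | h1 <;>
      rcases (hP' j hj).time e he' with ⟨h1', h2'⟩ | h1'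
    · exact h.disjoint i hi j hj e (hsub i e h1) (hsub j e h1')
    · exact absurd h2 (h1'.not_short hjk)
    · exact absurd h2' (h1.not_short hik)
    · exact h1.eq hik hjk h1'
  · obtain ⟨i, hi, hdi⟩ := h.demand d hd
    refine ⟨i, hi, hdem i hi d hdi ?_⟩
    exact List.mem_map.2 ⟨d, hd, rfl⟩

/-! ### Temporal walks as lists of timed edges -/

/-- The timed edges of a temporal walk. -/
def edgesOf (p : TemporalWalk (temporalGraph I.graph I.draft)) : List TEdge :=
  List.ofFn fun i : Fin p.length =>
    ((p.vert i.castSucc : ℕ), (p.vert i.succ : ℕ), p.time i.castSucc)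

theorem mem_edgesOf {p : TemporalWalk (temporalGraph I.graph I.draft)} {u v t : ℕ} :
    (u, v, t) ∈ edgesOf p ↔ ∃ a b : Fin I.n, ((a, b), t) ∈ p.timeEdges ∧ a.1 = u ∧ b.1 = v := by
  simp only [edgesOf, List.mem_ofFn, TemporalWalk.timeEdges, Set.mem_range, Prod.mk.injEq]
  constructor
  · rintro ⟨i, h1, h2, h3⟩
    exact ⟨_, _, ⟨i, ⟨rfl, rfl⟩, h3⟩, h1, h2⟩
  · rintro ⟨a, b, ⟨i, ⟨rfl, rfl⟩, h3⟩, h1, h2⟩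
    exact ⟨i, h1, h2, h3⟩

theorem isWalk_ofFn (m : ℕ) (v : Fin (m + 1) → ℕ) (t : Fin m → ℕ) :
    IsWalk (v 0) (List.ofFn fun i : Fin m => (v i.castSucc, v i.succ, t i)) := by
  induction m with
  | zero => trivial
  | succ m ih =>
    rw [List.ofFn_succ]
    exact ⟨rfl, ih (fun i => v i.succ) fun i => t i.succ⟩

theorem avail_iff {t : ℕ} : Avail I t ↔ t ∈ Set.Icc 1 (lifetime I.draft) := by
  rw [Set.mem_Icc, Avail]
  exact and_congr_right fun h => (le_lifetime h).symm

/-- A list of timed edges whose time steps are in the range from `b` to `c - 1` is the list of the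
timed edges of a temporal walk with time steps from `b` to `c`. -/
theorem exists_temporalWalk {x b c : ℕ} (l : List TEdge) (hx : x < I.n) (hw : IsWalk x l)
    (hinc : Increasing l) (hedge : ∀ e ∈ l, (e.1, e.2.1) ∈ I.edgeList ∧ Avail I e.2.2)
    (hb : ∀ e ∈ l, b ≤ e.2.2 ∧ e.2.2 < c) (hbc : b ≤ c) :
    ∃ p : TemporalWalk (temporalGraph I.graph I.draft), p.length = l.length ∧
      (p.vert 0 : ℕ) = x ∧ b ≤ p.time 0 ∧ p.time (Fin.last p.length) ≤ c ∧
      ∀ (u v : Fin I.n) t, ((u, v), t) ∈ p.timeEdges ↔ ((u : ℕ), (v : ℕ), t) ∈ l := by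
  induction l generalizing x b with
  | nil =>
    refine ⟨⟨0, fun _ => ⟨x, hx⟩, fun _ => b, fun i j hij => absurd hij (by omega),
      fun i => i.elim0⟩,
      rfl, rfl, le_rfl, hbc, fun u v t => ?_⟩
    simp [TemporalWalk.timeEdges]
  | cons e l ih =>
    obtain ⟨rfl, hw⟩ := hw
    obtain ⟨h1, h2⟩ := List.pairwise_cons.1 hinc
    obtain ⟨he1, he2⟩ := hedge e (by simp)
    obtain ⟨hb1, hb2⟩ := hb e (by simp)
    obtain ⟨p, hp1, hp2, hp3, hp4, hp5⟩ := ih (b := e.2.2 + 1) (lt_of_mem_edgeList he1).2 hw h2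
      (fun c hc => hedge c (by simp [hc])) (fun c hc => ⟨h1 c hc, (hb c (by simp [hc])).2⟩)
      (by omega)
    have hmono : StrictMono (Fin.cons e.2.2 p.time : Fin (p.length + 2) → ℕ) := by
      intro i j hij
      induction j using Fin.cases with
      | zero => exact absurd hij (Fin.not_lt_zero i)
      | succ j =>
        induction i using Fin.cases with
        | zero =>
          have := p.time_strictMono.monotone (Fin.zero_le j)
          simp only [Fin.cons_zero, Fin.cons_succ]
          omega
        | succ i =>
          simp only [Fin.cons_succ]
          exact p.time_strictMono (Fin.succ_lt_succ_iff.1 hij)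
    have hadj : ∀ i : Fin (p.length + 1), (temporalGraph I.graph I.draft).TimeEdge
        ((Fin.cons ⟨e.1, hx⟩ p.vert : Fin (p.length + 2) → Fin I.n) i.castSucc)
        ((Fin.cons ⟨e.1, hx⟩ p.vert : Fin (p.length + 2) → Fin I.n) i.succ)
        ((Fin.cons e.2.2 p.time : Fin (p.length + 2) → ℕ) i.castSucc) := by
      intro i
      induction i using Fin.cases with
      | zero =>
        obtain ⟨u, v, h3, h4, h5⟩ := mem_edgeList.1 he1
        have e1 : (⟨e.1, hx⟩ : Fin I.n) = u := Fin.ext h4.symm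
        have e2 : p.vert 0 = v := Fin.ext (hp2.trans h5.symm)
        refine ⟨?_, avail_iff.1 he2⟩
        change I.graph.Adj ⟨e.1, hx⟩ (p.vert 0)
        rw [e1, e2]
        exact h3
      | succ i => exact p.timeEdge i
    refine ⟨⟨p.length + 1, Fin.cons ⟨e.1, hx⟩ p.vert, Fin.cons e.2.2 p.time, hmono, hadj⟩,
      by simp [hp1], rfl, hb1, ?_, ?_⟩
    · exact hp4
    · intro u v t
      rw [List.mem_cons, ← hp5]
      simp only [TemporalWalk.timeEdges, Set.mem_range, Fin.exists_fin_succ, Prod.ext_iff,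
        Fin.ext_iff]
      refine or_congr ?_ Iff.rfl
      change (e.1 = u.1 ∧ (p.vert 0).1 = v.1) ∧ e.2.2 = t ↔ _
      rw [hp2]
      constructor
      · rintro ⟨⟨h3, h4⟩, h5⟩; exact ⟨h3.symm, h4.symm, h5.symm⟩
      · rintro ⟨h3, h4, h5⟩; exact ⟨⟨h3.symm, h4.symm⟩, h5.symm⟩

/-- The constraint of the problem selected by `μ`, for a temporal walk. -/
def WalkOK (μ : Bool) (h : ℕ) (p : TemporalWalk (temporalGraph I.graph I.draft)) : Prop :=
  if μ then p.length ≤ h else p.lifespan ≤ h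

/-- Plans are the same as sets of at most `k` walks that solve the problem. A set of walks may be
thinned out to at most as many walks as there are demands, one of which is chosen for each of
them. -/
theorem exists_isPlan_iff (μ : Bool) : (∃ P, IsPlan I (Avail I) μ P) ↔
    ∃ S : Finset (TemporalWalk (temporalGraph I.graph I.draft)),
      IsSchedule S ∧ Extends S ∧ S.card ≤ I.k ∧ ∀ p ∈ S, WalkOK μ I.h p := by
  classical
  constructor
  · rintro ⟨P, hP⟩
    have key : ∀ i ∈ I.walkers, ∃ p : TemporalWalk (temporalGraph I.graph I.draft),
        WalkOK μ I.h p ∧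
        ∀ (u v : Fin I.n) t, ((u, v), t) ∈ p.timeEdges ↔ ((u : ℕ), (v : ℕ), t) ∈ P i := by
      intro i hi
      obtain ⟨x, hx, hw⟩ := hP.isWalk i hi
      have hb := hP.bounded i hi
      unfold Bounded at hb
      unfold WalkOK
      split_ifs at hb ⊢ with hμ
      · obtain ⟨p, h1, -, -, -, h2⟩ := exists_temporalWalk (b := 0) (c := lifetime I.draft + 1)
          (P i) hx hw (hP.increasing i hi) (hP.edge i hi)
          (fun e he => ⟨Nat.zero_le _,
            Nat.lt_succ_of_le (avail_iff.1 (hP.edge i hi e he).2).2⟩) (Nat.zero_le _)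
        exact ⟨p, h1.trans_le hb, h2⟩
      · obtain ⟨s, hs⟩ := hb
        obtain ⟨p, -, -, h1, h2, h3⟩ := exists_temporalWalk (b := s) (c := s + I.h)
          (P i) hx hw (hP.increasing i hi) (hP.edge i hi) hs (Nat.le_add_right _ _)
        refine ⟨p, ?_, h3⟩
        unfold TemporalWalk.lifespan
        omega
    choose p hp hpe using key
    refine ⟨I.walkers.toFinset.attach.image fun i => p i.1 (List.mem_toFinset.1 i.2),
      ?_, ?_, ?_, ?_⟩
    · intro a ha b hb hab
      obtain ⟨⟨i, hi⟩, -, rfl⟩ := Finset.mem_image.1 (Finset.mem_coe.1 ha)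
      obtain ⟨⟨j, hj⟩, -, rfl⟩ := Finset.mem_image.1 (Finset.mem_coe.1 hb)
      rw [List.mem_toFinset] at hi hj
      refine Set.disjoint_left.2 fun e he he' => ?_
      obtain ⟨⟨u, v⟩, t⟩ := e
      rw [hpe i hi] at he
      rw [hpe j hj] at he'
      obtain rfl := hP.disjoint i hi j hj _ he he'
      exact hab rfl
    · intro u v t h
      obtain ⟨i, hi, hd⟩ := hP.demand (u, v, t)
        (mem_demandList.2 ⟨u, v, by simpa [Instance.draft] using h, rfl, rfl⟩)
      exact ⟨p i hi, Finset.mem_image.2 ⟨⟨i, List.mem_toFinset.2 hi⟩, Finset.mem_attach _ _, rfl⟩,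
        (hpe i hi u v t).2 hd⟩
    · exact Finset.card_image_le.trans (Finset.card_attach.trans_le <|
        (List.toFinset_card_le _).trans length_walkers_le)
    · intro q hq
      obtain ⟨⟨i, hi⟩, -, rfl⟩ := Finset.mem_image.1 hq
      exact hp i (List.mem_toFinset.1 hi)
  · rintro ⟨S, hS1, hS2, hS3, hS4⟩
    -- for every demand, choose a walk that meets it
    have hcov : ∀ d : {d // d ∈ I.demands}, ∃ p ∈ S, ((d.1.1, d.1.2.1), d.1.2.2) ∈ p.timeEdges :=
      fun d => hS2 _ _ _ (by simpa [Instance.draft] using d.2)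
    choose q hqS hq using hcov
    set S' : Finset (TemporalWalk (temporalGraph I.graph I.draft)) :=
      (I.demands.attach.map q).toFinset with hS'
    have hsub : S' ⊆ S := fun p hp => by
      simp only [hS', List.mem_toFinset, List.mem_map] at hp
      obtain ⟨d, -, rfl⟩ := hp
      exact hqS d
    have hcard : S'.card ≤ I.demands.length := by
      refine (List.toFinset_card_le _).trans ?_
      simp
    set ws := S'.toList with hws
    have hlen : ws.length ≤ I.demands.length ∧ ws.length ≤ I.k := by
      rw [hws, Finset.length_toList]
      exact ⟨hcard, (Finset.card_le_card hsub).trans hS3⟩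
    have hwsS : ∀ p ∈ ws, p ∈ S := fun p hp => hsub (Finset.mem_toList.1 hp)
    have hnd : ws.Nodup := S'.nodup_toList
    -- the walkers without a walk stay at an arbitrary vertex
    set P : ℕ → List TEdge := fun i => if h : i < ws.length then edgesOf ws[i] else [] with hP
    have hPi : ∀ {i} (h : i < ws.length), P i = edgesOf ws[i] := fun h => by simp [hP, h]
    have hPn : ∀ {i}, ¬ i < ws.length → P i = [] := fun h => by simp [hP, h]
    have hPe : ∀ {i e}, e ∈ P i → ∃ h : i < ws.length, e ∈ edgesOf ws[i] := by
      intro i e he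
      by_cases h : i < ws.length
      · exact ⟨h, hPi h ▸ he⟩
      · rw [hPn h] at he
        simp at he
    refine ⟨P, ⟨fun i hi => ?_, fun i hi => ?_, fun i hi e he => ?_, fun i hi => ?_,
      fun i hi j hj e he he' => ?_, fun d hd => ?_⟩⟩
    · by_cases h : i < ws.length
      · rw [hPi h]
        exact ⟨_, (ws[i].vert 0).2, isWalk_ofFn _ (fun j => (ws[i].vert j : ℕ)) _⟩
      · rw [hPn h]
        obtain ⟨d, -⟩ := List.exists_mem_of_length_pos
          ((Nat.zero_le i).trans_lt (mem_walkers.1 hi).1)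
        exact ⟨d.1, d.1.2, trivial⟩
    · by_cases h : i < ws.length
      · rw [hPi h]
        exact List.pairwise_ofFn.2 fun a b hab =>
          ws[i].time_strictMono (Fin.castSucc_lt_castSucc_iff.2 hab)
      · rw [hPn h]
        exact List.Pairwise.nil
    · obtain ⟨h, he⟩ := hPe he
      obtain ⟨j, rfl⟩ := List.mem_ofFn.1 he
      have := ws[i].timeEdge j
      exact ⟨mem_edgeList.2 ⟨_, _, this.1, rfl, rfl⟩, avail_iff.2 this.2⟩
    · by_cases h : i < ws.length
      · have h1 := hS4 _ (hwsS _ (List.getElem_mem h))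
        rw [hPi h]
        unfold WalkOK at h1
        unfold Bounded
        split_ifs at h1 ⊢ with hμ
        · simpa [edgesOf] using h1
        · refine ⟨ws[i].time 0, fun e he => ?_⟩
          obtain ⟨j, rfl⟩ := List.mem_ofFn.1 he
          have h2 := ws[i].time_strictMono.monotone (Fin.zero_le j.castSucc)
          have h3 := ws[i].time_strictMono (Fin.castSucc_lt_last j)
          unfold TemporalWalk.lifespan at h1
          dsimp only
          omega
      · rw [hPn h]
        unfold Bounded
        split_ifs <;> simp
    · obtain ⟨h, he⟩ := hPe he
      obtain ⟨h', he'⟩ := hPe he'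
      obtain ⟨u, v, t⟩ := e
      obtain ⟨a, b, h1, h2, h3⟩ := mem_edgesOf.1 he
      obtain ⟨a', b', h1', h2', h3'⟩ := mem_edgesOf.1 he'
      obtain rfl : a = a' := Fin.ext (h2.trans h2'.symm)
      obtain rfl : b = b' := Fin.ext (h3.trans h3'.symm)
      have h4 : ws[i] = ws[j] := by
        by_contra hne
        exact Set.disjoint_left.1 (hS1 (hwsS _ (List.getElem_mem h))
          (hwsS _ (List.getElem_mem h')) hne) h1 h1'
      exact (hnd.getElem_inj_iff).1 h4
    · obtain ⟨u, v, t⟩ := d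
      obtain ⟨a, b, h1, rfl, rfl⟩ := mem_demandList.1 hd
      have h2 : q ⟨_, h1⟩ ∈ ws := by
        rw [hws, Finset.mem_toList, hS', List.mem_toFinset]
        exact List.mem_map_of_mem (List.mem_attach _ _)
      obtain ⟨i, hi, h3⟩ := List.getElem_of_mem h2
      refine ⟨i, mem_walkers.2 ⟨hi.trans_le hlen.1, hi.trans_le hlen.2⟩, ?_⟩
      rw [hPi hi, h3]
      exact mem_edgesOf.2 ⟨a, b, hq ⟨_, h1⟩, rfl, rfl⟩

end TEDSC

namespace TEDSC

/-! ### Correctness of the dynamic program -/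

section correctness

variable {I : Instance} {μ : Bool}

/-- The state in which the data of walker `i` are `f i`. -/
def stateOf (I : Instance) (f : ℕ → Pos) : List (ℕ × Pos) := I.walkers.reverse.map fun i => (i, f i)

theorem mem_foldl_states {Q : List Pos} {ws : List ℕ} (hws : ws.Nodup) (s : List (ℕ × Pos)) :
    s ∈ ws.foldl (fun acc i => Q.flatMap fun q => acc.map fun s => (i, q) :: s) [[]] ↔
      ∃ f : ℕ → Pos, (∀ i ∈ ws, f i ∈ Q) ∧ s = ws.reverse.map fun i => (i, f i) := by
  induction ws using List.reverseRecOn generalizing s with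
  | nil => simp
  | append_singleton l i ih =>
    rw [List.nodup_append] at hws
    obtain ⟨h1, -, h2⟩ := hws
    have hi : i ∉ l := fun h => h2 i h i (by simp) rfl
    rw [List.foldl_append, List.foldl_cons, List.foldl_nil]
    simp only [List.mem_flatMap, List.mem_map, ih h1, List.reverse_append, List.reverse_cons,
      List.reverse_nil, List.nil_append, List.singleton_append, List.map_cons]
    constructor
    · rintro ⟨q, hq, _, ⟨f, hf, rfl⟩, rfl⟩
      have hne : ∀ j ∈ l, j ≠ i := fun j hj h => hi (h ▸ hj)
      refine ⟨Function.update f i q, fun j hj => ?_, ?_⟩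
      · rcases List.mem_append.1 hj with hj | hj
        · rw [Function.update_of_ne (hne j hj)]
          exact hf j hj
        · rw [List.mem_singleton.1 hj, Function.update_self]
          exact hq
      · rw [Function.update_self]
        refine congrArg _ (List.map_congr_left fun j hj => ?_)
        rw [Function.update_of_ne (hne j (List.mem_reverse.1 hj))]
    · rintro ⟨f, hf, rfl⟩
      exact ⟨f i, hf i (by simp), _, ⟨f, fun j hj => hf j (by simp [hj]), rfl⟩, rfl⟩

theorem mem_states {s : List (ℕ × Pos)} :
    s ∈ I.states ↔ ∃ f : ℕ → Pos, (∀ i ∈ I.walkers, f i ∈ I.positions) ∧ s = stateOf I f :=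
  mem_foldl_states nodup_walkers s

theorem mem_positions {b : Bool} {u v w : ℕ} :
    (b, u, v, w) ∈ I.positions ↔ u < I.n ∧ v < I.n ∧ w ∈ I.labels := by
  cases b <;> simp [Instance.positions]

theorem mem_labels {w : ℕ} : w ∈ I.labels ↔ w ∈ I.times ∨ w ≤ I.times.length := by
  simp only [Instance.labels, List.mem_append, List.mem_cons, List.mem_range, List.length_cons]
  constructor
  · rintro ((h | h) | h)
    · exact .inr (by omega)
    · exact .inl h
    · exact .inr (by omega)
  · rintro (h | h)
    · exact .inl (.inr h)
    · exact .inr (by omega)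

theorem transOK_stateOf {t : ℕ} {f f' : ℕ → Pos} :
    I.transOK μ t (stateOf I f) (stateOf I f') = true ↔
      ∀ i ∈ I.walkers, I.stepOK μ t (f i) (f' i) = true := by
  simp only [Instance.transOK, stateOf, List.map_reverse, List.all_reverse, List.all_map,
    List.any_reverse, List.any_map, Bool.and_eq_true, List.all_eq_true, List.any_eq_true,
    Function.comp_apply, eqB_iff]
  exact forall₂_congr fun i hi => ⟨fun ⟨j, _, h, h'⟩ => h ▸ h', fun h => ⟨i, hi, rfl, h⟩⟩

theorem stateOK_stateOf {t : ℕ} {f : ℕ → Pos} : I.stateOK t (stateOf I f) = true ↔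
    (∀ i ∈ I.walkers, ∀ j ∈ I.walkers, (f i).1 = true → (f j).1 = true →
      (f i).2.1 = (f j).2.1 → (f i).2.2.1 = (f j).2.2.1 → i = j) ∧
    ∀ d ∈ I.demandList, d.2.2 = t → ∃ i ∈ I.walkers, (f i).1 = true ∧ (f i).2.1 = d.1 ∧
      (f i).2.2.1 = d.2.1 := by
  simp only [Instance.stateOK, stateOf, List.map_reverse, List.all_reverse, List.all_map,
    List.any_reverse, List.any_map, Bool.and_eq_true, List.all_eq_true, List.any_eq_true,
    Function.comp_apply, Bool.or_eq_true, Bool.not_eq_true', ← Bool.not_eq_true, eqB_iff, not_and,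
    ← imp_iff_not_or]
  refine and_congr_left' (forall₂_congr fun i _ => forall₂_congr fun j _ => ?_)
  rw [or_iff_not_imp_right]
  tauto

theorem stepOK_iff {t : ℕ} {q q' : Pos} : I.stepOK μ t q q' = true ↔
    if q'.1 = true then q'.2.1 = q.2.2.1 ∧ (q'.2.1, q'.2.2.1) ∈ I.edgeList ∧
      (if μ = true then q'.2.2.2 = q.2.2.2 + 1 ∧ q'.2.2.2 ≤ I.h
        else q'.2.2.2 = q.2.2.2 ∧ q.2.2.2 ≤ t ∧ t < q.2.2.2 + I.h)
    else q'.2.2.1 = q.2.2.1 ∧ q'.2.2.2 = q.2.2.2 := by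
  unfold Instance.stepOK Instance.labelOK
  split_ifs <;> simp [← Bool.not_eq_true]

/-- The states that can be reached at the end of the time steps in `l`. -/
def reachAfter (I : Instance) (μ : Bool) (l : List ℕ) : List (List (ℕ × Pos)) :=
  l.foldl (fun L t => I.states.filter fun s' => I.stateOK t s' &&
    L.any fun s => I.transOK μ t s s') (I.states.filter fun s => Instance.initOK μ s)

theorem mem_reachAfter_nil {s : List (ℕ × Pos)} :
    s ∈ reachAfter I μ [] ↔ s ∈ I.states ∧ Instance.initOK μ s = true := List.mem_filter

theorem mem_reachAfter_concat {l : List ℕ} {t : ℕ} {s' : List (ℕ × Pos)} :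
    s' ∈ reachAfter I μ (l ++ [t]) ↔ s' ∈ I.states ∧ I.stateOK t s' = true ∧
      ∃ s ∈ reachAfter I μ l, I.transOK μ t s s' = true := by
  simp [reachAfter, List.foldl_append]

theorem answer_eq_true_iff : I.answer μ = true ↔ ∃ s, s ∈ reachAfter I μ I.times := by
  rw [Instance.answer, Bool.not_eq_true', List.isEmpty_eq_false_iff_exists_mem]
  rfl

theorem initOK_stateOf {f : ℕ → Pos} : Instance.initOK μ (stateOf I f) = true ↔
    (μ = true → ∀ i ∈ I.walkers, (f i).2.2.2 = 0) := by
  cases μ <;> simp [Instance.initOK, stateOf]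

/-- The walk `p`, with moves at the time steps in `l`, ends with the data `q` of a walker. -/
structure Traced (I : Instance) (μ : Bool) (l : List ℕ) (p : List TEdge) (q : Pos) : Prop where
  isWalk : ∃ x < I.n, IsWalk x p ∧ walkEnd x p = q.2.2.1
  increasing : Increasing p
  edge : ∀ e ∈ p, (e.1, e.2.1) ∈ I.edgeList ∧ e.2.2 ∈ l
  label : if μ = true then q.2.2.2 = p.length ∧ p.length ≤ I.h
    else ∀ e ∈ p, q.2.2.2 ≤ e.2.2 ∧ e.2.2 < q.2.2.2 + I.h

theorem Traced.step {l : List ℕ} {t : ℕ} {p : List TEdge} {q q' : Pos} (h : Traced I μ l p q)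
    (hl : ∀ s ∈ l, s < t) (hs : I.stepOK μ t q q' = true) :
    Traced I μ (l ++ [t]) (p ++ if q'.1 = true then [(q'.2.1, q'.2.2.1, t)] else []) q' := by
  obtain ⟨⟨x, hx, h1, h2⟩, h3, h4, h5⟩ := h
  rw [stepOK_iff] at hs
  have h4' : ∀ e ∈ p, (e.1, e.2.1) ∈ I.edgeList ∧ e.2.2 ∈ l ++ [t] := fun e he =>
    ⟨(h4 e he).1, List.mem_append_left _ (h4 e he).2⟩
  by_cases hq : q'.1 = true
  · rw [if_pos hq] at hs ⊢
    obtain ⟨h6, h7, h8⟩ := hs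
    refine ⟨⟨x, hx, isWalk_append.2 ⟨h1, h6.trans h2.symm, trivial⟩, walkEnd_append _ _ _⟩,
      List.pairwise_append.2 ⟨h3, List.pairwise_singleton _ _, fun e he e' he' => ?_⟩,
      fun e he => ?_, ?_⟩
    · rw [List.mem_singleton.1 he']
      exact hl _ (h4 e he).2
    · rcases List.mem_append.1 he with he | he
      · exact h4' e he
      · rw [List.mem_singleton.1 he]
        exact ⟨h7, by simp⟩
    · split_ifs at h5 h8 ⊢
      · rw [List.length_append, List.length_singleton, ← h5.1]
        exact ⟨h8.1, h8.1 ▸ h8.2⟩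
      · intro e he
        rw [h8.1]
        rcases List.mem_append.1 he with he | he
        · exact h5 e he
        · rw [List.mem_singleton.1 he]
          exact h8.2
  · rw [if_neg hq] at hs ⊢
    rw [List.append_nil]
    refine ⟨⟨x, hx, h1, h2.trans hs.1.symm⟩, h3, h4', ?_⟩
    rw [hs.2]
    exact h5

/-- The data of the reachable states are those of families of walks that meet the demands. -/
theorem exists_traced {l : List ℕ} (hl : l.Pairwise (· < ·)) {s : List (ℕ × Pos)}
    (hs : s ∈ reachAfter I μ l) : ∃ (f : ℕ → Pos) (P : ℕ → List TEdge),
      s = stateOf I f ∧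
      (∀ i ∈ I.walkers, Traced I μ l (P i) (f i)) ∧
      (∀ i ∈ I.walkers, ∀ j ∈ I.walkers, ∀ e ∈ P i, e ∈ P j → i = j) ∧
      ∀ d ∈ I.demandList, d.2.2 ∈ l → ∃ i ∈ I.walkers, d ∈ P i := by
  induction l using List.reverseRecOn generalizing s with
  | nil =>
    obtain ⟨h1, h2⟩ := mem_reachAfter_nil.1 hs
    obtain ⟨f, hf, rfl⟩ := mem_states.1 h1
    rw [initOK_stateOf] at h2
    refine ⟨f, fun _ => [], rfl, fun i hi => ⟨⟨_, (mem_positions.1 (hf i hi)).2.1, trivial, rfl⟩,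
      List.Pairwise.nil, by simp, ?_⟩, by simp, by simp⟩
    split_ifs with hμ
    · exact ⟨h2 hμ i hi, Nat.zero_le _⟩
    · simp
  | append_singleton l t ih =>
    obtain ⟨hl1, -, hl2⟩ := List.pairwise_append.1 hl
    have hlt : ∀ s ∈ l, s < t := fun s hs => hl2 s hs t (by simp)
    obtain ⟨h1, h2, s, h3, h4⟩ := mem_reachAfter_concat.1 hs
    obtain ⟨f', -, rfl⟩ := mem_states.1 h1
    obtain ⟨f, P, rfl, hP1, hP2, hP3⟩ := ih hl1 h3
    rw [transOK_stateOf] at h4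
    obtain ⟨h5, h6⟩ := stateOK_stateOf.1 h2
    -- an edge of the new walk is an old one, or the edge along which the walker has just moved
    have hmem : ∀ i e, e ∈ (P i ++ if (f' i).1 = true then [((f' i).2.1, (f' i).2.2.1, t)] else [])
        ↔ e ∈ P i ∨ (f' i).1 = true ∧ e = ((f' i).2.1, (f' i).2.2.1, t) := by
      intro i e
      split_ifs with h <;> simp [h]
    refine ⟨f', _, rfl, fun i hi => (hP1 i hi).step hlt (h4 i hi), fun i hi j hj e he he' => ?_,
      fun d hd hdl => ?_⟩
    · rw [hmem] at he he'
      have hold : ∀ j ∈ I.walkers, e ∈ P j → e.2.2 ≠ t := fun j hj h =>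
        (hlt _ ((hP1 j hj).edge e h).2).ne
      rcases he with he | ⟨he, rfl⟩ <;> rcases he' with he' | ⟨he', h⟩
      · exact hP2 i hi j hj e he he'
      · exact absurd (congrArg (fun e => e.2.2) h) (hold i hi he)
      · exact absurd rfl (hold j hj he')
      · simp only [Prod.mk.injEq] at h
        exact h5 i hi j hj he he' h.1 h.2.1
    · simp only [hmem]
      rcases List.mem_append.1 hdl with hdl | hdl
      · obtain ⟨i, hi, h⟩ := hP3 d hd hdl
        exact ⟨i, hi, .inl h⟩
      · rw [List.mem_singleton] at hdl
        obtain ⟨i, hi, h7, h8, h9⟩ := h6 d hd hdl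
        exact ⟨i, hi, .inr ⟨h7, by rw [h8, h9, ← hdl]⟩⟩

theorem exists_isPlan_of_answer (h : I.answer μ = true) : ∃ P, IsPlan I (· ∈ I.times) μ P := by
  obtain ⟨s, hs⟩ := answer_eq_true_iff.1 h
  obtain ⟨f, P, -, h1, h2, h3⟩ := exists_traced (sort_sorted _) hs
  refine ⟨P, fun i hi => ?_, fun i hi => (h1 i hi).increasing, fun i hi => (h1 i hi).edge,
    fun i hi => ?_, h2, fun d hd => h3 d hd ?_⟩
  · obtain ⟨x, hx, h4, -⟩ := (h1 i hi).isWalk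
    exact ⟨x, hx, h4⟩
  · have h4 := (h1 i hi).label
    unfold Bounded
    split_ifs at h4 ⊢
    · exact h4.2
    · exact ⟨_, h4⟩
  · have h4 : d.2.2 ∈ I.demandTimes := List.mem_map.2 ⟨d, hd, rfl⟩
    exact mem_times.2 ⟨⟨_, h4, le_rfl, Nat.le_add_right _ _⟩, _, h4, le_rfl⟩

/-- The moves of a walk at the time steps in `l`. -/
def movesIn (l : List ℕ) (p : List TEdge) : List TEdge := p.filter fun e => decide (e.2.2 ∈ l)

/-- At time `t`, a walk either rests or traverses one edge, which follows its earlier moves. -/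
theorem movesIn_concat {l : List ℕ} {t : ℕ} {p : List TEdge} (hp : Increasing p)
    (hl : ∀ s ∈ l, s < t) (hpl : ∀ e ∈ p, e.2.2 ∈ l ∨ t ≤ e.2.2) :
    (movesIn (l ++ [t]) p = movesIn l p ∧ ∀ e ∈ p, e.2.2 ≠ t) ∨
      ∃ e C, p = movesIn l p ++ e :: C ∧ e.2.2 = t ∧ movesIn (l ++ [t]) p = movesIn l p ++ [e] ∧
        ∀ e' ∈ p, e'.2.2 = t → e' = e := by
  induction p with
  | nil => exact .inl ⟨rfl, by simp⟩
  | cons e p ih =>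
    obtain ⟨h1, h2⟩ := List.pairwise_cons.1 hp
    have ht : t ∉ l := fun h => lt_irrefl _ (hl t h)
    by_cases he : e.2.2 ∈ l
    · have e1 : movesIn l (e :: p) = e :: movesIn l p := by simp [movesIn, he]
      have e2 : movesIn (l ++ [t]) (e :: p) = e :: movesIn (l ++ [t]) p := by simp [movesIn, he]
      have het : e.2.2 ≠ t := fun h => ht (h ▸ he)
      rw [e1, e2]
      rcases ih h2 fun e he => hpl e (List.mem_cons_of_mem _ he) with
        ⟨h3, h4⟩ | ⟨c, C, h3, h4, h5, h6⟩
      · exact .inl ⟨by rw [h3], List.forall_mem_cons.2 ⟨het, h4⟩⟩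
      · exact .inr ⟨c, C, congrArg _ h3, h4, by rw [h5]; rfl,
          List.forall_mem_cons.2 ⟨fun h => absurd h het, h6⟩⟩
    · have hte := (hpl e (by simp)).resolve_left he
      have hlater : ∀ c ∈ p, t < c.2.2 := fun c hc => hte.trans_lt (h1 c hc)
      have e1 : movesIn l (e :: p) = [] := by
        refine List.filter_eq_nil_iff.2 (List.forall_mem_cons.2 ⟨by simpa using he, fun c hc => ?_⟩)
        rw [decide_eq_true_iff]
        exact fun h => lt_asymm (hl _ h) (hlater c hc)
      have e2 : movesIn (l ++ [t]) p = [] := by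
        refine List.filter_eq_nil_iff.2 fun c hc => ?_
        rw [decide_eq_true_iff, List.mem_append, List.mem_singleton]
        rintro (h | h)
        · exact lt_asymm (hl _ h) (hlater c hc)
        · exact (hlater c hc).ne' h
      rw [e1]
      by_cases het : e.2.2 = t
      · refine .inr ⟨e, p, rfl, het, ?_, List.forall_mem_cons.2 ⟨fun _ => rfl, fun c hc h =>
          absurd h (hlater c hc).ne'⟩⟩
        have : movesIn (l ++ [t]) (e :: p) = e :: movesIn (l ++ [t]) p := by simp [movesIn, het]
        rw [this, e2]
        rfl
      · refine .inl ⟨?_, List.forall_mem_cons.2 ⟨het, fun c hc => (hlater c hc).ne'⟩⟩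
        have : movesIn (l ++ [t]) (e :: p) = movesIn (l ++ [t]) p := by simp [movesIn, he, het]
        rw [this, e2]

/-- The data `q` describe the walk `p` from `x` after the time steps in `l`, where `w` is a lower
bound for its time steps. -/
structure Follows (I : Instance) (μ : Bool) (x w : ℕ) (p : List TEdge) (l : List ℕ) (q : Pos) :
    Prop where
  mem : q ∈ I.positions
  vert : q.2.2.1 = walkEnd x (movesIn l p)
  label : q.2.2.2 = if μ = true then (movesIn l p).length else w

/-- A walk that can be described by the data of a walker. -/
structure Admissible (I : Instance) (μ : Bool) (x w : ℕ) (p : List TEdge) : Prop where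
  lt : x < I.n
  isWalk : IsWalk x p
  increasing : Increasing p
  edge : ∀ e ∈ p, (e.1, e.2.1) ∈ I.edgeList ∧ e.2.2 ∈ I.times
  mem : w ∈ I.labels
  bounded : if μ = true then p.length ≤ I.h else ∀ e ∈ p, w ≤ e.2.2 ∧ e.2.2 < w + I.h

theorem Admissible.label_mem {x w : ℕ} {p : List TEdge} (h : Admissible I μ x w p) (l : List ℕ) :
    (if μ = true then (movesIn l p).length else w) ∈ I.labels := by
  split_ifs
  · refine mem_labels.2 (.inr ((List.length_filter_le _ _).trans ?_))
    have h1 : (p.map fun e => e.2.2).Nodup :=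
      List.pairwise_map.2 (h.increasing.imp fun h => h.ne)
    have h2 : (p.map fun e => e.2.2) ⊆ I.times := fun t ht => by
      obtain ⟨e, he, rfl⟩ := List.mem_map.1 ht
      exact (h.edge e he).2
    simpa using (h1.subperm h2).length_le
  · exact h.mem

theorem Admissible.exists_init {x w : ℕ} {p : List TEdge} (h : Admissible I μ x w p) :
    ∃ q, Follows I μ x w p [] q := by
  have e : movesIn [] p = [] := by simp [movesIn]
  exact ⟨(false, x, x, _), mem_positions.2 ⟨h.lt, h.lt, h.label_mem []⟩, by rw [e]; rfl, rfl⟩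

theorem Admissible.exists_step {x w : ℕ} {p : List TEdge} (h : Admissible I μ x w p) {l : List ℕ}
    {t : ℕ} (hl : ∀ s ∈ l, s < t) (hpl : ∀ e ∈ p, e.2.2 ∈ l ∨ t ≤ e.2.2) {q : Pos}
    (hq : Follows I μ x w p l q) : ∃ q', Follows I μ x w p (l ++ [t]) q' ∧
      I.stepOK μ t q q' = true ∧
      ∀ u v, (u, v, t) ∈ p ↔ q'.1 = true ∧ q'.2.1 = u ∧ q'.2.2.1 = v := by
  have hlab := h.label_mem (l ++ [t])
  rcases movesIn_concat h.increasing hl hpl with ⟨h1, h2⟩ | ⟨e, C, h1, rfl, h2, h3⟩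
  · -- the walker rests
    refine ⟨(false, q.2.1, q.2.2.1, q.2.2.2), ⟨?_, ?_, ?_⟩, ?_, fun u v => ?_⟩
    · have := hq.mem
      rw [show q = (q.1, q.2.1, q.2.2.1, q.2.2.2) from rfl, mem_positions] at this
      exact mem_positions.2 this
    · rw [h1]; exact hq.vert
    · rw [h1]; exact hq.label
    · exact stepOK_iff.2 (by simp)
    · simpa using fun h => h2 _ h rfl
  · -- the walker moves along `e`
    have he : e ∈ p := by rw [h1]; simp
    obtain ⟨h4, -⟩ := h.edge e he
    have hw := h.isWalk
    rw [h1, isWalk_append] at hw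
    refine ⟨(true, e.1, e.2.1, _), ⟨mem_positions.2 ⟨(lt_of_mem_edgeList h4).1,
      (lt_of_mem_edgeList h4).2, hlab⟩, ?_, rfl⟩, stepOK_iff.2 ?_, fun u v => ⟨fun huv => ?_, ?_⟩⟩
    · rw [h2, walkEnd_append]; rfl
    · rw [if_pos rfl]
      refine ⟨hw.2.1.trans hq.vert.symm, h4, ?_⟩
      have h5 := hq.label
      have h6 := h.bounded
      split_ifs at h5 h6 ⊢
      · have h7 := congrArg List.length h1
        rw [List.length_append, List.length_cons] at h7
        dsimp only
        rw [h2, List.length_append, List.length_singleton, h5]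
        exact ⟨rfl, by omega⟩
      · rw [h5]
        exact ⟨rfl, h6 e he⟩
    · rw [← h3 _ huv rfl]
      exact ⟨rfl, rfl, rfl⟩
    · rintro ⟨-, rfl, rfl⟩
      exact he

/-- A solution gives a sequence of reachable states. -/
theorem exists_mem_reachAfter {P : ℕ → List TEdge} {x w : ℕ → ℕ}
    (hP : ∀ i ∈ I.walkers, Admissible I μ (x i) (w i) (P i))
    (hdisj : ∀ i ∈ I.walkers, ∀ j ∈ I.walkers, ∀ e ∈ P i, e ∈ P j → i = j)
    (hdem : ∀ d ∈ I.demandList, ∃ i ∈ I.walkers, d ∈ P i) (l r : List ℕ) (hlr : I.times = l ++ r) :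
    ∃ f, stateOf I f ∈ reachAfter I μ l ∧
      ∀ i ∈ I.walkers, Follows I μ (x i) (w i) (P i) l (f i) := by
  induction l using List.reverseRecOn generalizing r with
  | nil =>
    choose! f hf using fun i hi => (hP i hi).exists_init
    refine ⟨f, mem_reachAfter_nil.2 ⟨mem_states.2 ⟨f, fun i hi => (hf i hi).mem, rfl⟩,
      initOK_stateOf.2 fun hμ i hi => ?_⟩, hf⟩
    rw [(hf i hi).label, if_pos hμ]
    simp [movesIn]
  | append_singleton l t ih =>
    rw [List.append_assoc] at hlr
    obtain ⟨f, hf1, hf2⟩ := ih _ hlr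
    have hsort := sort_sorted (I.demandTimes.flatMap fun d => (I.delays.map fun j => d + j).filter
      fun t => I.demandTimes.any fun d' => !ltB d' t)
    change I.times.Pairwise (· < ·) at hsort
    rw [hlr, List.pairwise_append] at hsort
    obtain ⟨-, h1, h2⟩ := hsort
    have hl : ∀ s ∈ l, s < t := fun s hs => h2 s hs t (by simp)
    have hpl : ∀ i ∈ I.walkers, ∀ e ∈ P i, e.2.2 ∈ l ∨ t ≤ e.2.2 := fun i hi e he => by
      have h3 := ((hP i hi).edge e he).2
      rw [hlr] at h3
      rcases List.mem_append.1 h3 with h3 | h3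
      · exact .inl h3
      · rcases List.mem_cons.1 h3 with h3 | h3
        · exact .inr h3.ge
        · exact .inr ((List.pairwise_cons.1 h1).1 _ h3).le
    choose! f' hf' hstep hmem using fun i hi => (hP i hi).exists_step hl (hpl i hi) (hf2 i hi)
    refine ⟨f', mem_reachAfter_concat.2 ⟨mem_states.2 ⟨f', fun i hi => (hf' i hi).mem, rfl⟩,
      stateOK_stateOf.2 ⟨fun i hi j hj h3 h4 h5 h6 => ?_, fun d hd hdt => ?_⟩, _, hf1,
      transOK_stateOf.2 hstep⟩, hf'⟩
    · exact hdisj i hi j hj _ ((hmem i hi _ _).2 ⟨h3, rfl, rfl⟩)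
        ((hmem j hj _ _).2 ⟨h4, h5.symm, h6.symm⟩)
    · obtain ⟨i, hi, h3⟩ := hdem d hd
      subst hdt
      exact ⟨i, hi, (hmem i hi _ _).1 h3⟩

theorem answer_of_isPlan {P : ℕ → List TEdge} (h : IsPlan I (· ∈ I.times) μ P) :
    I.answer μ = true := by
  have key : ∀ i ∈ I.walkers, ∃ x w, Admissible I μ x w (P i) := by
    intro i hi
    obtain ⟨x, hx, hw⟩ := h.isWalk i hi
    have hb := h.bounded i hi
    have hinc := h.increasing i hi
    have hedge := h.edge i hi
    have h0 : 0 ∈ I.labels := mem_labels.2 (.inr (Nat.zero_le _))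
    unfold Bounded at hb
    by_cases hμ : μ = true
    · rw [if_pos hμ] at hb
      exact ⟨x, 0, hx, hw, hinc, hedge, h0, by rwa [if_pos hμ]⟩
    · rw [if_neg hμ] at hb
      obtain ⟨s, hs⟩ := hb
      rcases hPi : P i with _ | ⟨e, p⟩
      · exact ⟨x, 0, hx, trivial, List.Pairwise.nil, by simp, h0, by simp [hμ]⟩
      · -- the time of the first move is a lower bound for all of them
        rw [hPi] at hw hinc hedge hs
        refine ⟨x, e.2.2, hx, hw, hinc, hedge, mem_labels.2 (.inl (hedge e (by simp)).2), ?_⟩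
        rw [if_neg hμ]
        have h1 := (hs e (by simp)).1
        intro c hc
        refine ⟨?_, (hs c hc).2.trans_le (by omega)⟩
        rcases List.mem_cons.1 hc with rfl | hc
        · exact le_rfl
        · exact ((List.pairwise_cons.1 hinc).1 c hc).le
  choose! x w hxw using key
  obtain ⟨f, hf, -⟩ := exists_mem_reachAfter hxw h.disjoint h.demand I.times []
    (List.append_nil _).symm
  exact answer_eq_true_iff.2 ⟨_, hf⟩

/-- The dynamic program decides the problem selected by `μ`. -/
theorem answer_iff (I : Instance) (μ : Bool) : I.answer μ = true ↔
    ∃ S : Finset (TemporalWalk (temporalGraph I.graph I.draft)),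
      IsSchedule S ∧ Extends S ∧ S.card ≤ I.k ∧ ∀ p ∈ S, WalkOK μ I.h p := by
  rw [← exists_isPlan_iff]
  constructor
  · intro h
    obtain ⟨P, hP⟩ := exists_isPlan_of_answer h
    exact ⟨P, hP.of_times⟩
  · rintro ⟨P, hP⟩
    obtain ⟨P', hP'⟩ := hP.exists_times
    exact answer_of_isPlan hP'

end correctness

end TEDSC

namespace TEDSC

/-! ### The running time -/

theorem answer_true_iff (I : Instance) :
    I.answer true = true ↔ LengthFeasible I.graph I.draft I.k I.h := by
  simp [answer_iff, WalkOK, LengthFeasible]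

theorem answer_false_iff (I : Instance) :
    I.answer false = true ↔ LifespanFeasible I.graph I.draft I.k I.h := by
  simp [answer_iff, WalkOK, LifespanFeasible]

open Classical in
/-- A problem that is answered by the dynamic program is decided by a machine, uniformly in the
instances, with running time `|I| ^ (c' (k + 1))` for all sufficiently large `c'`. -/
theorem exists_machine_of_answer (μ : Bool) (yes : Instance → Prop)
    (h : ∀ I, I.answer μ = true ↔ yes I) : ∃ c, ∀ c' ≥ c,
    ∃ M : Turing.TM2ComputableAux Sym Bool, (∀ i : M.tm.K, Finite (M.tm.Γ i)) ∧
      ∀ I : Instance, Nonempty (Turing.TM2OutputsInTime M.tm (I.encode.map M.inputAlphabet.invFun)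
        (some ((Computability.encodeBool (decide (yes I))).map M.outputAlphabet.invFun))
        (I.encode.length ^ (c' * (I.k + 1)))) := by
  obtain ⟨b, M, hb, hM, hI⟩ := (FPB.answer μ).exists_machine
  obtain ⟨c, hc⟩ := exists_pow_bound hb
  refine ⟨c, fun c' hc' => ⟨M, hM, fun I => ?_⟩⟩
  have e : decide (yes I) = I.answer μ := by
    rw [Bool.eq_iff_iff, decide_eq_true_iff, h]
  rw [e]
  exact hI I _ (hc c' hc' I)

/-- A decision procedure of running time `|I| ^ (c (k + 1))` witnesses membership in XP. -/
theorem ParamProblem.DecidableInTime.inXP {P : ParamProblem} {c : ℕ}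
    (h : P.DecidableInTime fun I => P.size I ^ (c * (P.param I + 1))) : P.InXP := by
  refine ⟨fun _ => 1, fun k => c * (k + 1), Computable.const _, ?_, ?_⟩
  · exact (Primrec.nat_mul.comp (Primrec.const c) Primrec.succ).to_comp
  · simpa only [one_mul] using h

end TEDSC

theorem mainTheorem10 :
    (TEDSC.lengthTEDSC.InXP ∧ TEDSC.lifespanTEDSC.InXP) ∧
    ∃ c : ℕ,
      TEDSC.lengthTEDSC.DecidableInTime
        (fun I => TEDSC.lengthTEDSC.size I ^ (c * (TEDSC.lengthTEDSC.param I + 1))) ∧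
      TEDSC.lifespanTEDSC.DecidableInTime
        (fun I => TEDSC.lifespanTEDSC.size I ^ (c * (TEDSC.lifespanTEDSC.param I + 1))) := by
  obtain ⟨c₁, h₁⟩ := TEDSC.exists_machine_of_answer true _ TEDSC.answer_true_iff
  obtain ⟨c₂, h₂⟩ := TEDSC.exists_machine_of_answer false _ TEDSC.answer_false_iff
  have h₁' : TEDSC.lengthTEDSC.DecidableInTime
      (fun I => TEDSC.lengthTEDSC.size I ^ (max c₁ c₂ * (TEDSC.lengthTEDSC.param I + 1))) :=
    h₁ _ (le_max_left _ _)
  have h₂' : TEDSC.lifespanTEDSC.DecidableInTime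
      (fun I => TEDSC.lifespanTEDSC.size I ^ (max c₁ c₂ * (TEDSC.lifespanTEDSC.param I + 1))) :=
    h₂ _ (le_max_right _ _)
  exact ⟨⟨h₁'.inXP, h₂'.inXP⟩, _, h₁', h₂'⟩
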